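/- Let $n\ge 2$ and let $\mathbb{R}[x,\theta]=\mathbb{R}[x,\theta_1,\dots,\theta_n]$ be the superalgebra of polynomials in one even variable $x$ and $n$ odd (anticommuting) variables $\theta_i$. Write $\partial_x=\partial/\partial x$, $\partial_i=\partial/\partial\theta_i$ (left derivative), $F'=\partial_xF$, $\eta_i=\partial_i-\theta_i\partial_x$, and let $|F|$ be the parity of $F$ (formulas containing $|F|$ are extended by linearity from homogeneous elements). The Lie superalgebra $\mathcal{K}(n)$ of contact polynomial vector fields on $\mathbb{R}^{1|n}$, for the contact form $\alpha_n=dx+\sum_i\theta_i\,d\theta_i$, consists of the fields $$X_H=H\partial_x-\tfrac12\sum_{i=1}^n(-1)^{|H|}\eta_i(H)\,\eta_i,\qquad H\in\mathbb{R}[x,\theta].$$ For $\lambda\in\mathbb{R}$ let $\mathbb{F}^n_\lambda=\{F\alpha_n^\lambda : F\in\mathbb{R}[x,\theta]\}$ be the $\mathcal{K}(n)$-module of weighted densities, on which $X_H$ acts by $\mathbb{L}^\lambda_{X_H}=X_H+\lambda H'$. A binary differential operator $\mathbb{F}^n_\lambda\otimes\mathbb{F}^n_\mu\to\mathbb{F}^n_\nu$,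 $F\alpha_n^\lambda\otimes G\alpha_n^\mu\mapsto T(F,G)\alpha_n^\nu$, is one given by a finite sum of terms $(-1)^{|\delta||F|}a\,\partial_x^k\partial^{\varepsilon}(F)\,\partial_x^l\partial^{\delta}(G)$, where $a\in\mathbb{R}[x,\theta]$, $k,l\in\mathbb{N}$, $\varepsilon,\delta\in\{0,1\}^n$, $\partial^\varepsilon=\partial_1^{\varepsilon_1}\cdots\partial_n^{\varepsilon_n}$ and $|\delta|=\sum_i\delta_i$. It is $\mathcal{K}(n)$-invariant if $X_H\cdot T=0$ for every $H$, where, for homogeneous $H$, $T$ and $F$, $$(X_H\cdot T)(F,G)=\mathbb{L}^\nu_{X_H}T(F,G)-(-1)^{|T||H|}\Big(T(\mathbb{L}^\lambda_{X_H}F,G)+(-1)^{|H||F|}T(F,\mathbb{L}^\mu_{X_H}G)\Big),$$ and $X_H\cdot T$ is extended linearly to non-homogeneous $T$. Define $$\begin{aligned} \mathfrak{a}(F,G)&=FG,\\ \mathfrak{b}(F,G)&=\mu F'G-\lambda FG'-\tfrac12(-1)^{|F|}\sum_{i=1}^n\eta_i(F)\eta_i(G),\\ \mathfrak{c}(F,G)&=(-1)^{|F|}\big(\eta_1(F)\eta_2(G)-\eta_2(F)\eta_1(G)\big)+2\mu\,\eta_2(\eta_1(F))\,G,\\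 \mathfrak{d}(F,G)&=(-1)^{|F|}\big(\eta_1(F)\eta_2(G)-\eta_2(F)\eta_1(G)\big)+2\lambda F\,\eta_2(\eta_1(G)),\\ \mathfrak{e}(F,G)&=(-1)^{|F|}(\lambda+\tfrac12)\big(\eta_1(F)\eta_2(G)-\eta_2(F)\eta_1(G)\big)+\lambda F\,\eta_1(\eta_2(G))+(\lambda+1)\,\eta_1(\eta_2(F))\,G. \end{aligned}$$ Then, for all $\lambda,\mu,\nu\in\mathbb{R}$: If there is a nonzero $\mathcal{K}(n)$-invariant binary differential operator $\mathbb{F}^n_\lambda\otimes\mathbb{F}^n_\mu\to\mathbb{F}^n_\nu$, then $\nu=\lambda+\mu$ or $\nu=\lambda+\mu+1$. Moreover: (a) If $\nu=\lambda+\mu$, the $\mathcal{K}(n)$-invariant binary differential operators are exactly the operators $\alpha\mathfrak{a}$, $\alpha\in\mathbb{R}$. (b) If $\nu=\lambda+\mu+1$ and either $n>2$, or $n=2$ and $\lambda\mu\nu\ne0$, they are exactly the operators $\alpha\mathfrak{b}$, $\alpha\in\mathbb{R}$. If $\nu=\lambda+\mu+1$, $n=2$ and $\lambda\mu\nu=0$,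 they are exactly the operators $\alpha\mathfrak{b}+\beta\mathfrak{c}$ when $\lambda=0$, exactly the operators $\alpha\mathfrak{b}+\beta\mathfrak{d}$ when $\mu=0$, and exactly the operators $\alpha\mathfrak{b}+\beta\mathfrak{e}$ when $\nu=0$, with $\alpha,\beta\in\mathbb{R}$ (when two of the weights vanish, both corresponding descriptions hold). -/

import Mathlib

/-! Polynomial functions, contact vector fields, weighted densities and binary differential
operators on the superspace with one even coordinate `x` and `n` odd coordinates `θ_i`. -/

/-- The superalgebra `ℝ[x, θ_1, …, θ_n]`: polynomials in the (central) variable `x` whose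
coefficients lie in the exterior algebra on `θ_1, …, θ_n`. -/
abbrev SuperPoly (n : ℕ) : Type :=
  Polynomial (ExteriorAlgebra ℝ (Fin n → ℝ))

namespace SuperPoly

noncomputable section

variable {n : ℕ}

/-- The odd coordinate `θ_i`. -/
def theta (i : Fin n) : SuperPoly n :=
  Polynomial.C (ExteriorAlgebra.ι ℝ (Pi.single i (1 : ℝ)))

/-- The parity automorphism `F ↦ (-1)^{|F|} F`. -/
def sigma (n : ℕ) : SuperPoly n →ₗ[ℝ] SuperPoly n :=
  (Polynomial.mapAlgHom (R := ℝ)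
    (CliffordAlgebra.involute (Q := (0 : QuadraticForm ℝ (Fin n → ℝ))))).toLinearMap

/-- `F` is homogeneous of parity `p` (even for `p = 0`, odd for `p = 1`). -/
def HasParity (p : Fin 2) (F : SuperPoly n) : Prop :=
  sigma n F = (-1 : ℝ) ^ (p : ℕ) • F

/-- The even derivation `∂_x`. -/
def partialX (n : ℕ) : SuperPoly n →ₗ[ℝ] SuperPoly n :=
  Polynomial.derivative.restrictScalars ℝ

/-- The odd (left) derivation `∂_i = ∂/∂θ_i`, acting coefficientwise. -/
def partialTheta (i : Fin n) : SuperPoly n →ₗ[ℝ] SuperPoly n :=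
  Polynomial.lsum fun k =>
    ((Polynomial.monomial k).restrictScalars ℝ) ∘ₗ
      CliffordAlgebra.contractLeft (Q := (0 : QuadraticForm ℝ (Fin n → ℝ))) (LinearMap.proj i)

/-- The odd derivation `η_i = ∂_i - θ_i ∂_x`. -/
def eta (i : Fin n) : SuperPoly n →ₗ[ℝ] SuperPoly n :=
  partialTheta i - LinearMap.mulLeft ℝ (theta i) ∘ₗ partialX n

/-- The contact vector field `X_H = H ∂_x - (1/2) ∑_i (-1)^{|H|} η_i(H) η_i`, as an operator on
functions. -/
def contactField (H : SuperPoly n) : SuperPoly n →ₗ[ℝ] SuperPoly n :=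
  LinearMap.mulLeft ℝ H ∘ₗ partialX n
    - (1 / 2 : ℝ) • ∑ i : Fin n, LinearMap.mulLeft ℝ (eta i (sigma n H)) ∘ₗ eta i

/-- The action `X_H + w H'` of the contact vector field `X_H` on densities of weight `w`;
the density `F α_n^w` is represented by the function `F`. -/
def densityAction (w : ℝ) (H : SuperPoly n) : SuperPoly n →ₗ[ℝ] SuperPoly n :=
  contactField H + w • LinearMap.mulLeft ℝ (partialX n H)

/-- Bilinear operators `(F, G) ↦ T(F, G)` on `ℝ[x, θ]`. -/
abbrev BinaryOp (n : ℕ) : Type :=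
  SuperPoly n →ₗ[ℝ] SuperPoly n →ₗ[ℝ] SuperPoly n

/-- The monomial operator `∂_x^k ∂_{i_1} ⋯ ∂_{i_r}`, where `ε = {i_1 < ⋯ < i_r}`. -/
def partialMonomial (k : ℕ) (ε : Finset (Fin n)) : Module.End ℝ (SuperPoly n) :=
  (partialX n : Module.End ℝ (SuperPoly n)) ^ k *
    ((ε.sort (· ≤ ·)).map fun i => (partialTheta i : Module.End ℝ (SuperPoly n))).prod

/-- `T` is a binary differential operator: a finite sum of terms
`(F, G) ↦ (-1)^{|δ||F|} a · ∂_x^k ∂^ε(F) · ∂_x^l ∂^δ(G)` with polynomial coefficients `a`. -/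
def IsDifferential (T : BinaryOp n) : Prop :=
  ∃ (M : ℕ) (a : ℕ → Finset (Fin n) → ℕ → Finset (Fin n) → SuperPoly n),
    ∀ F G : SuperPoly n,
      T F G = ∑ k ∈ Finset.range (M + 1), ∑ ε : Finset (Fin n),
        ∑ l ∈ Finset.range (M + 1), ∑ δ : Finset (Fin n),
          a k ε l δ * partialMonomial k ε (((sigma n) ^ δ.card) F) * partialMonomial l δ G

/-- The component of parity `q` of a bilinear operator, applied to `(F, G)`. -/
def parityPart (q : Fin 2) (T : BinaryOp n) : BinaryOp n :=
  (1 / 2 : ℝ) • (T + (-1 : ℝ) ^ (q : ℕ) •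
    (T.compl₁₂ (sigma n) (sigma n)).compr₂ (sigma n))

/-- For `H` of parity `p` and `T` of parity `q`, the value at `(F, G)` of
`X_H · T = L^ν_{X_H} ∘ T - (-1)^{|T||H|} T ∘ L^{λ,μ}_{X_H}`, where
`L^{λ,μ}_{X_H}(F ⊗ G) = L^λ_{X_H} F ⊗ G + (-1)^{|H||F|} F ⊗ L^μ_{X_H} G`. -/
def actionHomogeneous (lam mu nu : ℝ) (p q : Fin 2) (H : SuperPoly n) (T : BinaryOp n)
    (F G : SuperPoly n) : SuperPoly n :=
  densityAction nu H (T F G)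
    - (-1 : ℝ) ^ ((p : ℕ) * (q : ℕ)) •
      (T (densityAction lam H F) G + T (((sigma n) ^ (p : ℕ)) F) (densityAction mu H G))

/-- `T`, not necessarily homogeneous, is annihilated by all contact vector fields when it is
regarded as an operator from densities of weights `lam`, `mu` to densities of weight `nu`. -/
def IsContactInvariant (lam mu nu : ℝ) (T : BinaryOp n) : Prop :=
  ∀ (p : Fin 2) (H : SuperPoly n), HasParity p H → ∀ F G : SuperPoly n,
    ∑ q : Fin 2, actionHomogeneous lam mu nu p q H (parityPart q T) F G = 0

/-- Invariant binary differential operators from densities of weights `lam`, `mu` to densities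
of weight `nu`. -/
def IsInvariantDifferential (lam mu nu : ℝ) (T : BinaryOp n) : Prop :=
  IsDifferential T ∧ IsContactInvariant lam mu nu T

/-- The operator `(F, G) ↦ A(F) · B(G)`. -/
def mulOp (A B : SuperPoly n →ₗ[ℝ] SuperPoly n) : BinaryOp n :=
  (LinearMap.mul ℝ (SuperPoly n)).compl₁₂ A B

/-- The product `FG`. -/
def opA (n : ℕ) : BinaryOp n :=
  mulOp LinearMap.id LinearMap.id

/-- The bracket `μ F'G - λ FG' - (1/2) (-1)^{|F|} ∑_i η_i(F) η_i(G)`. -/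
def opB (n : ℕ) (lam mu : ℝ) : BinaryOp n :=
  mu • mulOp (partialX n) LinearMap.id - lam • mulOp LinearMap.id (partialX n)
    - (1 / 2 : ℝ) • ∑ i : Fin n, mulOp (eta i ∘ₗ sigma n) (eta i)

/-- The operator `(-1)^{|F|} (η_i(F) η_j(G) - η_j(F) η_i(G))`. -/
def skewOp (i j : Fin n) : BinaryOp n :=
  mulOp (eta i ∘ₗ sigma n) (eta j) - mulOp (eta j ∘ₗ sigma n) (eta i)

/-- With `(i, j) = (1, 2)`:
`(-1)^{|F|} (η_1(F) η_2(G) - η_2(F) η_1(G)) + 2μ η_2(η_1(F)) G`. -/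
def opC (i j : Fin n) (mu : ℝ) : BinaryOp n :=
  skewOp i j + (2 * mu) • mulOp (eta j ∘ₗ eta i) LinearMap.id

/-- With `(i, j) = (1, 2)`:
`(-1)^{|F|} (η_1(F) η_2(G) - η_2(F) η_1(G)) + 2λ F η_2(η_1(G))`. -/
def opD (i j : Fin n) (lam : ℝ) : BinaryOp n :=
  skewOp i j + (2 * lam) • mulOp LinearMap.id (eta j ∘ₗ eta i)

/-- With `(i, j) = (1, 2)`:
`(-1)^{|F|} (λ + 1/2) (η_1(F) η_2(G) - η_2(F) η_1(G)) + λ F η_1(η_2(G)) + (λ + 1) η_1(η_2(F)) G`. -/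
def opE (i j : Fin n) (lam : ℝ) : BinaryOp n :=
  (lam + 1 / 2) • skewOp i j + lam • mulOp LinearMap.id (eta i ∘ₗ eta j)
    + (lam + 1) • mulOp (eta i ∘ₗ eta j) LinearMap.id

end

end SuperPoly

/-! The fields `X_1 = ∂_x` and `X_{θ_i} = ½(∂_i + θ_i ∂_x)` move the origin in every direction, so
an invariant `T` is determined by the bilinear functional `t(F, G) = T(F, G)(0)`
(`eq_zero_of_eval0_eq_zero`). What remains is invariance of `t` under the fields vanishing at the
origin (`OriginInvariant`). This turns the classification into linear algebra on the numbers `t(x^k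
θ_L, x^l θ_{L'})`.

The field of `H = x` is the Euler field. It makes such a number vanish unless `ν = λ + μ + N/2`,
where `N = 2(k + l) + |L| + |L'|` (`OriginInvariant.weight`). The crucial point is that `N` can only
be `0` or `2`, whatever the weights are (`OriginInvariant.degree`). Two mechanisms give this. For
each pair `i ≠ j`, the fields of `x^m θ_i θ_j` and `x^{m+1} θ_i` yield the recurrences
`PairRelations`. Comparing them for different `m` removes the weights and leaves a positive multiple
of each unknown, so the degree in `x, θ_i, θ_j` alone is `0` or `2` (`OriginInvariant.pair_degree`).
If `n ≥ 3`, the only configurations of larger total degree surviving all pairs have `k = l = 0` and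
every odd coordinate occurring exactly once; the cubic fields `θ_i θ_j θ_k` annihilate these.

For `N = 0` the single number `t(1, 1)` remains, and the product realises it. For `N = 2`, the
values `t(x, 1)` and `t(1, x)` are multiples of the common value `S` of all `t(θ_i, θ_i)`, and `𝔟`
realises `S`. The other unknowns are the values on `θ_i ⊗ θ_j`, `θ_i θ_j ⊗ 1` and `1 ⊗ θ_i θ_j`. If
`n ≥ 3` they vanish by a rotation involving a third index. If `n = 2`, write them as `R`, `P`, `Q`;
they satisfy the three equations of `two_relations`, whose determinant in `(P, Q, R)` is `-4λμν`.
Extra operators thus appear only when `λμν = 0`. The solution space is then a line, spanned by the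
values of `𝔠`, `𝔡` or `𝔢`.

Conversely, invariance of the listed operators is checked from the commutators of `X_H` with `∂_x`
and `η_i`, and their differential form by expanding the `η_i`. -/

namespace SuperPoly

/-! ### Calculus in the superalgebra: parity, derivations, supercommutation, evaluation at the
origin -/

noncomputable section

variable {n : ℕ}

/-- The even coordinate `x`. -/
def coordX (n : ℕ) : SuperPoly n := Polynomial.X

theorem coordX_mul (F : SuperPoly n) : coordX n * F = F * coordX n :=
  Polynomial.X_mul

/-- The parity automorphism is an algebra automorphism. -/
theorem sigma_mul (F G : SuperPoly n) : sigma n (F * G) = sigma n F * sigma n G := by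
  simp [sigma]

@[simp] theorem sigma_one : sigma n 1 = 1 := by
  simp [sigma]

@[simp] theorem sigma_coordX : sigma n (coordX n) = coordX n := by
  simp [sigma, coordX]

@[simp] theorem sigma_theta (i : Fin n) : sigma n (theta i) = -theta i := by
  have h : CliffordAlgebra.involute
      (ExteriorAlgebra.ι ℝ (Pi.single i (1 : ℝ)) : ExteriorAlgebra ℝ (Fin n → ℝ)) =
      -ExteriorAlgebra.ι ℝ (Pi.single i (1 : ℝ)) := CliffordAlgebra.involute_ι _
  simp [sigma, theta, h]

@[simp] theorem partialX_one : partialX n 1 = 0 := by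
  simp [partialX]

theorem partialX_mul (F G : SuperPoly n) :
    partialX n (F * G) = partialX n F * G + F * partialX n G := by
  simp [partialX, Polynomial.derivative_mul]

@[simp] theorem partialX_coordX : partialX n (coordX n) = 1 := by
  simp [partialX, coordX]

@[simp] theorem partialX_theta (i : Fin n) : partialX n (theta i) = 0 := by
  simp [partialX, theta]

theorem partialTheta_monomial (i : Fin n) (k : ℕ) (a : ExteriorAlgebra ℝ (Fin n → ℝ)) :
    partialTheta i (Polynomial.monomial k a) = Polynomial.monomial k
      (CliffordAlgebra.contractLeft (Q := (0 : QuadraticForm ℝ (Fin n → ℝ)))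
        (LinearMap.proj i) a) := by
  simp [partialTheta, Polynomial.lsum_apply]

/-- Every superpolynomial is obtained from `1` by linear combinations and left multiplications by
the coordinates. -/
theorem induction {P : SuperPoly n → Prop} (F : SuperPoly n) (one : P 1)
    (add : ∀ F G, P F → P G → P (F + G)) (smul : ∀ (r : ℝ) F, P F → P (r • F))
    (x_mul : ∀ F, P F → P (coordX n * F)) (theta_mul : ∀ i F, P F → P (theta i * F)) : P F := by
  have zero : P 0 := by simpa using smul 0 1 one
  have sum : ∀ (s : Finset (Fin n)) (f : Fin n → SuperPoly n), (∀ i, P (f i)) →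
      P (∑ i ∈ s, f i) := by
    intro s f hf
    induction s using Finset.induction_on with
    | empty => simpa using zero
    | insert a s ha ih => rw [Finset.sum_insert ha]; exact add _ _ (hf a) ih
  have const : ∀ a : ExteriorAlgebra ℝ (Fin n → ℝ), P (Polynomial.C a) := by
    intro a
    induction a using CliffordAlgebra.left_induction with
    | algebraMap r =>
      have : (Polynomial.C (algebraMap ℝ (ExteriorAlgebra ℝ (Fin n → ℝ)) r) : SuperPoly n)
          = r • 1 := by
        rw [← Algebra.algebraMap_eq_smul_one]; rfl
      exact this ▸ smul r 1 one
    | add a b ha hb => rw [Polynomial.C_add]; exact add _ _ ha hb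
    | ι_mul a m ha =>
      have hm : m = ∑ i, m i • Pi.single i (1 : ℝ) := by
        rw [← pi_eq_sum_univ' m]
      have : (Polynomial.C (CliffordAlgebra.ι 0 m * a) : SuperPoly n)
          = ∑ i, m i • (theta i * Polynomial.C a) := by
        conv_lhs => rw [hm]
        simp only [map_sum, map_smul, Finset.sum_mul, smul_mul_assoc, theta]
        simp only [← Polynomial.C_mul, Polynomial.smul_C]
      rw [this]
      exact sum _ _ fun i => smul _ _ (theta_mul i _ ha)
  induction F using Polynomial.induction_on' with
  | add p q hp hq => exact add _ _ hp hq
  | monomial k a =>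
    induction k with
    | zero => exact const a
    | succ k ih =>
      rw [← Polynomial.X_mul_monomial]
      exact x_mul _ ih

theorem partialTheta_theta_mul (i j : Fin n) (F : SuperPoly n) :
    partialTheta i (theta j * F) = (if i = j then F else 0) - theta j * partialTheta i F := by
  induction F using Polynomial.induction_on' with
  | add p q hp hq => rw [mul_add, map_add, hp, hq, map_add, mul_add]; split_ifs <;> abel
  | monomial k a =>
    have h := CliffordAlgebra.contractLeft_ι_mul (Q := (0 : QuadraticForm ℝ (Fin n → ℝ)))
      (LinearMap.proj i) (Pi.single j (1 : ℝ)) a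
    rw [theta, Polynomial.C_mul_monomial, partialTheta_monomial, partialTheta_monomial,
      Polynomial.C_mul_monomial]
    erw [h]
    by_cases hij : i = j
    · subst hij; simp [map_sub]
    · simp [hij]

theorem partialTheta_coordX_mul (i : Fin n) (F : SuperPoly n) :
    partialTheta i (coordX n * F) = coordX n * partialTheta i F := by
  induction F using Polynomial.induction_on' with
  | add p q hp hq => rw [mul_add, map_add, hp, hq, map_add, mul_add]
  | monomial k a =>
    rw [coordX, Polynomial.X_mul_monomial, partialTheta_monomial, partialTheta_monomial,
      Polynomial.X_mul_monomial]

@[simp] theorem partialTheta_one (i : Fin n) : partialTheta i (1 : SuperPoly n) = 0 := by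
  have := partialTheta_monomial i 0 1
  rw [CliffordAlgebra.contractLeft_one] at this
  simpa using this

@[simp] theorem partialTheta_theta (i j : Fin n) :
    partialTheta i (theta j) = if i = j then 1 else 0 := by
  simpa using partialTheta_theta_mul i j 1

@[simp] theorem partialTheta_coordX (i : Fin n) : partialTheta i (coordX n) = 0 := by
  simpa using partialTheta_coordX_mul i (1 : SuperPoly n)

theorem sigma_sigma (F : SuperPoly n) : sigma n (sigma n F) = F := by
  induction F using induction with
  | one => simp
  | add F G hF hG => simp [hF, hG]
  | smul r F hF => simp [hF]
  | x_mul F hF => simp [sigma_mul, hF]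
  | theta_mul i F hF => simp [sigma_mul, hF]

theorem sigma_partialX (F : SuperPoly n) : sigma n (partialX n F) = partialX n (sigma n F) := by
  induction F using induction with
  | one => simp
  | add F G hF hG => simp [hF, hG]
  | smul r F hF => simp [hF]
  | x_mul F hF => simp [sigma_mul, hF, partialX_mul]
  | theta_mul i F hF => simp [sigma_mul, hF, partialX_mul]

theorem sigma_partialTheta (i : Fin n) (F : SuperPoly n) :
    sigma n (partialTheta i F) = -partialTheta i (sigma n F) := by
  induction F using induction with
  | one => simp
  | add F G hF hG => simp [hF, hG]; abel
  | smul r F hF => simp [hF]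
  | x_mul F hF => simp [sigma_mul, hF, partialTheta_coordX_mul]
  | theta_mul j F hF =>
    simp [sigma_mul, hF, partialTheta_theta_mul]; split_ifs <;> simp

theorem partialTheta_mul (i : Fin n) (F G : SuperPoly n) :
    partialTheta i (F * G) = partialTheta i F * G + sigma n F * partialTheta i G := by
  induction F using induction with
  | one => simp
  | add F F' hF hF' => simp [add_mul, hF, hF']; abel
  | smul r F hF => simp [hF]
  | x_mul F hF =>
    rw [mul_assoc, partialTheta_coordX_mul, hF, partialTheta_coordX_mul, sigma_mul, sigma_coordX]
    noncomm_ring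
  | theta_mul j F hF =>
    rw [mul_assoc, partialTheta_theta_mul, hF, partialTheta_theta_mul, sigma_mul, sigma_theta]
    split_ifs <;> noncomm_ring

theorem partialTheta_partialX (i : Fin n) (F : SuperPoly n) :
    partialTheta i (partialX n F) = partialX n (partialTheta i F) := by
  induction F using induction with
  | one => simp
  | add F G hF hG => simp [hF, hG]
  | smul r F hF => simp [hF]
  | x_mul F hF => simp [partialTheta_coordX_mul, hF, partialX_mul]
  | theta_mul j F hF =>
    simp [partialTheta_theta_mul, hF, partialX_mul]; split_ifs <;> simp

theorem theta_mul_theta (i j : Fin n) :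
    (theta i * theta j : SuperPoly n) = -(theta j * theta i) := by
  have h := ExteriorAlgebra.ι_add_mul_swap (R := ℝ) (Pi.single i (1 : ℝ) : Fin n → ℝ)
    (Pi.single j (1 : ℝ))
  rw [theta, theta, ← Polynomial.C_mul, ← Polynomial.C_mul, ← Polynomial.C_neg,
    eq_neg_of_add_eq_zero_left h]

@[simp] theorem theta_mul_self (i : Fin n) : (theta i * theta i : SuperPoly n) = 0 := by
  have h := ExteriorAlgebra.ι_sq_zero (R := ℝ) (Pi.single i (1 : ℝ) : Fin n → ℝ)
  rw [theta, ← Polynomial.C_mul, h, Polynomial.C_0]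

theorem partialTheta_partialTheta (i j : Fin n) (F : SuperPoly n) :
    partialTheta i (partialTheta j F) = -partialTheta j (partialTheta i F) := by
  induction F using induction with
  | one => simp
  | add F G hF hG => simp [hF, hG]; abel
  | smul r F hF => simp [hF]
  | x_mul F hF => simp [partialTheta_coordX_mul, hF]
  | theta_mul k F hF =>
    simp only [partialTheta_theta_mul, map_sub, hF]
    split_ifs <;> simp <;> abel

theorem partialTheta_partialTheta_self (i : Fin n) (F : SuperPoly n) :
    partialTheta i (partialTheta i F) = 0 := by
  have h := eq_neg_iff_add_eq_zero.mp (partialTheta_partialTheta i i F)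
  rw [← two_smul ℝ] at h
  exact (smul_eq_zero.mp h).resolve_left two_ne_zero

theorem theta_mul_comm (i : Fin n) (F : SuperPoly n) : theta i * F = sigma n F * theta i := by
  induction F using induction with
  | one => simp
  | add F G hF hG => simp [mul_add, add_mul, hF, hG]
  | smul r F hF => simp [hF]
  | x_mul F hF => rw [← mul_assoc, ← coordX_mul, mul_assoc, hF, sigma_mul, sigma_coordX, mul_assoc]
  | theta_mul j F hF =>
    rw [← mul_assoc, theta_mul_theta, neg_mul, mul_assoc, hF, sigma_mul, sigma_theta]
    noncomm_ring

/-- `Z + σZ` and `Z - σZ` are twice the even and odd parts of `Z`. The two identities are proved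
together because multiplication by `θ_i` interchanges the parts. -/
theorem mul_add_sigma_comm (Z F : SuperPoly n) :
    F * (Z + sigma n Z) = (Z + sigma n Z) * F ∧
      F * (Z - sigma n Z) = (Z - sigma n Z) * sigma n F := by
  induction Z using induction generalizing F with
  | one => simp [mul_add, add_mul]
  | add Z W hZ hW =>
    have h1 : Z + W + sigma n (Z + W) = (Z + sigma n Z) + (W + sigma n W) := by
      rw [map_add]; abel
    have h2 : Z + W - sigma n (Z + W) = (Z - sigma n Z) + (W - sigma n W) := by
      rw [map_add]; abel
    rw [h1, h2, mul_add, (hZ F).1, (hW F).1, mul_add, (hZ F).2, (hW F).2, ← add_mul, ← add_mul]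
    exact ⟨rfl, rfl⟩
  | smul r Z hZ =>
    rw [map_smul, ← smul_add, ← smul_sub, mul_smul_comm, mul_smul_comm, (hZ F).1, (hZ F).2,
      smul_mul_assoc, smul_mul_assoc]
    exact ⟨rfl, rfl⟩
  | x_mul Z hZ =>
    rw [sigma_mul, sigma_coordX, ← mul_add, ← mul_sub]
    constructor
    · rw [← mul_assoc, ← coordX_mul, mul_assoc, (hZ F).1, mul_assoc]
    · rw [← mul_assoc, ← coordX_mul, mul_assoc, (hZ F).2, mul_assoc]
  | theta_mul i Z hZ =>
    have h1 : theta i * Z + sigma n (theta i * Z) = theta i * (Z - sigma n Z) := by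
      rw [sigma_mul, sigma_theta]; noncomm_ring
    have h2 : theta i * Z - sigma n (theta i * Z) = theta i * (Z + sigma n Z) := by
      rw [sigma_mul, sigma_theta]; noncomm_ring
    have h3 : F * theta i = theta i * sigma n F := by rw [theta_mul_comm, sigma_sigma]
    rw [h1, h2]
    constructor
    · rw [← mul_assoc, h3, mul_assoc, (hZ _).2, sigma_sigma, mul_assoc]
    · rw [← mul_assoc, h3, mul_assoc, (hZ _).1, mul_assoc]

/-- Even elements are central. -/
theorem mul_comm_of_even {Z : SuperPoly n} (hZ : sigma n Z = Z) (F : SuperPoly n) :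
    F * Z = Z * F := by
  have h := (mul_add_sigma_comm Z F).1
  rw [hZ, ← two_smul ℝ, mul_smul_comm, smul_mul_assoc] at h
  exact smul_right_injective _ (two_ne_zero' ℝ) h

/-- Odd elements commute with all others up to the parity automorphism. -/
theorem mul_comm_of_odd {Z : SuperPoly n} (hZ : sigma n Z = -Z) (F : SuperPoly n) :
    F * Z = Z * sigma n F := by
  have h := (mul_add_sigma_comm Z F).2
  rw [hZ, sub_neg_eq_add, ← two_smul ℝ, mul_smul_comm, smul_mul_assoc] at h
  exact smul_right_injective _ (two_ne_zero' ℝ) h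

/-- Evaluation at the origin. -/
def eval0 (n : ℕ) : SuperPoly n →ₗ[ℝ] ℝ :=
  (ExteriorAlgebra.algebraMapInv (R := ℝ) (M := Fin n → ℝ)).toLinearMap ∘ₗ
    (Polynomial.lcoeff (ExteriorAlgebra ℝ (Fin n → ℝ)) 0).restrictScalars ℝ

theorem eval0_mul (F G : SuperPoly n) : eval0 n (F * G) = eval0 n F * eval0 n G := by
  simp [eval0, Polynomial.mul_coeff_zero]

@[simp] theorem eval0_one : eval0 n 1 = 1 := by
  simp [eval0]

@[simp] theorem eval0_coordX : eval0 n (coordX n) = 0 := by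
  simp [eval0, coordX]

@[simp] theorem eval0_theta (i : Fin n) : eval0 n (theta i) = 0 := by
  simp [eval0, theta, ExteriorAlgebra.algebraMapInv]

@[simp] theorem eval0_sigma (F : SuperPoly n) : eval0 n (sigma n F) = eval0 n F := by
  induction F using induction with
  | one => simp
  | add F G hF hG => simp [hF, hG]
  | smul r F hF => simp [hF]
  | x_mul F hF => simp [sigma_mul, eval0_mul]
  | theta_mul j F hF => simp [sigma_mul, eval0_mul]

end

end SuperPoly

/-! ### Contact fields as superderivations, and subspaces detected at the origin -/

namespace SuperPoly

noncomputable section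

variable {n : ℕ}

theorem eta_apply (i : Fin n) (F : SuperPoly n) :
    eta i F = partialTheta i F - theta i * partialX n F := rfl

theorem eta_mul (i : Fin n) (F G : SuperPoly n) :
    eta i (F * G) = eta i F * G + sigma n F * eta i G := by
  have h := theta_mul_comm i F
  simp only [eta_apply, partialTheta_mul, partialX_mul, mul_add, sub_mul, mul_sub, ← mul_assoc, h]
  abel

theorem sigma_eta (i : Fin n) (F : SuperPoly n) : sigma n (eta i F) = -eta i (sigma n F) := by
  simp only [eta_apply, map_sub, sigma_mul, sigma_theta, sigma_partialTheta, sigma_partialX]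
  noncomm_ring

theorem eta_partialX (i : Fin n) (F : SuperPoly n) :
    eta i (partialX n F) = partialX n (eta i F) := by
  simp [eta_apply, partialTheta_partialX, partialX_mul]

theorem eta_eta (i j : Fin n) (F : SuperPoly n) :
    eta i (eta j F) = -eta j (eta i F) - if i = j then (2 : ℝ) • partialX n F else 0 := by
  simp only [eta_apply, map_sub, partialTheta_theta_mul, partialX_mul, partialX_theta,
    partialTheta_partialX, partialTheta_partialTheta i j, ← mul_assoc,
    theta_mul_theta i j, zero_mul, zero_add, two_smul]
  by_cases hij : i = j
  · subst hij; simp; abel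
  · simp [hij, Ne.symm hij]; abel

theorem eta_eta_self (i : Fin n) (F : SuperPoly n) : eta i (eta i F) = -partialX n F := by
  have h := eta_eta i i F
  rw [if_pos rfl, eq_sub_iff_add_eq, eq_neg_iff_add_eq_zero, add_right_comm, ← two_smul ℝ,
    ← smul_add] at h
  exact eq_neg_of_add_eq_zero_left ((smul_eq_zero.mp h).resolve_left two_ne_zero)

theorem eta_eta_of_ne {i j : Fin n} (hij : i ≠ j) (F : SuperPoly n) :
    eta i (eta j F) = -eta j (eta i F) := by
  rw [eta_eta, if_neg hij, sub_zero]

theorem contactField_apply (H F : SuperPoly n) : contactField H F =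
    H * partialX n F - (1 / 2 : ℝ) • ∑ i, eta i (sigma n H) * eta i F := by
  simp [contactField]

theorem densityAction_apply (w : ℝ) (H F : SuperPoly n) : densityAction w H F =
    contactField H F + w • (partialX n H * F) := by
  simp [densityAction]

theorem hasParity_zero_iff {H : SuperPoly n} : HasParity 0 H ↔ sigma n H = H := by
  simp [HasParity]

theorem hasParity_one_iff {H : SuperPoly n} : HasParity 1 H ↔ sigma n H = -H := by
  simp [HasParity]

theorem forall_hasParity_iff {P : Fin 2 → SuperPoly n → Prop} :
    (∀ p H, HasParity p H → P p H) ↔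
      (∀ H, sigma n H = H → P 0 H) ∧ (∀ H, sigma n H = -H → P 1 H) := by
  simp [Fin.forall_fin_two, hasParity_zero_iff, hasParity_one_iff]

theorem contactField_of_even {H : SuperPoly n} (hH : sigma n H = H) (F : SuperPoly n) :
    contactField H F = H * partialX n F - (1 / 2 : ℝ) • ∑ i, eta i H * eta i F := by
  rw [contactField_apply, hH]

theorem contactField_of_odd {H : SuperPoly n} (hH : sigma n H = -H) (F : SuperPoly n) :
    contactField H F = H * partialX n F + (1 / 2 : ℝ) • ∑ i, eta i H * eta i F := by
  simp [contactField_apply, hH]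

theorem sigma_contactField_of_even {H : SuperPoly n} (hH : sigma n H = H) (F : SuperPoly n) :
    sigma n (contactField H F) = contactField H (sigma n F) := by
  simp [contactField_of_even hH, sigma_mul, sigma_partialX, sigma_eta, hH]

theorem sigma_contactField_of_odd {H : SuperPoly n} (hH : sigma n H = -H) (F : SuperPoly n) :
    sigma n (contactField H F) = -contactField H (sigma n F) := by
  simp [contactField_of_odd hH, sigma_mul, sigma_partialX, sigma_eta, hH]
  abel

theorem sigma_densityAction_of_even {H : SuperPoly n} (hH : sigma n H = H) (w : ℝ)
    (F : SuperPoly n) :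
    sigma n (densityAction w H F) = densityAction w H (sigma n F) := by
  simp [densityAction_apply, sigma_contactField_of_even hH, sigma_mul, sigma_partialX, hH]

theorem sigma_densityAction_of_odd {H : SuperPoly n} (hH : sigma n H = -H) (w : ℝ)
    (F : SuperPoly n) :
    sigma n (densityAction w H F) = -densityAction w H (sigma n F) := by
  simp [densityAction_apply, sigma_contactField_of_odd hH, sigma_mul, sigma_partialX, hH]
  abel

theorem eta_odd_of_even {H : SuperPoly n} (hH : sigma n H = H) (i : Fin n) :
    sigma n (eta i H) = -eta i H := by rw [sigma_eta, hH]

theorem eta_even_of_odd {H : SuperPoly n} (hH : sigma n H = -H) (i : Fin n) :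
    sigma n (eta i H) = eta i H := by rw [sigma_eta, hH, map_neg, neg_neg]

theorem contactField_mul_of_even {H : SuperPoly n} (hH : sigma n H = H) (F G : SuperPoly n) :
    contactField H (F * G) = contactField H F * G + F * contactField H G := by
  simp only [contactField_of_even hH, partialX_mul, eta_mul, mul_add, mul_sub, sub_mul,
    Finset.sum_add_distrib, smul_add, smul_mul_assoc, mul_smul_comm, Finset.sum_mul,
    Finset.mul_sum, ← mul_assoc, mul_comm_of_even hH F,
    fun i => mul_comm_of_odd (eta_odd_of_even hH i) F]
  abel

theorem contactField_mul_of_odd {H : SuperPoly n} (hH : sigma n H = -H) (F G : SuperPoly n) :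
    contactField H (F * G) = contactField H F * G + sigma n F * contactField H G := by
  simp only [contactField_of_odd hH, partialX_mul, eta_mul, mul_add, add_mul,
    Finset.sum_add_distrib, smul_add, smul_mul_assoc, mul_smul_comm, Finset.sum_mul,
    Finset.mul_sum, ← mul_assoc, mul_comm_of_odd hH (sigma n F), sigma_sigma,
    fun i => mul_comm_of_even (eta_even_of_odd hH i) (sigma n F)]
  abel

theorem partialX_even {H : SuperPoly n} (hH : sigma n H = H) :
    sigma n (partialX n H) = partialX n H := by rw [sigma_partialX, hH]

theorem partialX_odd {H : SuperPoly n} (hH : sigma n H = -H) :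
    sigma n (partialX n H) = -partialX n H := by rw [sigma_partialX, hH, map_neg]

theorem densityAction_mul_of_even {H : SuperPoly n} (hH : sigma n H = H) (a b : ℝ)
    (F G : SuperPoly n) : densityAction (a + b) H (F * G) =
      densityAction a H F * G + F * densityAction b H G := by
  simp only [densityAction_apply, contactField_mul_of_even hH, add_mul, mul_add, add_smul,
    smul_mul_assoc, mul_smul_comm, ← mul_assoc, mul_comm_of_even (partialX_even hH) F]
  abel

theorem densityAction_mul_of_odd {H : SuperPoly n} (hH : sigma n H = -H) (a b : ℝ)
    (F G : SuperPoly n) : densityAction (a + b) H (F * G) =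
      densityAction a H F * G + sigma n F * densityAction b H G := by
  simp only [densityAction_apply, contactField_mul_of_odd hH, add_mul, mul_add, add_smul,
    smul_mul_assoc, mul_smul_comm, ← mul_assoc, mul_comm_of_odd (partialX_odd hH) (sigma n F),
    sigma_sigma]
  abel

/-- Contact invariance without the decomposition of `T` into homogeneous components. -/
theorem isContactInvariant_iff {lam mu nu : ℝ} {T : BinaryOp n} :
    IsContactInvariant lam mu nu T ↔
      (∀ H, sigma n H = H → ∀ F G, densityAction nu H (T F G) =
        T (densityAction lam H F) G + T F (densityAction mu H G)) ∧
      (∀ H, sigma n H = -H → ∀ F G, densityAction nu H (T F G) =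
        sigma n (T (sigma n (densityAction lam H F)) (sigma n G) +
          T F (sigma n (densityAction mu H G)))) := by
  have half : ∀ Y : SuperPoly n, (1 / 2 : ℝ) • Y + (1 / 2 : ℝ) • Y = Y := fun Y => by
    rw [← add_smul]; norm_num
  unfold IsContactInvariant
  rw [forall_hasParity_iff]
  refine and_congr (forall₂_congr fun H hH => forall₂_congr fun F G => ?_)
    (forall₂_congr fun H hH => forall₂_congr fun F G => ?_)
  · rw [← sub_eq_zero (a := densityAction nu H (T F G))]
    refine Eq.congr_left ?_
    simp [actionHomogeneous, parityPart, Fin.sum_univ_two]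
    rw [← half (densityAction nu H (T F G)), ← half (T (densityAction lam H F) G),
      ← half (T F (densityAction mu H G))]
    module
  -- For odd `H` the sign `(-1)^q` turns `T_0 + T_1` into `T_0 - T_1`, which is `σ ∘ T ∘ (σ ⊗ σ)`.
  · rw [← sub_eq_zero (a := densityAction nu H (T F G))]
    refine Eq.congr_left ?_
    simp [actionHomogeneous, parityPart, Fin.sum_univ_two, sigma_sigma]
    rw [← half (densityAction nu H (T F G)),
      ← half (sigma n (T (sigma n (densityAction lam H F)) (sigma n G))),
      ← half (sigma n (T F (sigma n (densityAction mu H G))))]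
    module

theorem IsContactInvariant.add {lam mu nu : ℝ} {T U : BinaryOp n}
    (hT : IsContactInvariant lam mu nu T) (hU : IsContactInvariant lam mu nu U) :
    IsContactInvariant lam mu nu (T + U) := by
  rw [isContactInvariant_iff] at *
  constructor
  · intro H hH F G
    simp only [LinearMap.add_apply, map_add, hT.1 H hH, hU.1 H hH]
    abel
  · intro H hH F G
    simp only [LinearMap.add_apply, map_add, hT.2 H hH, hU.2 H hH]
    abel

theorem IsContactInvariant.smul {lam mu nu : ℝ} {T : BinaryOp n}
    (hT : IsContactInvariant lam mu nu T) (r : ℝ) : IsContactInvariant lam mu nu (r • T) := by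
  rw [isContactInvariant_iff] at *
  constructor
  · intro H hH F G
    simp only [LinearMap.smul_apply, map_smul, hT.1 H hH, smul_add]
  · intro H hH F G
    simp only [LinearMap.smul_apply, map_smul, map_add, hT.2 H hH, smul_add]

theorem IsContactInvariant.sub {lam mu nu : ℝ} {T U : BinaryOp n}
    (hT : IsContactInvariant lam mu nu T) (hU : IsContactInvariant lam mu nu U) :
    IsContactInvariant lam mu nu (T - U) := by
  have h : T - U = T + (-1 : ℝ) • U := by ext1; ext1; simp [sub_eq_add_neg]
  exact h ▸ hT.add (hU.smul (-1))

/-- The operator `G ↦ ∂_i(θ_i G)` kills multiples of `θ_i` and commutes with multiplication by every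
other `θ_j`. -/
theorem foldr_partialTheta_theta_mul (l : List (Fin n)) (j : Fin n) (F : SuperPoly n) :
    l.foldr (fun i G => partialTheta i (theta i * G)) (theta j * F) =
      if j ∈ l then 0 else
        theta j * l.foldr (fun i G => partialTheta i (theta i * G)) F := by
  induction l with
  | nil => simp
  | cons i l ih =>
    rw [List.foldr_cons, ih, List.foldr_cons]
    by_cases hl : j ∈ l
    · simp [hl]
    · by_cases hij : j = i
      · subst hij; simp [hl, ← mul_assoc]
      · rw [if_neg hl, if_neg (by simp [hl, hij]), ← mul_assoc, theta_mul_theta, neg_mul, map_neg,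
          mul_assoc, partialTheta_theta_mul, if_neg (Ne.symm hij), zero_sub, neg_neg]

/-- The composite `Q` of all `G ↦ ∂_i(θ_i G)` projects onto polynomials in `x` alone, and it fixes
`F` because all `∂_i F` vanish. A real polynomial in `x` with zero derivative is constant. -/
theorem eq_one_smul_of_partial_eq_zero {F : SuperPoly n} (hx : partialX n F = 0)
    (hF : ∀ i, partialTheta i F = 0) : F = eval0 n F • 1 := by
  set l : List (Fin n) := Finset.univ.toList
  let Q : SuperPoly n → SuperPoly n := fun F => l.foldr (fun i G => partialTheta i (theta i * G)) F
  have hQ : Q F = F := by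
    have : ∀ l : List (Fin n), l.foldr (fun i G => partialTheta i (theta i * G)) F = F := by
      intro l
      induction l with
      | nil => rfl
      | cons i l ih => rw [List.foldr_cons, ih, partialTheta_theta_mul, hF]; simp
    exact this l
  have add : ∀ (l : List (Fin n)) (F G : SuperPoly n),
      l.foldr (fun i G => partialTheta i (theta i * G)) (F + G) =
        l.foldr (fun i G => partialTheta i (theta i * G)) F +
          l.foldr (fun i G => partialTheta i (theta i * G)) G := by
    intro l F G
    induction l with
    | nil => rfl
    | cons i l ih => simp [ih, mul_add]
  have smul : ∀ (l : List (Fin n)) (r : ℝ) (F : SuperPoly n),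
      l.foldr (fun i G => partialTheta i (theta i * G)) (r • F) =
        r • l.foldr (fun i G => partialTheta i (theta i * G)) F := by
    intro l r F
    induction l with
    | nil => rfl
    | cons i l ih => simp [ih]
  have x_mul : ∀ (l : List (Fin n)) (F : SuperPoly n),
      l.foldr (fun i G => partialTheta i (theta i * G)) (coordX n * F) =
        coordX n * l.foldr (fun i G => partialTheta i (theta i * G)) F := by
    intro l F
    induction l with
    | nil => rfl
    | cons i l ih =>
      rw [List.foldr_cons, ih, ← mul_assoc, ← coordX_mul, mul_assoc, partialTheta_coordX_mul]; rfl
  have one : ∀ l : List (Fin n),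
      l.foldr (fun i G => partialTheta i (theta i * G)) (1 : SuperPoly n) = 1 := by
    intro l
    induction l with
    | nil => rfl
    | cons i l ih => simp [ih]
  have hinj : Function.Injective (algebraMap ℝ (ExteriorAlgebra ℝ (Fin n → ℝ))) :=
    (ExteriorAlgebra.algebraMap_leftInverse _).injective
  have hp : ∀ F : SuperPoly n, ∃ p : Polynomial ℝ,
      Q F = p.map (algebraMap ℝ (ExteriorAlgebra ℝ (Fin n → ℝ))) := by
    intro F
    induction F using induction with
    | one => exact ⟨1, by simp [Q, one]⟩
    | add F G hF hG =>
      obtain ⟨p, hp⟩ := hF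
      obtain ⟨q, hq⟩ := hG
      exact ⟨p + q, by rw [Polynomial.map_add, ← hp, ← hq]; exact add l F G⟩
    | smul r F hF =>
      obtain ⟨p, hp⟩ := hF
      refine ⟨r • p, ?_⟩
      rw [Polynomial.smul_eq_C_mul, Polynomial.map_mul, ← hp, Polynomial.map_C,
        ← Polynomial.smul_eq_C_mul,
        algebraMap_smul]
      exact smul l r F
    | x_mul F hF =>
      obtain ⟨p, hp⟩ := hF
      exact ⟨Polynomial.X * p, by
        rw [Polynomial.map_mul, ← hp, Polynomial.map_X]; exact x_mul l F⟩
    | theta_mul i F hF =>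
      exact ⟨0, by
        rw [Polynomial.map_zero]
        exact (foldr_partialTheta_theta_mul l i F).trans (if_pos (by simp [l]))⟩
  obtain ⟨p, hp⟩ := hp F
  rw [hQ] at hp
  have hd : Polynomial.derivative p = 0 := by
    refine Polynomial.map_injective _ hinj ?_
    rw [← Polynomial.derivative_map, ← hp, Polynomial.map_zero]
    exact hx
  rw [Polynomial.eq_C_of_derivative_eq_zero hd, Polynomial.map_C] at hp
  rw [hp, ← Polynomial.algebraMap_apply, Algebra.algebraMap_eq_smul_one, map_smul, eval0_one,
    smul_eq_mul, mul_one]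

/-- A nonzero element could be differentiated within `W` down to a nonzero constant. The outer
induction is on the degree in `x`, the inner one (`key`) on the set of odd coordinates on which an
`x`-independent element may depend. -/
theorem eq_zero_of_mem_of_eval0 (W : Submodule ℝ (SuperPoly n))
    (hx : ∀ F ∈ W, partialX n F ∈ W)
    (ht : ∀ F ∈ W, ∀ i, partialTheta i F + theta i * partialX n F ∈ W)
    (h0 : ∀ F ∈ W, eval0 n F = 0) : ∀ F ∈ W, F = 0 := by
  have key : ∀ (S : Finset (Fin n)) (F : SuperPoly n), F ∈ W → partialX n F = 0 →
      (∀ i ∉ S, partialTheta i F = 0) → F = 0 := by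
    intro S
    induction S using Finset.induction_on with
    | empty =>
      intro F hF hFx hFi
      rw [eq_one_smul_of_partial_eq_zero hFx fun i => hFi i (by simp), h0 F hF, zero_smul]
    | insert j S hj ih =>
      intro F hF hFx hFi
      refine ih F hF hFx fun i hi => ?_
      by_cases hij : i = j
      · subst hij
        -- Since `∂_x F = 0`, the operator `∂_i + θ_i ∂_x` gives just `∂_i F`, which lies in `W` and
        -- no longer involves `θ_i`.
        refine ih _ ?_ ?_ ?_
        · simpa [hFx] using ht F hF i
        · rw [← partialTheta_partialX, hFx, map_zero]
        · intro k hk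
          by_cases hki : k = i
          · rw [hki, partialTheta_partialTheta_self]
          · rw [partialTheta_partialTheta, hFi k (by simp [hki, hk]), map_zero, neg_zero]
      · exact hFi i (by simp [hij, hi])
  have main : ∀ (d : ℕ) (F : SuperPoly n), F ∈ W → F.natDegree ≤ d → F = 0 := by
    intro d
    induction d with
    | zero =>
      intro F hF hd
      refine key Finset.univ F hF ?_ (by simp)
      rw [Polynomial.eq_C_of_natDegree_le_zero hd]
      simp [partialX]
    | succ d ih =>
      intro F hF hd
      refine key Finset.univ F hF (ih _ (hx F hF) ?_) (by simp)
      have := Polynomial.natDegree_derivative_le F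
      change (Polynomial.derivative F).natDegree ≤ d
      omega
  exact fun F hF => main _ F hF le_rfl

end

end SuperPoly

/-! ### Explicit contact fields of monomials -/

namespace SuperPoly

noncomputable section

variable {n : ℕ}

theorem coordX_pow_comm (k : ℕ) (F : SuperPoly n) : F * coordX n ^ k = coordX n ^ k * F :=
  (Polynomial.commute_X_pow F k).eq.symm

theorem mul_coordX_pow_mul (k : ℕ) (F G : SuperPoly n) :
    F * (coordX n ^ k * G) = coordX n ^ k * (F * G) := by
  rw [← mul_assoc, coordX_pow_comm, mul_assoc]

theorem coordX_pow_mul_pow_mul (k l : ℕ) (F : SuperPoly n) :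
    coordX n ^ k * (coordX n ^ l * F) = coordX n ^ (k + l) * F := by
  rw [← mul_assoc, pow_add]

@[simp] theorem sigma_coordX_pow (k : ℕ) : sigma n (coordX n ^ k) = coordX n ^ k := by
  induction k with
  | zero => simp
  | succ k ih => rw [pow_succ, sigma_mul, ih, sigma_coordX]

theorem partialX_coordX_pow (k : ℕ) :
    partialX n (coordX n ^ k) = (k : ℝ) • coordX n ^ (k - 1) := by
  simp only [partialX, coordX, LinearMap.coe_restrictScalars, Polynomial.derivative_X_pow]
  rw [← map_natCast (algebraMap ℝ (ExteriorAlgebra ℝ (Fin n → ℝ))), ← Polynomial.smul_eq_C_mul,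
    algebraMap_smul]

theorem partialX_coordX_pow_succ (k : ℕ) :
    partialX n (coordX n ^ (k + 1)) = (k + 1 : ℝ) • coordX n ^ k := by
  simp [partialX_coordX_pow]

theorem coordX_mul_partialX_pow (k : ℕ) :
    coordX n * partialX n (coordX n ^ k) = (k : ℝ) • coordX n ^ k := by
  rw [partialX_coordX_pow, mul_smul_comm, ← pow_succ']
  cases k <;> simp

theorem partialTheta_coordX_pow_mul (i : Fin n) (k : ℕ) (F : SuperPoly n) :
    partialTheta i (coordX n ^ k * F) = coordX n ^ k * partialTheta i F := by
  induction k with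
  | zero => simp
  | succ k ih => rw [pow_succ', mul_assoc, partialTheta_coordX_mul, ih, mul_assoc]

theorem partialX_theta_mul (i : Fin n) (F : SuperPoly n) :
    partialX n (theta i * F) = theta i * partialX n F := by
  simp [partialX_mul]

/-- The Euler operator `∑ θ_i ∂_i`. -/
def eulerTheta (n : ℕ) : SuperPoly n →ₗ[ℝ] SuperPoly n :=
  ∑ i : Fin n, LinearMap.mulLeft ℝ (theta i) ∘ₗ partialTheta i

theorem eulerTheta_apply (F : SuperPoly n) :
    eulerTheta n F = ∑ i, theta i * partialTheta i F := by
  simp [eulerTheta]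

@[simp] theorem eulerTheta_one : eulerTheta n 1 = 0 := by
  simp [eulerTheta_apply]

theorem eulerTheta_coordX_pow_mul (k : ℕ) (F : SuperPoly n) :
    eulerTheta n (coordX n ^ k * F) = coordX n ^ k * eulerTheta n F := by
  simp [eulerTheta_apply, partialTheta_coordX_pow_mul, mul_coordX_pow_mul, Finset.mul_sum]

theorem eulerTheta_theta_mul (i : Fin n) (F : SuperPoly n) :
    eulerTheta n (theta i * F) = theta i * F + theta i * eulerTheta n F := by
  have h : ∀ j, theta j * (theta i * partialTheta j F) =
      -(theta i * (theta j * partialTheta j F)) :=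
    fun j => by rw [← mul_assoc, theta_mul_theta, neg_mul, mul_assoc]
  simp [eulerTheta_apply, partialTheta_theta_mul, mul_sub, h, Finset.mul_sum,
    Finset.sum_add_distrib]

theorem eta_coordX_pow_succ (i : Fin n) (m : ℕ) :
    eta i (coordX n ^ (m + 1)) = -((m + 1 : ℝ) • (coordX n ^ m * theta i)) := by
  have h := partialTheta_coordX_pow_mul i (m + 1) (1 : SuperPoly n)
  rw [mul_one, partialTheta_one, mul_zero] at h
  rw [eta_apply, h, partialX_coordX_pow_succ, mul_smul_comm, coordX_pow_comm, zero_sub]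

theorem eta_theta (i j : Fin n) : eta i (theta j) = if i = j then 1 else 0 := by
  simp [eta_apply]

/-- Besides the term with `k = i`, `η_k(x^{m+1} θ_i)` contributes a multiple of `x^m θ_i θ_k`. As
`θ_k² = 0`, only the `∂_k` part of `η_k F` survives this factor, and the sum over `k` is the Euler
operator. -/
theorem contactField_odd_monomial (m : ℕ) (i : Fin n) (F : SuperPoly n) :
    contactField (coordX n ^ (m + 1) * theta i) F =
      (1 / 2 : ℝ) • (coordX n ^ (m + 1) * (partialTheta i F + theta i * partialX n F)) +
      ((m + 1) / 2 : ℝ) • (coordX n ^ m * (theta i * eulerTheta n F)) := by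
  have hH : sigma n (coordX n ^ (m + 1) * theta i) = -(coordX n ^ (m + 1) * theta i) := by
    simp [sigma_mul]
  have h : ∀ k, eta k (coordX n ^ (m + 1) * theta i) * eta k F =
      (if k = i then coordX n ^ (m + 1) * eta i F else 0) +
        (m + 1 : ℝ) • (coordX n ^ m * (theta i * (theta k * partialTheta k F))) := by
    intro k
    rw [eta_mul, eta_coordX_pow_succ, eta_theta, sigma_coordX_pow, neg_mul, smul_mul_assoc,
      mul_assoc, theta_mul_theta k i, add_mul, neg_mul, smul_mul_assoc, mul_neg, neg_mul, smul_neg,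
      neg_neg, add_comm]
    congr 1
    · split_ifs with hk
      · rw [hk, mul_one]
      · simp
    · simp only [eta_apply, mul_sub, mul_assoc]
      rw [← mul_assoc (theta k) (theta k)]
      simp
  rw [contactField_of_odd hH]
  simp only [h, Finset.sum_add_distrib, Finset.sum_ite_eq', Finset.mem_univ, if_true]
  rw [← Finset.smul_sum, ← Finset.mul_sum, ← Finset.mul_sum, ← eulerTheta_apply, eta_apply,
    mul_sub, mul_add, mul_assoc]
  module

theorem contactField_even_monomial (m : ℕ) (i j : Fin n) (F : SuperPoly n) :
    contactField (coordX n ^ m * (theta i * theta j)) F =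
      (1 / 2 : ℝ) • (coordX n ^ m * (theta i * partialTheta j F - theta j * partialTheta i F)) +
      (1 / 2 : ℝ) • (partialX n (coordX n ^ m) * (theta i * (theta j * eulerTheta n F))) := by
  have hH : sigma n (coordX n ^ m * (theta i * theta j)) = coordX n ^ m * (theta i * theta j) := by
    simp [sigma_mul]
  have hp : ∀ k, partialTheta k (coordX n ^ m * (theta i * theta j)) =
      coordX n ^ m * ((if k = i then theta j else 0) - if k = j then theta i else 0) := by
    intro k
    rw [partialTheta_coordX_pow_mul, partialTheta_theta_mul, partialTheta_theta]
    congr 2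
    split_ifs <;> simp
  have h : ∀ k, eta k (coordX n ^ m * (theta i * theta j)) * eta k F =
      (if k = i then coordX n ^ m * (theta j * eta i F) else 0) -
      (if k = j then coordX n ^ m * (theta i * eta j F) else 0) -
        (partialX n (coordX n ^ m) * (theta i * (theta j * (theta k * partialTheta k F)))) := by
    intro k
    have hx : partialX n (theta i * theta j) = 0 := by simp [partialX_mul]
    have hc : theta k * (partialX n (coordX n ^ m) * (theta i * theta j)) =
        partialX n (coordX n ^ m) * (theta i * (theta j * theta k)) := by
      have hk : theta k * (theta i * theta j) = theta i * (theta j * theta k) := by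
        rw [← mul_assoc, theta_mul_theta k i, neg_mul, mul_assoc, theta_mul_theta k j, mul_neg,
          neg_neg]
      rw [partialX_coordX_pow, smul_mul_assoc, mul_smul_comm, mul_coordX_pow_mul, hk,
        smul_mul_assoc]
    have hs : theta k * (theta k * partialX n F) = 0 := by rw [← mul_assoc]; simp
    rw [eta_apply, hp, partialX_mul, hx, mul_zero, add_zero, hc, sub_mul]
    congr 1
    · split_ifs with h1 h2 h2
      · simp [← h1, ← h2]
      · simp [← h1, mul_assoc]
      · simp [← h2, mul_assoc]
      · simp
    · rw [eta_apply, mul_assoc, mul_assoc, mul_assoc, mul_sub, hs, sub_zero]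
  rw [contactField_of_even hH]
  simp only [h, Finset.sum_sub_distrib, Finset.sum_ite_eq', Finset.mem_univ, if_true]
  rw [← Finset.mul_sum, ← Finset.mul_sum, ← Finset.mul_sum, ← eulerTheta_apply, eta_apply,
    eta_apply, mul_sub, mul_sub, mul_sub, ← mul_assoc (theta j) (theta i), theta_mul_theta j i,
    mul_assoc, neg_mul, mul_assoc]
  simp only [mul_sub, mul_neg]
  module

theorem contactField_cubic (i j k : Fin n) (F : SuperPoly n) :
    contactField (theta i * (theta j * theta k)) F =
      -((1 / 2 : ℝ) • (theta i * (theta j * (theta k * partialX n F)))) +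
      (1 / 2 : ℝ) • (theta j * (theta k * partialTheta i F) - theta i * (theta k * partialTheta j F)
        + theta i * (theta j * partialTheta k F)) := by
  have hH : sigma n (theta i * (theta j * theta k)) = -(theta i * (theta j * theta k)) := by
    simp [sigma_mul]
  have h : ∀ l, eta l (theta i * (theta j * theta k)) * eta l F =
      (if l = i then theta j * (theta k * eta i F) else 0) -
      (if l = j then theta i * (theta k * eta j F) else 0) +
      (if l = k then theta i * (theta j * eta k F) else 0) := by
    intro l
    have e : eta l (theta i * (theta j * theta k)) =
        (if l = i then theta j * theta k else 0) - (if l = j then theta i * theta k else 0) +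
          (if l = k then theta i * theta j else 0) := by
      simp only [eta_mul, sigma_theta, eta_theta]
      split_ifs <;> noncomm_ring
    rw [e, add_mul, sub_mul]
    congr 1
    · congr 1
      · split_ifs with h1
        · rw [h1, mul_assoc]
        · simp
      · split_ifs with h1
        · rw [h1, mul_assoc]
        · simp
    · split_ifs with h1
      · rw [h1, mul_assoc]
      · simp
  rw [contactField_of_odd hH]
  simp only [h, Finset.sum_add_distrib, Finset.sum_sub_distrib, Finset.sum_ite_eq',
    Finset.mem_univ, if_true]
  have h1 : theta j * (theta k * (theta i * partialX n F)) =
      theta i * (theta j * (theta k * partialX n F)) := by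
    simp only [← mul_assoc]
    rw [mul_assoc (theta j), theta_mul_theta k i, mul_neg, ← mul_assoc, theta_mul_theta j i]
    simp
  have h2 : theta i * (theta k * (theta j * partialX n F)) =
      -(theta i * (theta j * (theta k * partialX n F))) := by
    simp only [← mul_assoc]
    rw [mul_assoc (theta i), theta_mul_theta k j, mul_neg, ← mul_assoc]
    simp
  simp only [eta_apply, mul_sub, h1, h2, mul_assoc]
  module

theorem contactField_coordX (F : SuperPoly n) :
    contactField (coordX n) F = coordX n * partialX n F + (1 / 2 : ℝ) • eulerTheta n F := by
  have h : ∀ k, eta k (coordX n) * eta k F = -(theta k * partialTheta k F) := by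
    intro k
    rw [eta_apply (F := F), mul_sub]
    simp [eta_apply, ← mul_assoc]
  rw [contactField_of_even (by simp)]
  simp only [h, Finset.sum_neg_distrib, ← eulerTheta_apply]
  module

theorem contactField_one (F : SuperPoly n) : contactField 1 F = partialX n F := by
  rw [contactField_of_even (by simp)]
  simp [eta_apply]

theorem contactField_theta (i : Fin n) (F : SuperPoly n) :
    contactField (theta i) F = (1 / 2 : ℝ) • (partialTheta i F + theta i * partialX n F) := by
  rw [contactField_of_odd (by simp)]
  simp only [eta_theta, ite_mul, one_mul, zero_mul, Finset.sum_ite_eq', Finset.mem_univ, if_true]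
  rw [eta_apply]
  module

end

end SuperPoly

/-! ### Reduction to functionals at the origin, and the Euler grading -/

namespace SuperPoly

noncomputable section

variable {n : ℕ}

theorem densityAction_one (w : ℝ) (F : SuperPoly n) : densityAction w 1 F = partialX n F := by
  simp [densityAction_apply, contactField_one]

theorem densityAction_theta (w : ℝ) (i : Fin n) (F : SuperPoly n) :
    densityAction w (theta i) F =
      (1 / 2 : ℝ) • (partialTheta i F + theta i * partialX n F) := by
  simp [densityAction_apply, contactField_theta]

/-- An invariant operator is determined by its values at the origin. -/
theorem eq_zero_of_eval0_eq_zero {lam mu nu : ℝ} {T : BinaryOp n}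
    (hT : IsContactInvariant lam mu nu T) (h0 : ∀ F G, eval0 n (T F G) = 0) : T = 0 := by
  rw [isContactInvariant_iff] at hT
  have hbar : ∀ i F G, partialTheta i (T F G) + theta i * partialX n (T F G) =
      (2 : ℝ) • densityAction nu (theta i) (T F G) := by
    intro i F G
    rw [densityAction_theta, smul_smul]; norm_num
  have hbar' : ∀ i F, partialTheta i (sigma n F) + theta i * partialX n (sigma n F) =
      -sigma n (partialTheta i F + theta i * partialX n F) := by
    intro i F
    rw [map_add, sigma_mul, sigma_theta, sigma_partialTheta, sigma_partialX]
    noncomm_ring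
  -- The values `σ(T(F, G))` are included because invariance under an odd field expresses its action
  -- on `T(F, G)` through `σ ∘ T`.
  let W : Submodule ℝ (SuperPoly n) := Submodule.span ℝ
    ({Y | ∃ F G, Y = T F G} ∪ {Y | ∃ F G, Y = sigma n (T F G)})
  have mem1 : ∀ F G, T F G ∈ W := fun F G => Submodule.subset_span (Or.inl ⟨F, G, rfl⟩)
  have mem2 : ∀ F G, sigma n (T F G) ∈ W := fun F G => Submodule.subset_span (Or.inr ⟨F, G, rfl⟩)
  have dx : ∀ F G, partialX n (T F G) = T (partialX n F) G + T F (partialX n G) := by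
    intro F G
    simpa [densityAction_one] using hT.1 1 (by simp) F G
  have main := eq_zero_of_mem_of_eval0 W ?_ ?_ ?_
  · ext1 F
    ext1 G
    exact main _ (mem1 F G)
  · intro Y hY
    induction hY using Submodule.span_induction with
    | mem Y hY =>
      rcases hY with ⟨F, G, rfl⟩ | ⟨F, G, rfl⟩
      · rw [dx]; exact add_mem (mem1 _ _) (mem1 _ _)
      · rw [← sigma_partialX, dx, map_add]; exact add_mem (mem2 _ _) (mem2 _ _)
    | zero => simp
    | add Y Z _ _ hY hZ => rw [map_add]; exact add_mem hY hZ
    | smul r Y _ hY => rw [map_smul]; exact W.smul_mem r hY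
  · intro Y hY i
    induction hY using Submodule.span_induction with
    | mem Y hY =>
      rcases hY with ⟨F, G, rfl⟩ | ⟨F, G, rfl⟩
      · rw [hbar, hT.2 _ (sigma_theta i), map_add]
        exact W.smul_mem _ (add_mem (mem2 _ _) (mem2 _ _))
      · rw [hbar', hbar, hT.2 _ (sigma_theta i), map_smul, sigma_sigma]
        exact W.neg_mem (W.smul_mem _ (add_mem (mem1 _ _) (mem1 _ _)))
    | zero => simp
    | add Y Z _ _ hY hZ =>
      rw [map_add, map_add, mul_add, add_add_add_comm]; exact add_mem hY hZ
    | smul r Y _ hY =>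
      rw [map_smul, map_smul, mul_smul_comm, ← smul_add]; exact W.smul_mem r hY
  · intro Y hY
    induction hY using Submodule.span_induction with
    | mem Y hY =>
      rcases hY with ⟨F, G, rfl⟩ | ⟨F, G, rfl⟩
      · exact h0 F G
      · rw [eval0_sigma, h0]
    | zero => simp
    | add Y Z _ _ hY hZ => rw [map_add, hY, hZ, add_zero]
    | smul r Y _ hY => rw [map_smul, hY, smul_zero]

theorem eval0_of_odd {Z : SuperPoly n} (hZ : sigma n Z = -Z) : eval0 n Z = 0 := by
  have h := eval0_sigma Z
  rw [hZ, map_neg] at h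
  linarith

/-- Bilinear functionals invariant under the contact fields vanishing at the origin, which act
on the target through the weight `nu`. -/
structure OriginInvariant (lam mu nu : ℝ)
    (t : SuperPoly n →ₗ[ℝ] SuperPoly n →ₗ[ℝ] ℝ) : Prop where
  even : ∀ H, sigma n H = H → eval0 n H = 0 → ∀ F G,
    t (densityAction lam H F) G + t F (densityAction mu H G) =
      nu * eval0 n (partialX n H) * t F G
  odd : ∀ H, sigma n H = -H → (∀ i, eval0 n (eta i H) = 0) → ∀ F G,
    t (densityAction lam H F) G + t (sigma n F) (densityAction mu H G) = 0

/-- The value of a bilinear operator at the origin. -/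
def atOrigin (T : BinaryOp n) : SuperPoly n →ₗ[ℝ] SuperPoly n →ₗ[ℝ] ℝ :=
  T.compr₂ (eval0 n)

@[simp] theorem atOrigin_apply (T : BinaryOp n) (F G : SuperPoly n) :
    atOrigin T F G = eval0 n (T F G) := rfl

/-- Odd functions vanish at the origin. For even `H` with `H(0) = 0` this kills the terms with `η_i
H`, leaving the scalar `ν H'(0)`. For odd `H` it kills `H` and `H'`, so only the terms with `η_i H`
have to be excluded by hypothesis. -/
theorem IsContactInvariant.originInvariant {lam mu nu : ℝ} {T : BinaryOp n}
    (hT : IsContactInvariant lam mu nu T) : OriginInvariant lam mu nu (atOrigin T) := by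
  rw [isContactInvariant_iff] at hT
  constructor
  · intro H hH h0 F G
    simp only [atOrigin_apply]
    rw [← map_add, ← hT.1 H hH, densityAction_apply, contactField_of_even hH]
    have h : ∀ i, eval0 n (eta i H) = 0 := fun i => eval0_of_odd (eta_odd_of_even hH i)
    simp [eval0_mul, h0, h]
    ring
  · intro H hH h0 F G
    have h := congrArg (eval0 n) (hT.2 H hH (sigma n F) (sigma n G))
    have hH0 := eval0_of_odd hH
    have hH1 := eval0_of_odd (partialX_odd hH)
    rw [densityAction_apply, contactField_of_odd hH, eval0_sigma, map_add, sigma_sigma,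
      sigma_densityAction_of_odd hH, sigma_densityAction_of_odd hH, sigma_sigma, sigma_sigma] at h
    simp [eval0_mul, h0, hH0, hH1] at h
    simp only [atOrigin_apply]
    linarith

/-- The product `θ_{i_1} ⋯ θ_{i_r}`. -/
def thetaList (L : List (Fin n)) : SuperPoly n := (L.map theta).prod

@[simp] theorem thetaList_nil : thetaList ([] : List (Fin n)) = 1 := rfl

@[simp] theorem thetaList_cons (i : Fin n) (L : List (Fin n)) :
    thetaList (i :: L) = theta i * thetaList L := by
  simp [thetaList]

@[simp] theorem partialX_thetaList (L : List (Fin n)) : partialX n (thetaList L) = 0 := by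
  induction L with
  | nil => simp
  | cons i L ih => rw [thetaList_cons, partialX_theta_mul, ih, mul_zero]

theorem partialTheta_thetaList {i : Fin n} {L : List (Fin n)} (h : i ∉ L) :
    partialTheta i (thetaList L) = 0 := by
  induction L with
  | nil => simp
  | cons j L ih =>
    rw [List.mem_cons, not_or] at h
    rw [thetaList_cons, partialTheta_theta_mul, ih h.2, if_neg h.1]
    simp

theorem eulerTheta_thetaList (L : List (Fin n)) :
    eulerTheta n (thetaList L) = (L.length : ℝ) • thetaList L := by
  induction L with
  | nil => simp
  | cons j L ih =>
    rw [thetaList_cons, eulerTheta_theta_mul, ih, List.length_cons]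
    push_cast
    rw [mul_smul_comm]
    module

theorem sigma_thetaList (L : List (Fin n)) :
    sigma n (thetaList L) = (-1 : ℝ) ^ L.length • thetaList L := by
  induction L with
  | nil => simp
  | cons j L ih =>
    rw [thetaList_cons, sigma_mul, ih, sigma_theta, List.length_cons, pow_succ]
    simp

theorem thetaList_of_mem {i : Fin n} {L : List (Fin n)} (h : i ∈ L) :
    ∃ c : ℝ, thetaList L = c • (theta i * thetaList (L.erase i)) := by
  induction L with
  | nil => simp at h
  | cons j L ih =>
    by_cases hij : j = i
    · subst hij
      exact ⟨1, by simp⟩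
    · obtain ⟨c, hc⟩ := ih (by simpa [Ne.symm hij] using h)
      refine ⟨-c, ?_⟩
      rw [List.erase_cons_tail (by simpa using hij), thetaList_cons, thetaList_cons, hc,
        mul_smul_comm, ← mul_assoc, theta_mul_theta j i]
      simp [mul_assoc]

theorem theta_mul_thetaList_of_mem {i : Fin n} {L : List (Fin n)} (h : i ∈ L) :
    theta i * thetaList L = 0 := by
  obtain ⟨c, hc⟩ := thetaList_of_mem h
  rw [hc, mul_smul_comm, ← mul_assoc]
  simp

/-- A bilinear functional which vanishes on monomials vanishes. -/
theorem functional_eq_zero (t : SuperPoly n →ₗ[ℝ] SuperPoly n →ₗ[ℝ] ℝ)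
    (h : ∀ (k l : ℕ) (L L' : List (Fin n)), L.Nodup → L'.Nodup →
      t (coordX n ^ k * thetaList L) (coordX n ^ l * thetaList L') = 0) (F G : SuperPoly n) :
    t F G = 0 := by
  have span : ∀ f : SuperPoly n →ₗ[ℝ] ℝ,
      (∀ (k : ℕ) (L : List (Fin n)), L.Nodup → f (coordX n ^ k * thetaList L) = 0) →
      ∀ F, f F = 0 := by
    intro f hf F
    have hF : F ∈ Submodule.span ℝ {Y : SuperPoly n | ∃ (k : ℕ) (L : List (Fin n)),
        L.Nodup ∧ Y = coordX n ^ k * thetaList L} := by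
      induction F using induction with
      | one => exact Submodule.subset_span ⟨0, [], by simp, by simp⟩
      | add F G hF hG => exact add_mem hF hG
      | smul r F hF => exact Submodule.smul_mem _ r hF
      | x_mul F hF =>
        induction hF using Submodule.span_induction with
        | mem Y hY =>
          obtain ⟨k, L, hL, rfl⟩ := hY
          exact Submodule.subset_span ⟨k + 1, L, hL, by rw [pow_succ', mul_assoc]⟩
        | zero => simp
        | add Y Z _ _ hY hZ => rw [mul_add]; exact add_mem hY hZ
        | smul r Y _ hY => rw [mul_smul_comm]; exact Submodule.smul_mem _ r hY
      | theta_mul i F hF =>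
        induction hF using Submodule.span_induction with
        | mem Y hY =>
          obtain ⟨k, L, hL, rfl⟩ := hY
          rw [mul_coordX_pow_mul]
          by_cases hi : i ∈ L
          · rw [theta_mul_thetaList_of_mem hi, mul_zero]; exact zero_mem _
          · exact Submodule.subset_span ⟨k, i :: L, by simp [hi, hL], by simp⟩
        | zero => simp
        | add Y Z _ _ hY hZ => rw [mul_add]; exact add_mem hY hZ
        | smul r Y _ hY => rw [mul_smul_comm]; exact Submodule.smul_mem _ r hY
    induction hF using Submodule.span_induction with
    | mem Y hY => obtain ⟨k, L, hL, rfl⟩ := hY; exact hf k L hL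
    | zero => simp
    | add Y Z _ _ hY hZ => rw [map_add, hY, hZ, add_zero]
    | smul r Y _ hY => rw [map_smul, hY, smul_zero]
  exact span (t.flip G) (fun k L hL => span (t _) (fun l L' hL' => h k l L L' hL hL') G) F

/-- Monomials are eigenvectors of the field of `H = x`, with eigenvalue `k + |L|/2 + w` on densities
of weight `w`, while the target contributes the scalar `ν`. -/
theorem OriginInvariant.weight {lam mu nu : ℝ} {t : SuperPoly n →ₗ[ℝ] SuperPoly n →ₗ[ℝ] ℝ}
    (ht : OriginInvariant lam mu nu t) {k l : ℕ} {L L' : List (Fin n)}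
    (h : t (coordX n ^ k * thetaList L) (coordX n ^ l * thetaList L') ≠ 0) :
    nu = lam + mu + k + l + ((L.length + L'.length : ℕ) : ℝ) / 2 := by
  have e : ∀ (w : ℝ) (k : ℕ) (L : List (Fin n)), densityAction w (coordX n)
      (coordX n ^ k * thetaList L) =
        (k + (L.length : ℝ) / 2 + w) • (coordX n ^ k * thetaList L) := by
    intro w k L
    rw [densityAction_apply, contactField_coordX, partialX_mul, partialX_thetaList, mul_zero,
      add_zero, ← mul_assoc, coordX_mul_partialX_pow, eulerTheta_coordX_pow_mul,
      eulerTheta_thetaList, partialX_coordX, one_mul, mul_smul_comm, smul_mul_assoc]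
    module
  have h1 := ht.even (coordX n) (by simp) (by simp) (coordX n ^ k * thetaList L)
    (coordX n ^ l * thetaList L')
  rw [e, e] at h1
  simp only [map_smul, LinearMap.smul_apply, smul_eq_mul, partialX_coordX, eval0_one] at h1
  rw [← add_mul] at h1
  have h2 := mul_right_cancel₀ h h1
  push_cast
  linarith

end

end SuperPoly

/-! ### Action of the monomial fields on products with a spectator factor -/

namespace SuperPoly

noncomputable section

variable {n : ℕ}

theorem densityAction_odd_monomial (w : ℝ) (m : ℕ) (i : Fin n) (F : SuperPoly n) :
    densityAction w (coordX n ^ (m + 1) * theta i) F =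
      (1 / 2 : ℝ) • (coordX n ^ (m + 1) * (partialTheta i F + theta i * partialX n F)) +
      (m + 1 : ℝ) • (coordX n ^ m * (theta i * ((1 / 2 : ℝ) • eulerTheta n F + w • F))) := by
  rw [densityAction_apply, contactField_odd_monomial, partialX_mul, partialX_theta,
    partialX_coordX_pow_succ, mul_zero, add_zero, smul_mul_assoc, smul_mul_assoc, mul_assoc]
  simp only [mul_add, mul_smul_comm]
  module

theorem densityAction_even_monomial (w : ℝ) (m : ℕ) (i j : Fin n) (F : SuperPoly n) :
    densityAction w (coordX n ^ m * (theta i * theta j)) F =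
      (1 / 2 : ℝ) • (coordX n ^ m * (theta i * partialTheta j F - theta j * partialTheta i F)) +
      partialX n (coordX n ^ m) *
        (theta i * (theta j * ((1 / 2 : ℝ) • eulerTheta n F + w • F))) := by
  rw [densityAction_apply, contactField_even_monomial, partialX_mul (coordX n ^ m),
    partialX_theta_mul, partialX_theta]
  simp only [mul_add, mul_smul_comm, mul_zero, add_zero, mul_assoc]
  module

theorem theta_mul_coordX_pow_mul (i : Fin n) (k : ℕ) (F : SuperPoly n) :
    theta i * (coordX n ^ k * F) = coordX n ^ k * (theta i * F) :=
  mul_coordX_pow_mul k (theta i) F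

/-- `Y` has constant coefficients, does not involve `θ_i`, and is homogeneous of degree `d` in
the odd coordinates. -/
structure IsFree (i : Fin n) (d : ℝ) (Y : SuperPoly n) : Prop where
  partialX_eq : partialX n Y = 0
  partialTheta_eq : partialTheta i Y = 0
  eulerTheta_eq : eulerTheta n Y = d • Y

theorem IsFree.theta_mul {i j : Fin n} (hij : i ≠ j) {d : ℝ} {Y : SuperPoly n}
    (hY : IsFree i d Y) : IsFree i (d + 1) (theta j * Y) where
  partialX_eq := by rw [partialX_theta_mul, hY.partialX_eq, mul_zero]
  partialTheta_eq := by
    rw [partialTheta_theta_mul, hY.partialTheta_eq, if_neg hij, mul_zero, sub_zero]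
  eulerTheta_eq := by
    rw [eulerTheta_theta_mul, hY.eulerTheta_eq, mul_smul_comm]; module

theorem isFree_thetaList {i : Fin n} {L : List (Fin n)} (h : i ∉ L) :
    IsFree i L.length (thetaList L) :=
  ⟨partialX_thetaList L, partialTheta_thetaList h, eulerTheta_thetaList L⟩

theorem coordX_pow_succ_mul_partialX_pow (m k : ℕ) (F : SuperPoly n) :
    coordX n ^ (m + 1) * (partialX n (coordX n ^ k) * F) =
      (k : ℝ) • (coordX n ^ (k + m) * F) := by
  rw [pow_succ, mul_assoc, ← mul_assoc (coordX n), coordX_mul_partialX_pow, smul_mul_assoc,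
    mul_smul_comm, coordX_pow_mul_pow_mul, add_comm]

section

variable {i j : Fin n} {d : ℝ} {Y : SuperPoly n}

/-- A factor `Y` not involving `θ_i` enters only through its odd degree `d`, which the Euler
operator converts into the shift of the weight `w` to `w + d/2`. -/
theorem IsFree.odd_action (hY : IsFree i d Y) (w : ℝ) (m k : ℕ) :
    densityAction w (coordX n ^ (m + 1) * theta i) (coordX n ^ k * Y) =
      (k / 2 + (m + 1) * (w + d / 2) : ℝ) • (coordX n ^ (k + m) * (theta i * Y)) := by
  have hc : theta i * (partialX n (coordX n ^ k) * Y) =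
      partialX n (coordX n ^ k) * (theta i * Y) := by
    rw [partialX_coordX_pow, smul_mul_assoc, mul_smul_comm, mul_coordX_pow_mul, smul_mul_assoc]
  rw [densityAction_odd_monomial, partialTheta_coordX_pow_mul, hY.partialTheta_eq, mul_zero,
    zero_add, partialX_mul, hY.partialX_eq, mul_zero, add_zero, hc,
    coordX_pow_succ_mul_partialX_pow, eulerTheta_coordX_pow_mul, hY.eulerTheta_eq, add_comm k m]
  simp only [mul_add, mul_smul_comm, theta_mul_coordX_pow_mul, coordX_pow_mul_pow_mul]
  module

theorem theta_mul_theta_mul_self (i : Fin n) (F : SuperPoly n) :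
    theta i * (theta i * F) = 0 := by
  rw [← mul_assoc, theta_mul_self, zero_mul]

theorem theta_mul_theta_mul_theta_mul (i j : Fin n) (F : SuperPoly n) :
    theta i * (theta j * (theta i * F)) = 0 := by
  rw [← mul_assoc (theta j), theta_mul_theta j i, neg_mul, mul_neg, mul_assoc,
    theta_mul_theta_mul_self, neg_zero]

theorem IsFree.odd_action_theta (hY : IsFree i d Y) (w : ℝ) (m k : ℕ) :
    densityAction w (coordX n ^ (m + 1) * theta i) (coordX n ^ k * (theta i * Y)) =
      (1 / 2 : ℝ) • (coordX n ^ (k + m + 1) * Y) := by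
  rw [densityAction_odd_monomial, partialTheta_coordX_pow_mul, partialTheta_theta_mul,
    hY.partialTheta_eq, if_pos rfl, mul_zero, sub_zero, partialX_mul, partialX_theta_mul,
    hY.partialX_eq, eulerTheta_coordX_pow_mul, eulerTheta_theta_mul, hY.eulerTheta_eq,
    partialX_coordX_pow, show k + m + 1 = m + 1 + k by omega]
  simp only [mul_add, mul_smul_comm, smul_mul_assoc, theta_mul_coordX_pow_mul,
    theta_mul_theta_mul_self, mul_zero, smul_zero, add_zero, coordX_pow_mul_pow_mul]

theorem IsFree.even_action (hi : IsFree i d Y) (hj : IsFree j d Y) (w : ℝ) (m k : ℕ) :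
    densityAction w (coordX n ^ (m + 1) * (theta i * theta j)) (coordX n ^ k * Y) =
      ((m + 1) * (w + d / 2) : ℝ) • (coordX n ^ (k + m) * (theta i * (theta j * Y))) := by
  rw [add_comm k m]
  simp only [densityAction_even_monomial, partialTheta_coordX_pow_mul, hi.partialTheta_eq,
    hj.partialTheta_eq, partialX_coordX_pow_succ, eulerTheta_coordX_pow_mul, hi.eulerTheta_eq,
    mul_add, mul_smul_comm, smul_mul_assoc, theta_mul_coordX_pow_mul, mul_zero, smul_zero,
    zero_add, coordX_pow_mul_pow_mul, sub_zero]
  module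

theorem IsFree.rotation_action (hi : IsFree i d Y) (hj : IsFree j d Y) (w : ℝ) (k : ℕ) :
    densityAction w (coordX n ^ 0 * (theta i * theta j)) (coordX n ^ k * Y) = 0 := by
  simp only [densityAction_even_monomial, partialTheta_coordX_pow_mul, hi.partialTheta_eq,
    hj.partialTheta_eq]
  simp

theorem IsFree.even_action_theta_left (hij : i ≠ j) (hi : IsFree i d Y) (hj : IsFree j d Y)
    (w : ℝ) (m k : ℕ) :
    densityAction w (coordX n ^ m * (theta i * theta j)) (coordX n ^ k * (theta i * Y)) =
      -(1 / 2 : ℝ) • (coordX n ^ (k + m) * (theta j * Y)) := by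
  rw [add_comm k m]
  simp only [densityAction_even_monomial, partialTheta_coordX_pow_mul, partialTheta_theta_mul,
    hi.partialTheta_eq, hj.partialTheta_eq, if_true, if_neg hij.symm, eulerTheta_coordX_pow_mul,
    eulerTheta_theta_mul, hi.eulerTheta_eq, mul_add, mul_smul_comm, theta_mul_coordX_pow_mul,
    theta_mul_theta_mul_theta_mul, mul_zero, smul_zero, mul_neg, add_zero, sub_zero, zero_sub,
    coordX_pow_mul_pow_mul]
  module

theorem IsFree.even_action_theta_right (hij : i ≠ j) (hi : IsFree i d Y) (hj : IsFree j d Y)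
    (w : ℝ) (m k : ℕ) :
    densityAction w (coordX n ^ m * (theta i * theta j)) (coordX n ^ k * (theta j * Y)) =
      (1 / 2 : ℝ) • (coordX n ^ (k + m) * (theta i * Y)) := by
  rw [add_comm k m]
  simp only [densityAction_even_monomial, partialTheta_coordX_pow_mul, partialTheta_theta_mul,
    hi.partialTheta_eq, hj.partialTheta_eq, if_true, if_neg hij, eulerTheta_coordX_pow_mul,
    eulerTheta_theta_mul, hi.eulerTheta_eq, mul_add, mul_smul_comm, theta_mul_coordX_pow_mul,
    theta_mul_theta_mul_self, mul_zero, smul_zero, add_zero, sub_zero,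
    coordX_pow_mul_pow_mul]

theorem IsFree.even_action_theta_theta (hij : i ≠ j) (hi : IsFree i d Y) (hj : IsFree j d Y)
    (w : ℝ) (m k : ℕ) :
    densityAction w (coordX n ^ m * (theta i * theta j))
      (coordX n ^ k * (theta i * (theta j * Y))) = 0 := by
  simp only [densityAction_even_monomial, partialTheta_coordX_pow_mul, partialTheta_theta_mul,
    hi.partialTheta_eq, hj.partialTheta_eq, if_true, if_neg hij, if_neg hij.symm,
    eulerTheta_coordX_pow_mul, eulerTheta_theta_mul, hi.eulerTheta_eq, mul_add, mul_smul_comm,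
    theta_mul_coordX_pow_mul, theta_mul_theta_mul_self, theta_mul_theta_mul_theta_mul, mul_zero,
    smul_zero, add_zero, sub_zero, zero_sub, mul_neg, neg_zero]

end

section

variable {lam mu nu : ℝ} {t : SuperPoly n →ₗ[ℝ] SuperPoly n →ₗ[ℝ] ℝ}

theorem OriginInvariant.even_monomial (ht : OriginInvariant lam mu nu t) (m : ℕ) (i j : Fin n)
    (F G : SuperPoly n) :
    t (densityAction lam (coordX n ^ m * (theta i * theta j)) F) G +
      t F (densityAction mu (coordX n ^ m * (theta i * theta j)) G) = 0 := by
  rw [ht.even _ (by simp [sigma_mul]) (by simp [eval0_mul]), partialX_mul, map_add, eval0_mul,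
    eval0_mul, eval0_mul, partialX_theta_mul, partialX_theta]
  simp

/-- The exponent must be positive: `η_k(x^{m+1} θ_i)` vanishes at the origin, whereas `η_i(θ_i) = 1`
does not. -/
theorem OriginInvariant.odd_monomial (ht : OriginInvariant lam mu nu t) (m : ℕ) (i : Fin n)
    (F G : SuperPoly n) :
    t (densityAction lam (coordX n ^ (m + 1) * theta i) F) G +
      t (sigma n F) (densityAction mu (coordX n ^ (m + 1) * theta i) G) = 0 := by
  refine ht.odd _ (by simp [sigma_mul]) (fun k => ?_) F G
  rw [eta_mul, eta_coordX_pow_succ, map_add, eval0_mul, eval0_mul, pow_succ, sigma_mul]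
  simp [eval0_mul]

end

end

end SuperPoly

/-! ### The recurrences attached to a pair of odd coordinates -/

namespace SuperPoly

noncomputable section

variable {n : ℕ}

/-- The linear relations between the values of an invariant functional on monomials in one even
and two odd coordinates. Here `A k l` stands for the value on `x^k ⊗ x^l`, `P k l`, `Q k l` and
`B k l` for the values with a factor `θ_i θ_j` on the left, on the right, and on both sides, and
`S k l`, `R k l` for the values on `x^k θ_i ⊗ x^l θ_i` and `x^k θ_i ⊗ x^l θ_j`. -/
structure PairRelations (lam mu : ℝ) (A P Q S R B : ℕ → ℕ → ℝ) : Prop where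
  shift_S : ∀ k m l, S (k + m) l = S k (l + m)
  shift_R : ∀ k m l, R (k + m) l = R k (l + m)
  even_PQ : ∀ k m l, lam * P (k + m) l + mu * Q k (l + m) = 0
  mu_B : ∀ k l, mu * B k l = 0
  odd_AS : ∀ k m l, A (k + m + 1) l = (l + 2 * mu * (m + 1)) * S k (l + m)
  odd_SA : ∀ k m l, (k + 2 * lam * (m + 1)) * S (k + m) l + A k (l + m + 1) = 0
  odd_PR : ∀ k m l, (k + m + 1 + 2 * lam * (m + 1)) * P (k + m) l
    + (l + 2 * mu * (m + 1)) * R k (l + m) = 0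
  odd_RQ : ∀ k m l, (k + 2 * lam * (m + 1)) * R (k + m) l
    + (l + m + 1 + 2 * mu * (m + 1)) * Q k (l + m) = 0
  odd_PR' : ∀ k m l, P k (l + m + 1) = R (k + m + 1) l
  odd_SB : ∀ k m l, S (k + m + 1) l + (l + m + 1 + 2 * mu * (m + 1)) * B k (l + m) = 0

variable {lam mu : ℝ} {A P Q S R B : ℕ → ℕ → ℝ}

/-- By `shift_S`, `S` depends only on `k + l = N + 1`. Two expressions for `A 2 N` give `μ S = 0`,
and two for `A N 2` give `λ S = 0`. The two expressions for `A 1 (N + 1)` then leave `(N + 2) S =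
0`. -/
theorem PairRelations.S_eq_zero (h : PairRelations lam mu A P Q S R B) {k l : ℕ}
    (hkl : 1 ≤ k + l) : S k l = 0 := by
  have e : S k l = S (k + l) 0 := by rw [h.shift_S, zero_add]
  obtain ⟨N, hN⟩ := Nat.exists_eq_add_of_le' hkl
  rw [e, hN]
  have c : ∀ a b, a + b = N + 1 → S a b = S (N + 1) 0 := by
    intro a b hab
    have := h.shift_S a b 0
    rw [zero_add, hab] at this
    exact this.symm
  have a1 := h.odd_AS 1 0 N
  have a2 := h.odd_AS 0 1 N
  have b1 := h.odd_SA N 0 1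
  have b2 := h.odd_SA N 1 0
  have c1 := h.odd_AS 0 0 (N + 1)
  have c2 := h.odd_SA 1 0 N
  rw [c _ _ (by omega)] at a1 a2 b1 b2 c1 c2
  norm_num at a1 a2 b1 b2 c1 c2
  have hmu : mu * S (N + 1) 0 = 0 := by linarith
  have hlam : lam * S (N + 1) 0 = 0 := by linarith
  have : (N + 2 : ℝ) * S (N + 1) 0 = 0 := by linarith
  exact (mul_eq_zero.mp this).resolve_left (by positivity)

theorem PairRelations.A_eq_zero (h : PairRelations lam mu A P Q S R B) {k l : ℕ}
    (hkl : 2 ≤ k + l) : A k l = 0 := by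
  rcases k with _ | k
  · obtain ⟨l, rfl⟩ : ∃ l', l = l' + 1 := ⟨l - 1, by omega⟩
    have := h.odd_SA 0 0 l
    rw [h.S_eq_zero (by omega), mul_zero, zero_add] at this
    exact this
  · have := h.odd_AS k 0 l
    rw [h.S_eq_zero (by omega), mul_zero] at this
    exact this

/-- No lower bound on `k + l` is needed: `odd_SB` involves `S` only in degree `k + l + 1`, where it
vanishes, and `mu_B` then removes the weight, leaving `(l + 1) B = 0`. -/
theorem PairRelations.B_eq_zero (h : PairRelations lam mu A P Q S R B) (k l : ℕ) :
    B k l = 0 := by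
  have h1 := h.odd_SB k 0 l
  have h2 := h.mu_B k l
  rw [h.S_eq_zero (by omega), zero_add] at h1
  norm_num at h1
  have : (l + 1 + 2 * mu) * B k l = (l + 1) * B k l + 2 * (mu * B k l) := by ring
  rw [← mul_eq_zero, this, h2, mul_zero, add_zero] at h1
  exact (mul_eq_zero.mp h1).resolve_left (by positivity)

/-- The extreme values `P (N + 1) 0` and `Q 0 (N + 1)` come along because they are needed first. In
`odd_PR` and `odd_RQ`, twice the case `m = 0` minus the case `m = 1` cancels `R` and the weights,
leaving `(N + 2) P = 0` and `(N + 2) Q = 0`. Then `μ R = λ R = 0`, and with `P 0 (N + 1) = R 1 N`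
the relation `odd_PR` becomes `(N + 2) R = 0`. -/
theorem PairRelations.R_eq_zero (h : PairRelations lam mu A P Q S R B) {k l : ℕ}
    (hkl : 1 ≤ k + l) : R k l = 0 ∧ P (k + l) 0 = 0 ∧ Q 0 (k + l) = 0 := by
  have e : R k l = R (k + l) 0 := by rw [h.shift_R, zero_add]
  obtain ⟨N, hN⟩ := Nat.exists_eq_add_of_le' hkl
  rw [e, hN]
  have c : ∀ a b, a + b = N + 1 → R a b = R (N + 1) 0 := by
    intro a b hab
    have := h.shift_R a b 0
    rw [zero_add, hab] at this
    exact this.symm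
  have a1 := h.odd_PR (N + 1) 0 0
  have a2 := h.odd_PR N 1 0
  have b1 := h.odd_RQ 0 0 (N + 1)
  have b2 := h.odd_RQ 0 1 N
  have c1 := h.odd_PR 0 0 (N + 1)
  have c2 := h.odd_PR' 0 0 N
  have d := h.even_PQ 0 0 (N + 1)
  rw [c _ _ (by omega)] at a1 a2 b1 b2 c1 c2
  simp only [add_zero, zero_add, Nat.cast_add, Nat.cast_one, Nat.cast_zero] at *
  have hP : (N + 2 : ℝ) * P (N + 1) 0 = 0 := by linarith
  have hQ : (N + 2 : ℝ) * Q 0 (N + 1) = 0 := by linarith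
  have hP := (mul_eq_zero.mp hP).resolve_left (by positivity)
  have hQ := (mul_eq_zero.mp hQ).resolve_left (by positivity)
  rw [hP] at a1 a2
  rw [hQ] at b1 b2 d
  rw [c2] at c1 d
  have : (N + 2 : ℝ) * R (N + 1) 0 = 0 := by linarith
  exact ⟨(mul_eq_zero.mp this).resolve_left (by positivity), hP, hQ⟩

/-- With `R` and the extreme values of `Q` gone, `odd_PR` reads `(k + 1 + 2λ) P = 0` and `even_PQ`
reads `λ P = 0`. -/
theorem PairRelations.P_eq_zero (h : PairRelations lam mu A P Q S R B) {k l : ℕ}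
    (hkl : 1 ≤ k + l) : P k l = 0 := by
  have h1 := h.odd_PR k 0 l
  have h2 := h.even_PQ 0 k l
  rw [add_zero, (h.R_eq_zero (l := l + 0) (by omega)).1] at h1
  rw [add_comm l k, (h.R_eq_zero hkl).2.2, zero_add] at h2
  norm_num at h1 h2
  rw [← mul_eq_zero] at h1 h2
  have : (k + 1 : ℝ) * P k l = 0 := by linarith
  exact (mul_eq_zero.mp this).resolve_left (by positivity)

theorem PairRelations.Q_eq_zero (h : PairRelations lam mu A P Q S R B) {k l : ℕ}
    (hkl : 1 ≤ k + l) : Q k l = 0 := by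
  have h1 := h.odd_RQ k 0 l
  have h2 := h.even_PQ k l 0
  rw [add_zero, (h.R_eq_zero (by omega)).1] at h1
  rw [(h.R_eq_zero hkl).2.1, zero_add] at h2
  norm_num at h1 h2
  rw [← mul_eq_zero] at h1 h2
  have : (l + 1 : ℝ) * Q k l = 0 := by linarith
  exact (mul_eq_zero.mp this).resolve_left (by positivity)

section

variable {nu : ℝ} {t : SuperPoly n →ₗ[ℝ] SuperPoly n →ₗ[ℝ] ℝ} {i j : Fin n}
  {s s' e : ℝ} {Y Y' : SuperPoly n}

/-- The rotation field of `θ_i θ_j` sends `θ_j Y` to `½ θ_i Y` and kills `Z`. -/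
theorem OriginInvariant.theta_left_eq_zero (ht : OriginInvariant lam mu nu t) (hij : i ≠ j)
    (hi : IsFree i s Y) (hj : IsFree j s Y) (k : ℕ) {Z : SuperPoly n}
    (hZ : densityAction mu (coordX n ^ 0 * (theta i * theta j)) Z = 0) :
    t (coordX n ^ k * (theta i * Y)) Z = 0 := by
  have h := ht.even_monomial 0 i j (coordX n ^ k * (theta j * Y)) Z
  rw [hi.even_action_theta_right hij hj, hZ] at h
  simpa using h

theorem OriginInvariant.theta_right_eq_zero (ht : OriginInvariant lam mu nu t) (hij : i ≠ j)
    (hi : IsFree i s Y) (hj : IsFree j s Y) (k : ℕ) {Z : SuperPoly n}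
    (hZ : densityAction lam (coordX n ^ 0 * (theta i * theta j)) Z = 0) :
    t Z (coordX n ^ k * (theta i * Y)) = 0 := by
  have h := ht.even_monomial 0 i j Z (coordX n ^ k * (theta j * Y))
  rw [hi.even_action_theta_right hij hj, hZ] at h
  simpa using h

theorem OriginInvariant.swap_S (ht : OriginInvariant lam mu nu t) (hij : i ≠ j)
    (hi : IsFree i s Y) (hj : IsFree j s Y) (hi' : IsFree i s' Y') (hj' : IsFree j s' Y')
    (k m l : ℕ) :
    t (coordX n ^ (k + m) * (theta j * Y)) (coordX n ^ l * (theta j * Y')) =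
      t (coordX n ^ k * (theta i * Y)) (coordX n ^ (l + m) * (theta i * Y')) := by
  have h := ht.even_monomial m i j (coordX n ^ k * (theta i * Y)) (coordX n ^ l * (theta j * Y'))
  rw [hi.even_action_theta_left hij hj, hi'.even_action_theta_right hij hj'] at h
  simp only [map_smul, LinearMap.smul_apply, smul_eq_mul] at h
  linarith

theorem OriginInvariant.swap_R (ht : OriginInvariant lam mu nu t) (hij : i ≠ j)
    (hi : IsFree i s Y) (hj : IsFree j s Y) (hi' : IsFree i s' Y') (hj' : IsFree j s' Y')
    (k m l : ℕ) :
    t (coordX n ^ (k + m) * (theta j * Y)) (coordX n ^ l * (theta i * Y')) =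
      -t (coordX n ^ k * (theta i * Y)) (coordX n ^ (l + m) * (theta j * Y')) := by
  have h := ht.even_monomial m i j (coordX n ^ k * (theta i * Y)) (coordX n ^ l * (theta i * Y'))
  rw [hi.even_action_theta_left hij hj, hi'.even_action_theta_left hij hj'] at h
  simp only [map_smul, LinearMap.smul_apply, smul_eq_mul] at h
  linarith

/-- Each relation is invariance under `x^m θ_i θ_j` or `x^{m+1} θ_i`, tested on one pair of
monomials. The spectators `Y`, `Y'` shift the weights by half their odd degrees. The parity sign `e`
of `Y`, produced by `σ` in the odd relations, is absorbed into `S` and `R`. -/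
theorem OriginInvariant.pairRelations (ht : OriginInvariant lam mu nu t) (hij : i ≠ j)
    (hi : IsFree i s Y) (hj : IsFree j s Y) (hi' : IsFree i s' Y') (hj' : IsFree j s' Y')
    (hY : sigma n Y = e • Y) (he : e * e = 1) :
    PairRelations (lam + s / 2) (mu + s' / 2)
      (fun k l => t (coordX n ^ k * Y) (coordX n ^ l * Y'))
      (fun k l => t (coordX n ^ k * (theta i * (theta j * Y))) (coordX n ^ l * Y'))
      (fun k l => t (coordX n ^ k * Y) (coordX n ^ l * (theta i * (theta j * Y'))))
      (fun k l => e * t (coordX n ^ k * (theta i * Y)) (coordX n ^ l * (theta i * Y')))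
      (fun k l => e * t (coordX n ^ k * (theta i * Y)) (coordX n ^ l * (theta j * Y')))
      (fun k l => t (coordX n ^ k * (theta i * (theta j * Y)))
        (coordX n ^ l * (theta i * (theta j * Y')))) := by
  have sS := ht.swap_S hij hi hj hi' hj'
  have sR := ht.swap_R hij hi hj hi' hj'
  have sS0 := fun k l => sS k 0 l
  have sR0 := fun k l => sR k 0 l
  simp only [add_zero] at sS0 sR0
  have hσ : ∀ k, sigma n (coordX n ^ k * Y) = e • (coordX n ^ k * Y) := fun k => by
    rw [sigma_mul, hY, sigma_coordX_pow, mul_smul_comm]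
  have hσ1 : ∀ a k, sigma n (coordX n ^ k * (theta a * Y)) =
      -(e • (coordX n ^ k * (theta a * Y))) := fun a k => by
    rw [sigma_mul, sigma_mul, hY, sigma_coordX_pow, sigma_theta, mul_smul_comm, neg_mul, smul_neg,
      mul_neg, mul_smul_comm]
  have hσ2 : ∀ k, sigma n (coordX n ^ k * (theta i * (theta j * Y))) =
      e • (coordX n ^ k * (theta i * (theta j * Y))) := fun k => by
    rw [sigma_mul, sigma_mul, sigma_mul, hY, sigma_coordX_pow, sigma_theta, sigma_theta]
    simp
  have hij1 := hi.theta_mul hij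
  have hij1' := hi'.theta_mul hij
  constructor
  · intro k m l
    rw [← sS0, sS]
  · intro k m l
    have h := sR0 (k + m) l
    rw [sR] at h
    rw [neg_inj.mp h]
  · intro k m l
    have h := ht.even_monomial (m + 1) i j (coordX n ^ k * Y) (coordX n ^ l * Y')
    rw [hi.even_action hj, hi'.even_action hj'] at h
    simp only [map_smul, LinearMap.smul_apply, smul_eq_mul] at h
    -- The field of `x^{m+1} θ_i θ_j` produces the common factor `m + 1`, which is cancelled.
    have hm : (m + 1 : ℝ) ≠ 0 := by positivity
    refine mul_left_cancel₀ hm ?_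
    rw [mul_zero]
    linarith
  · intro k l
    have h := ht.even_monomial 1 i j (coordX n ^ k * (theta i * (theta j * Y)))
      (coordX n ^ l * Y')
    rw [hi.even_action_theta_theta hij hj, hi'.even_action hj' mu 0] at h
    simpa using h
  · intro k m l
    have h := ht.odd_monomial m i (coordX n ^ k * (theta i * Y)) (coordX n ^ l * Y')
    rw [hi.odd_action_theta, hi'.odd_action, hσ1] at h
    simp only [map_smul, LinearMap.smul_apply, smul_eq_mul, map_neg, LinearMap.neg_apply] at h
    linarith
  · intro k m l
    have h := ht.odd_monomial m i (coordX n ^ k * Y) (coordX n ^ l * (theta i * Y'))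
    rw [hi'.odd_action_theta, hi.odd_action, hσ] at h
    simp only [map_smul, LinearMap.smul_apply, smul_eq_mul] at h
    linear_combination (2 * e) * h - (t (coordX n ^ k * Y) (coordX n ^ (l + m + 1) * Y')) * he
  · intro k m l
    have h := ht.odd_monomial m i (coordX n ^ k * (theta j * Y)) (coordX n ^ l * Y')
    rw [hij1.odd_action, hi'.odd_action, hσ1] at h
    simp only [map_smul, LinearMap.smul_apply, smul_eq_mul, map_neg, LinearMap.neg_apply,
      sR0] at h
    linarith
  · intro k m l
    have h := ht.odd_monomial m i (coordX n ^ k * Y) (coordX n ^ l * (theta j * Y'))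
    rw [hi.odd_action, hij1'.odd_action, hσ] at h
    simp only [map_smul, LinearMap.smul_apply, smul_eq_mul] at h
    linear_combination (2 * e) * h - ((l + m + 1 + 2 * (mu + s' / 2) * (m + 1)) *
      t (coordX n ^ k * Y) (coordX n ^ (l + m) * (theta i * (theta j * Y')))) * he
  · intro k m l
    have h := ht.odd_monomial m i (coordX n ^ k * (theta i * (theta j * Y)))
      (coordX n ^ l * (theta i * Y'))
    rw [hij1.odd_action_theta, hi'.odd_action_theta, hσ2] at h
    simp only [map_smul, LinearMap.smul_apply, smul_eq_mul, sR0] at h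
    linear_combination (2 * e) * h - (t (coordX n ^ k * (theta i * (theta j * Y)))
      (coordX n ^ (l + m + 1) * Y')) * he
  · intro k m l
    have h := ht.odd_monomial m i (coordX n ^ k * (theta i * (theta j * Y)))
      (coordX n ^ l * (theta j * Y'))
    rw [hij1.odd_action_theta, hij1'.odd_action, hσ2] at h
    simp only [map_smul, LinearMap.smul_apply, smul_eq_mul, sS0] at h
    linear_combination (2 * e) * h - ((l + m + 1 + 2 * (mu + s' / 2) * (m + 1)) *
      t (coordX n ^ k * (theta i * (theta j * Y)))
        (coordX n ^ (l + m) * (theta i * (theta j * Y')))) * he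

end

end

end SuperPoly

/-! ### Degree bound for each pair of odd coordinates -/

namespace SuperPoly

noncomputable section

variable {n : ℕ}

theorem densityAction_neg (w : ℝ) (H F : SuperPoly n) :
    densityAction w (-H) F = -densityAction w H F := by
  simp only [densityAction_apply, contactField_apply, map_neg, neg_mul, Finset.sum_neg_distrib,
    smul_neg]
  abel

/-- Brings a monomial to the form required by `PairRelations`, pulling `θ_i` and `θ_j` to the front
at the cost of a scalar `c`. -/
theorem exists_thetaList_eq {i j : Fin n} (hij : i ≠ j) {L : List (Fin n)} (hL : L.Nodup) :
    ∃ (Y : SuperPoly n) (s e c : ℝ), IsFree i s Y ∧ IsFree j s Y ∧ sigma n Y = e • Y ∧ e * e = 1 ∧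
      ((L.count i = 0 ∧ L.count j = 0 ∧ thetaList L = c • Y) ∨
        (L.count i = 1 ∧ L.count j = 0 ∧ thetaList L = c • (theta i * Y)) ∨
        (L.count i = 0 ∧ L.count j = 1 ∧ thetaList L = c • (theta j * Y)) ∨
        (L.count i = 1 ∧ L.count j = 1 ∧ thetaList L = c • (theta i * (theta j * Y)))) := by
  have free : ∀ L' : List (Fin n), i ∉ L' → j ∉ L' →
      IsFree i L'.length (thetaList L') ∧ IsFree j L'.length (thetaList L') ∧
      sigma n (thetaList L') = (-1 : ℝ) ^ L'.length • thetaList L' ∧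
      (-1 : ℝ) ^ L'.length * (-1) ^ L'.length = 1 := fun L' h1 h2 =>
    ⟨isFree_thetaList h1, isFree_thetaList h2, sigma_thetaList L', by
      rw [← mul_pow]; norm_num⟩
  have nd : ∀ (a : Fin n) {L : List (Fin n)}, L.Nodup → a ∉ L.erase a := fun a L h =>
    h.not_mem_erase
  by_cases hi : i ∈ L <;> by_cases hj : j ∈ L
  · obtain ⟨c, hc⟩ := thetaList_of_mem hi
    have hj' : j ∈ L.erase i := (List.mem_erase_of_ne hij.symm).mpr hj
    obtain ⟨c', hc'⟩ := thetaList_of_mem hj'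
    obtain ⟨f1, f2, f3, f4⟩ := free ((L.erase i).erase j)
      (fun h => nd i hL (List.mem_of_mem_erase h)) (nd j (hL.erase i))
    refine ⟨_, _, _, c * c', f1, f2, f3, f4, Or.inr (Or.inr (Or.inr
      ⟨List.count_eq_one_of_mem hL hi, List.count_eq_one_of_mem hL hj, ?_⟩))⟩
    rw [hc, hc', mul_smul_comm, smul_smul]
  · obtain ⟨c, hc⟩ := thetaList_of_mem hi
    obtain ⟨f1, f2, f3, f4⟩ := free (L.erase i) (nd i hL) (fun h => hj (List.mem_of_mem_erase h))
    exact ⟨_, _, _, c, f1, f2, f3, f4, Or.inr (Or.inl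
      ⟨List.count_eq_one_of_mem hL hi, List.count_eq_zero_of_not_mem hj, hc⟩)⟩
  · obtain ⟨c, hc⟩ := thetaList_of_mem hj
    obtain ⟨f1, f2, f3, f4⟩ := free (L.erase j) (fun h => hi (List.mem_of_mem_erase h)) (nd j hL)
    exact ⟨_, _, _, c, f1, f2, f3, f4, Or.inr (Or.inr (Or.inl
      ⟨List.count_eq_zero_of_not_mem hi, List.count_eq_one_of_mem hL hj, hc⟩))⟩
  · obtain ⟨f1, f2, f3, f4⟩ := free L hi hj
    exact ⟨_, _, _, 1, f1, f2, f3, f4, Or.inl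
      ⟨List.count_eq_zero_of_not_mem hi, List.count_eq_zero_of_not_mem hj, (one_smul _ _).symm⟩⟩

variable {lam mu nu : ℝ} {t : SuperPoly n →ₗ[ℝ] SuperPoly n →ₗ[ℝ] ℝ}

/-- A nonzero value of an invariant functional on a pair of monomials forces their total degree in
`x` (counted twice) and in any two odd coordinates to be `0` or `2`. -/
theorem OriginInvariant.pair_degree (ht : OriginInvariant lam mu nu t) {i j : Fin n} (hij : i ≠ j)
    {k l : ℕ} {L L' : List (Fin n)} (hL : L.Nodup) (hL' : L'.Nodup)
    (h : t (coordX n ^ k * thetaList L) (coordX n ^ l * thetaList L') ≠ 0) :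
    2 * (k + l) + (L.count i + L.count j + (L'.count i + L'.count j)) = 0 ∨
      2 * (k + l) + (L.count i + L.count j + (L'.count i + L'.count j)) = 2 := by
  obtain ⟨Y, s, e, c, hi, hj, hY, he, hc⟩ := exists_thetaList_eq hij hL
  obtain ⟨Y', s', e', c', hi', hj', -, -, hc'⟩ := exists_thetaList_eq hij hL'
  have rel := ht.pairRelations hij hi hj hi' hj' hY he
  have he0 : e ≠ 0 := fun h => by simp [h] at he
  have hA := fun h => rel.A_eq_zero (k := k) (l := l) h
  have hP := fun h => rel.P_eq_zero (k := k) (l := l) h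
  have hQ := fun h => rel.Q_eq_zero (k := k) (l := l) h
  have hB := rel.B_eq_zero k l
  have hS := fun h => (mul_eq_zero.mp (rel.S_eq_zero (k := k) (l := l) h)).resolve_left he0
  have hR := fun h => (mul_eq_zero.mp (rel.R_eq_zero (k := k) (l := l) h).1).resolve_left he0
  have hS' := ht.swap_S hij hi hj hi' hj' k 0 l
  have hR' := ht.swap_R hij hi hj hi' hj' k 0 l
  simp only [add_zero] at hS' hR'
  have r0 : ∀ w, densityAction w (coordX n ^ 0 * (theta i * theta j)) (coordX n ^ k * Y) = 0 :=
    fun w => hi.rotation_action hj w k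
  have r0' : ∀ w, densityAction w (coordX n ^ 0 * (theta i * theta j)) (coordX n ^ l * Y') = 0 :=
    fun w => hi'.rotation_action hj' w l
  have r2 : ∀ w, densityAction w (coordX n ^ 0 * (theta i * theta j))
      (coordX n ^ k * (theta i * (theta j * Y))) = 0 :=
    fun w => hi.even_action_theta_theta hij hj w 0 k
  have r2' : ∀ w, densityAction w (coordX n ^ 0 * (theta i * theta j))
      (coordX n ^ l * (theta i * (theta j * Y'))) = 0 :=
    fun w => hi'.even_action_theta_theta hij hj' w 0 l
  -- The rotation with `i` and `j` interchanged is the negative one; it serves the cases where `θ_j`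
  -- stands alone.
  have neg : ∀ {w : ℝ} {Z : SuperPoly n},
      densityAction w (coordX n ^ 0 * (theta i * theta j)) Z = 0 →
      densityAction w (coordX n ^ 0 * (theta j * theta i)) Z = 0 := by
    intro w Z hZ
    have : coordX n ^ 0 * (theta j * theta i) = -(coordX n ^ 0 * (theta i * theta j)) := by
      rw [theta_mul_theta, mul_neg]
    rw [this, densityAction_neg, hZ, neg_zero]
  by_contra hcon
  rw [not_or] at hcon
  -- Sixteen cases, by which of `θ_i, θ_j` occur on each side. When their total number is odd a
  -- rotation kills the value in every degree; the even cases are the entries `A`, `P`, `Q`, `B`,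
  -- and `S`, `R` up to exchanging `i` and `j`.
  rcases hc with ⟨n1, n2, hc⟩ | ⟨n1, n2, hc⟩ | ⟨n1, n2, hc⟩ | ⟨n1, n2, hc⟩ <;>
  rcases hc' with ⟨n1', n2', hc'⟩ | ⟨n1', n2', hc'⟩ | ⟨n1', n2', hc'⟩ | ⟨n1', n2', hc'⟩ <;>
  rw [n1, n2, n1', n2'] at hcon <;>
  rw [hc, hc'] at h <;>
  simp only [mul_smul_comm, map_smul, LinearMap.smul_apply, smul_eq_mul, ne_eq, mul_eq_zero,
    not_or] at h <;>
  apply h.2.2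
  · exact hA (by omega)
  · exact ht.theta_right_eq_zero hij hi' hj' l (r0 _)
  · exact ht.theta_right_eq_zero hij.symm hj' hi' l (neg (r0 _))
  · exact hQ (by omega)
  · exact ht.theta_left_eq_zero hij hi hj k (r0' _)
  · exact hS (by omega)
  · exact hR (by omega)
  · exact ht.theta_left_eq_zero hij hi hj k (r2' _)
  · exact ht.theta_left_eq_zero hij.symm hj hi k (neg (r0' _))
  · rw [hR', hR (by omega), neg_zero]
  · rw [hS', hS (by omega)]
  · exact ht.theta_left_eq_zero hij.symm hj hi k (neg (r2' _))
  · exact hP (by omega)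
  · exact ht.theta_right_eq_zero hij hi' hj' l (r2 _)
  · exact ht.theta_right_eq_zero hij.symm hj' hi' l (neg (r2 _))
  · exact hB

end

end SuperPoly

/-! ### Cubic fields and the bound on the total degree -/

namespace SuperPoly

noncomputable section

variable {n : ℕ}

theorem densityAction_cubic (w : ℝ) (i j k : Fin n) (F : SuperPoly n) :
    densityAction w (theta i * (theta j * theta k)) F =
      -((1 / 2 : ℝ) • (theta i * (theta j * (theta k * partialX n F)))) +
      (1 / 2 : ℝ) • (theta j * (theta k * partialTheta i F) - theta i * (theta k * partialTheta j F)
        + theta i * (theta j * partialTheta k F)) := by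
  rw [densityAction_apply, contactField_cubic, partialX_theta_mul, partialX_theta_mul]
  simp

theorem isFree_one (i : Fin n) : IsFree i 0 (1 : SuperPoly n) :=
  ⟨by simp, by simp, by simp⟩

theorem isFree_theta {i j : Fin n} (hij : i ≠ j) : IsFree i 1 (theta j : SuperPoly n) := by
  simpa using (isFree_one i).theta_mul hij

section

variable {i j k : Fin n} {d : ℝ} {Y : SuperPoly n}

theorem IsFree.cubic_action_coordX (hi : IsFree i d Y) (hj : IsFree j d Y) (hk : IsFree k d Y)
    (w : ℝ) : densityAction w (theta i * (theta j * theta k)) (coordX n * Y) =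
      -(1 / 2 : ℝ) • (theta i * (theta j * (theta k * Y))) := by
  simp [densityAction_cubic, partialX_mul, hi.partialX_eq, partialTheta_coordX_mul,
    hi.partialTheta_eq, hj.partialTheta_eq, hk.partialTheta_eq]

theorem IsFree.cubic_action (hi : IsFree i d Y) (hj : IsFree j d Y) (hk : IsFree k d Y)
    (w : ℝ) : densityAction w (theta i * (theta j * theta k)) Y = 0 := by
  simp [densityAction_cubic, hi.partialX_eq, hi.partialTheta_eq, hj.partialTheta_eq,
    hk.partialTheta_eq]

theorem IsFree.cubic_action_theta (hij : i ≠ j) (hik : i ≠ k) (hi : IsFree i d Y)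
    (hj : IsFree j d Y) (hk : IsFree k d Y) (w : ℝ) :
    densityAction w (theta i * (theta j * theta k)) (theta i * Y) =
      (1 / 2 : ℝ) • (theta j * (theta k * Y)) := by
  simp [densityAction_cubic, partialX_theta_mul, hi.partialX_eq, partialTheta_theta_mul,
    hi.partialTheta_eq, hj.partialTheta_eq, hk.partialTheta_eq, hij.symm, hik.symm]

end

variable {lam mu nu : ℝ} {t : SuperPoly n →ₗ[ℝ] SuperPoly n →ₗ[ℝ] ℝ}

theorem OriginInvariant.cubic (ht : OriginInvariant lam mu nu t) (i j k : Fin n)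
    (F G : SuperPoly n) :
    t (densityAction lam (theta i * (theta j * theta k)) F) G +
      t (sigma n F) (densityAction mu (theta i * (theta j * theta k)) G) = 0 := by
  refine ht.odd _ (by simp [sigma_mul]) (fun l => ?_) F G
  simp [eta_mul, eval0_mul]

/-- The cubic field turns `x Y` into `-½ θ_i θ_j θ_k Y` and kills `Y'`. -/
theorem OriginInvariant.cubic_left_eq_zero (ht : OriginInvariant lam mu nu t) {i j k : Fin n}
    {d d' : ℝ} {Y Y' : SuperPoly n} (hi : IsFree i d Y) (hj : IsFree j d Y) (hk : IsFree k d Y)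
    (hi' : IsFree i d' Y') (hj' : IsFree j d' Y') (hk' : IsFree k d' Y') :
    t (theta i * (theta j * (theta k * Y))) Y' = 0 := by
  have h := ht.cubic i j k (coordX n * Y) Y'
  rw [hi.cubic_action_coordX hj hk, hi'.cubic_action hj' hk'] at h
  simpa using h

theorem OriginInvariant.cubic_right_eq_zero (ht : OriginInvariant lam mu nu t) {i j k : Fin n}
    {d d' : ℝ} {Y Y' : SuperPoly n} (hi : IsFree i d Y) (hj : IsFree j d Y) (hk : IsFree k d Y)
    (hi' : IsFree i d' Y') (hj' : IsFree j d' Y') (hk' : IsFree k d' Y') :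
    t Y (theta i * (theta j * (theta k * Y'))) = 0 := by
  -- The first argument is `σY` so that the sign rule of the odd relation restores `Y`.
  have h := ht.cubic i j k (sigma n Y) (coordX n * Y')
  have hz : densityAction lam (theta i * (theta j * theta k)) (sigma n Y) = 0 := by
    have := sigma_densityAction_of_odd (H := theta i * (theta j * theta k)) (by simp [sigma_mul])
      lam Y
    rw [hi.cubic_action hj hk, map_zero] at this
    exact neg_eq_zero.mp this.symm
  rw [hi'.cubic_action_coordX hj' hk', hz, sigma_sigma] at h
  simpa using h

/-- The cubic field of `θ_c θ_a θ_b`, applied to `θ_c ⊗ θ_c θ_d`, produces the wanted value together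
with one on `θ_c ⊗ θ_a θ_b θ_d`, which already vanishes. -/
theorem OriginInvariant.two_two_eq_zero (ht : OriginInvariant lam mu nu t) {a b c d : Fin n}
    (hac : a ≠ c) (had : a ≠ d) (hbc : b ≠ c) (hbd : b ≠ d) (hcd : c ≠ d) :
    t (theta a * theta b) (theta c * theta d) = 0 := by
  have h := ht.cubic c a b (theta c * 1) (theta c * theta d)
  rw [(isFree_one c).cubic_action_theta hac.symm hbc.symm (isFree_one a) (isFree_one b),
    (isFree_theta hcd).cubic_action_theta hac.symm hbc.symm (isFree_theta had) (isFree_theta hbd),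
    mul_one, mul_one, sigma_theta] at h
  have h0 := ht.cubic_right_eq_zero (isFree_theta hac) (isFree_theta hbc) (isFree_theta hcd.symm)
    (isFree_one a) (isFree_one b) (isFree_one d)
  rw [mul_one] at h0
  simpa [h0] using h

/-- Cubic fields and rotations identify all values of this shape with `± v`, where `v = t(θ_a, θ_b
θ_c)`. The field of `x θ_a` on `θ_b ⊗ θ_c`, `1 ⊗ θ_b θ_c` and `θ_b θ_c ⊗ 1` then gives `(λ + μ + 1)
v = 0`, `λ v = 0` and `μ v = 0`, which together force `v = 0`. -/
theorem OriginInvariant.one_two_eq_zero (ht : OriginInvariant lam mu nu t) {a b c : Fin n}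
    (hab : a ≠ b) (hac : a ≠ c) (hbc : b ≠ c) :
    t (theta a) (theta b * theta c) = 0 ∧ t (theta b * theta c) (theta a) = 0 := by
  have swap : ∀ {x y z : Fin n}, x ≠ y → x ≠ z →
      t (theta y * theta z) (theta x) = t (theta x) (theta y * theta z) := by
    intro x y z hxy hxz
    have h := ht.cubic x y z (theta x * 1) (theta x * 1)
    rw [(isFree_one x).cubic_action_theta hxy hxz (isFree_one y) (isFree_one z),
      (isFree_one x).cubic_action_theta hxy hxz (isFree_one y) (isFree_one z), mul_one, mul_one,
      sigma_theta] at h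
    simp only [map_smul, LinearMap.smul_apply, smul_eq_mul, map_neg, LinearMap.neg_apply] at h
    linarith
  have rot : ∀ {x y z : Fin n}, x ≠ y → x ≠ z → y ≠ z →
      t (theta y) (theta x * theta z) = -t (theta x) (theta y * theta z) := by
    intro x y z hxy hxz hyz
    simpa using ht.swap_R hxy (isFree_one x) (isFree_one y) (isFree_theta hxz) (isFree_theta hyz)
      0 0 0
  have alt : ∀ {x y z : Fin n}, t (theta x) (theta y * theta z) =
      -t (theta x) (theta z * theta y) := by
    intro x y z
    rw [theta_mul_theta, map_neg]
  have e1 : t (theta a * theta b) (theta c) = t (theta a) (theta b * theta c) := by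
    have r1 := swap hac.symm hbc.symm
    have r2 := alt (x := c) (y := a) (z := b)
    have r3 := rot hbc hab.symm hac.symm
    have r4 := alt (x := b) (y := c) (z := a)
    have r5 := rot hab hac hbc
    linarith
  have e2 : t (theta b) (theta a * theta c) = -t (theta a) (theta b * theta c) :=
    rot hab hac hbc
  have e3 : t (theta b * theta c) (theta a) = t (theta a) (theta b * theta c) := swap hab hac
  have h1 := ht.odd_monomial 0 a (coordX n ^ 0 * theta b) (coordX n ^ 0 * theta c)
  rw [(isFree_theta hab).odd_action, (isFree_theta hac).odd_action] at h1
  have h2 := ht.odd_monomial 0 a (coordX n ^ 0 * 1) (coordX n ^ 0 * (theta b * theta c))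
  rw [(isFree_one a).odd_action, ((isFree_theta hac).theta_mul hab).odd_action] at h2
  have h3 := ht.odd_monomial 0 a (coordX n ^ 0 * (theta b * theta c)) (coordX n ^ 0 * 1)
  rw [(isFree_one a).odd_action, ((isFree_theta hac).theta_mul hab).odd_action] at h3
  have z1 := ht.cubic_right_eq_zero (isFree_one a) (isFree_one b) (isFree_one c)
    (isFree_one a) (isFree_one b) (isFree_one c)
  have z2 := ht.cubic_left_eq_zero (isFree_one a) (isFree_one b) (isFree_one c)
    (isFree_one a) (isFree_one b) (isFree_one c)
  simp only [mul_one] at z1 z2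
  simp [sigma_mul, e1, e2, e3, z1, z2] at h1 h2 h3
  have : t (theta a) (theta b * theta c) = 0 := by
    rcases h2 with h2 | h2
    · rcases h3 with h3 | h3
      · rw [h2, h3] at h1; linarith
      · exact h3
    · exact h2
  exact ⟨this, e3.trans this⟩

theorem length_eq_sum_count (L : List (Fin n)) : L.length = ∑ a, L.count a := by
  have := Multiset.sum_count_eq_card (s := Finset.univ) (m := (L : Multiset (Fin n))) (by simp)
  simpa using this.symm

/-- An invariant functional is supported in total degrees `0` and `1`, where `θ_i` has degree
`1 / 2`. -/
theorem OriginInvariant.degree (ht : OriginInvariant lam mu nu t) (hn : 2 ≤ n)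
    {k l : ℕ} {L L' : List (Fin n)} (hL : L.Nodup) (hL' : L'.Nodup)
    (h : t (coordX n ^ k * thetaList L) (coordX n ^ l * thetaList L') ≠ 0) :
    2 * (k + l) + (L.length + L'.length) = 0 ∨ 2 * (k + l) + (L.length + L'.length) = 2 := by
  have hd : ∀ i j, i ≠ j → _ := fun i j hij => ht.pair_degree hij hL hL' h
  have hsum : L.length + L'.length = ∑ a, (L.count a + L'.count a) := by
    rw [Finset.sum_add_distrib, ← length_eq_sum_count, ← length_eq_sum_count]
  have : Nontrivial (Fin n) := Fin.nontrivial_iff_two_le.mpr hn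
  by_cases hkl : 1 ≤ k + l
  · have h0 : ∀ a, L.count a + L'.count a = 0 := by
      intro a
      obtain ⟨b, hb⟩ := exists_ne a
      have := hd a b hb.symm
      omega
    simp only [h0, Finset.sum_const_zero] at hsum
    obtain ⟨a, b, hab⟩ := exists_pair_ne (Fin n)
    have h1 := hd a b hab
    have h2 := h0 a
    have h3 := h0 b
    omega
  -- Without `x`, any two multiplicities add up to `0` or `2`: either one index occurs twice and no
  -- other occurs, or all multiplicities are `1`, or all are `0`.
  by_cases h2 : ∃ a, L.count a + L'.count a = 2
  · obtain ⟨a, ha⟩ := h2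
    rw [Finset.sum_eq_single a (fun b _ hb => by have := hd a b hb.symm; omega) (by simp), ha]
      at hsum
    omega
  by_cases h1 : ∃ a, L.count a + L'.count a = 1
  swap
  · have h0 : ∀ a, L.count a + L'.count a = 0 := by
      intro a
      obtain ⟨b, hb⟩ := exists_ne a
      have := hd a b hb.symm
      have := not_exists.mp h2 a
      have := not_exists.mp h1 a
      omega
    simp only [h0, Finset.sum_const_zero] at hsum
    omega
  have h1 : ∀ a, L.count a + L'.count a = 1 := by
    obtain ⟨b, hb⟩ := h1
    intro a
    by_cases hab : a = b
    · rw [hab, hb]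
    · have := hd a b hab
      omega
  simp only [h1, Finset.sum_const, Finset.card_univ, Fintype.card_fin, smul_eq_mul, mul_one] at hsum
  by_cases hn3 : n = 2
  · omega
  exfalso
  obtain ⟨rfl, rfl⟩ : k = 0 ∧ l = 0 := by omega
  have hdisj : ∀ a ∈ L, a ∉ L' := fun a ha ha' => by
    have := h1 a
    have := List.count_pos_iff.mpr ha
    have := List.count_pos_iff.mpr ha'
    omega
  apply h
  simp only [pow_zero, one_mul]
  have hf : ∀ a, a ∉ L → IsFree a L.length (thetaList L) := fun a ha => isFree_thetaList ha
  have hf' : ∀ a, a ∉ L' → IsFree a L'.length (thetaList L') := fun a ha => isFree_thetaList ha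
  have hdisj' : ∀ a ∈ L', a ∉ L := fun a ha ha' => hdisj a ha' ha
  by_cases hL3 : 3 ≤ L.length
  · rcases L with _ | ⟨a, _ | ⟨b, _ | ⟨c, L⟩⟩⟩ <;>
      simp only [List.length_nil, List.length_cons] at hL3
    · omega
    · omega
    · omega
    simp only [List.nodup_cons, List.mem_cons, not_or] at hL
    simp only [thetaList_cons]
    exact ht.cubic_left_eq_zero (isFree_thetaList hL.1.2.2) (isFree_thetaList hL.2.1.2)
      (isFree_thetaList hL.2.2.1) (hf' _ (hdisj _ (by simp))) (hf' _ (hdisj _ (by simp)))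
      (hf' _ (hdisj _ (by simp)))
  by_cases hL3' : 3 ≤ L'.length
  · rcases L' with _ | ⟨a, _ | ⟨b, _ | ⟨c, L'⟩⟩⟩ <;>
      simp only [List.length_nil, List.length_cons] at hL3'
    · omega
    · omega
    · omega
    simp only [List.nodup_cons, List.mem_cons, not_or] at hL'
    simp only [thetaList_cons]
    exact ht.cubic_right_eq_zero (hf _ (hdisj' _ (by simp))) (hf _ (hdisj' _ (by simp)))
      (hf _ (hdisj' _ (by simp))) (isFree_thetaList hL'.1.2.2) (isFree_thetaList hL'.2.1.2)
      (isFree_thetaList hL'.2.2.1)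
  -- Neither side has three odd factors now, so `n` is `3` or `4` and the shapes `(1, 2)`, `(2, 1)`,
  -- `(2, 2)` remain.
  clear hf hf' hdisj' hd h h1 h2
  rcases L with _ | ⟨a, _ | ⟨b, _ | ⟨c, L⟩⟩⟩ <;> rcases L' with _ | ⟨a', _ | ⟨b', _ | ⟨c', L'⟩⟩⟩ <;>
    simp only [List.length_nil, List.length_cons] at hsum hL3 hL3' <;> try omega
  all_goals
    simp only [List.nodup_cons, List.mem_cons, not_or, List.not_mem_nil, forall_eq_or_imp,
      not_false_eq_true, and_true, IsEmpty.forall_iff, implies_true, List.nodup_nil] at hL hL' hdisj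
    simp only [thetaList_cons, thetaList_nil, mul_one]
  · exact (ht.one_two_eq_zero hdisj.1 hdisj.2 hL').1
  · exact (ht.one_two_eq_zero (Ne.symm hdisj.1) (Ne.symm hdisj.2) hL).2
  · exact ht.two_two_eq_zero hdisj.1.1 hdisj.1.2 hdisj.2.1 hdisj.2.2 hL'

end

end SuperPoly

/-! ### Commutators with contact fields; invariance of `𝔞` and `𝔟` -/

namespace SuperPoly

noncomputable section

variable {n : ℕ}

/-- Contact fields preserve the span of the `η_j`: the term `η_i(H) ∂_x F` from differentiating the
coefficient `H` is cancelled by the `∂_x` arising when `η_i` passes `η_j` with `j = i`. -/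
theorem eta_densityAction_of_even {H : SuperPoly n} (hH : sigma n H = H) (w : ℝ) (i : Fin n)
    (F : SuperPoly n) : eta i (densityAction w H F) = densityAction w H (eta i F)
      - (1 / 2 : ℝ) • ∑ j, eta i (eta j H) * eta j F + w • (eta i (partialX n H) * F) := by
  have h : ∀ j, eta j H * eta i (eta j F) = -(eta j H * eta j (eta i F)) -
      if i = j then (2 : ℝ) • (eta i H * partialX n F) else 0 := fun j => by
    rw [eta_eta i j, mul_sub, mul_neg]
    split_ifs with hij
    · rw [hij, mul_smul_comm]
    · rw [mul_zero]
  simp only [densityAction_apply, contactField_of_even hH, map_add, map_sub, map_smul, map_sum,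
    eta_mul, hH, eta_partialX, eta_odd_of_even hH, neg_mul, h, partialX_even hH,
    Finset.sum_add_distrib, Finset.sum_neg_distrib, Finset.sum_sub_distrib, Finset.sum_ite_eq,
    Finset.mem_univ, if_true]
  module

theorem eta_densityAction_of_odd {H : SuperPoly n} (hH : sigma n H = -H) (w : ℝ) (i : Fin n)
    (F : SuperPoly n) : eta i (densityAction w H F) = -densityAction w H (eta i F)
      + (1 / 2 : ℝ) • ∑ j, eta i (eta j H) * eta j F + w • (eta i (partialX n H) * F) := by
  have h : ∀ j, eta j H * eta i (eta j F) = -(eta j H * eta j (eta i F)) -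
      if i = j then (2 : ℝ) • (eta i H * partialX n F) else 0 := fun j => by
    rw [eta_eta i j, mul_sub, mul_neg]
    split_ifs with hij
    · rw [hij, mul_smul_comm]
    · rw [mul_zero]
  simp only [densityAction_apply, contactField_of_odd hH, map_add, map_smul, map_sum,
    eta_mul, hH, eta_partialX, eta_even_of_odd hH, neg_mul, h, partialX_odd hH,
    Finset.sum_add_distrib, Finset.sum_neg_distrib, Finset.sum_sub_distrib, Finset.sum_ite_eq,
    Finset.mem_univ, if_true]
  module

theorem densityAction_add_weight (w v : ℝ) (H F : SuperPoly n) :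
    densityAction (w + v) H F = densityAction w H F + v • (partialX n H * F) := by
  rw [densityAction_apply, densityAction_apply, add_smul, add_assoc]

theorem partialX_densityAction_of_even {H : SuperPoly n} (hH : sigma n H = H) (w : ℝ)
    (F : SuperPoly n) : partialX n (densityAction w H F) = densityAction (w + 1) H (partialX n F)
      - (1 / 2 : ℝ) • ∑ j, eta j (partialX n H) * eta j F
      + w • (partialX n (partialX n H) * F) := by
  simp only [densityAction_apply, contactField_of_even hH, map_add, map_sub, map_smul, map_sum,
    partialX_mul, eta_partialX, Finset.sum_add_distrib]
  module

theorem partialX_densityAction_of_odd {H : SuperPoly n} (hH : sigma n H = -H) (w : ℝ)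
    (F : SuperPoly n) : partialX n (densityAction w H F) = densityAction (w + 1) H (partialX n F)
      + (1 / 2 : ℝ) • ∑ j, eta j (partialX n H) * eta j F
      + w • (partialX n (partialX n H) * F) := by
  simp only [densityAction_apply, contactField_of_odd hH, map_add, map_smul, map_sum,
    partialX_mul, eta_partialX, Finset.sum_add_distrib]
  module

/-- Contact invariance of an operator which preserves parity. -/
theorem isContactInvariant_of_even {lam mu nu : ℝ} {T : BinaryOp n}
    (hT : ∀ F G, sigma n (T F G) = T (sigma n F) (sigma n G))
    (h0 : ∀ H, sigma n H = H → ∀ F G, densityAction nu H (T F G) =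
        T (densityAction lam H F) G + T F (densityAction mu H G))
    (h1 : ∀ H, sigma n H = -H → ∀ F G, densityAction nu H (T F G) =
        T (densityAction lam H F) G + T (sigma n F) (densityAction mu H G)) :
    IsContactInvariant lam mu nu T := by
  refine isContactInvariant_iff.mpr ⟨h0, fun H hH F G => ?_⟩
  rw [h1 H hH, map_add, hT, hT, sigma_sigma, sigma_sigma, sigma_sigma]

theorem densityAction_mul_of_even' {H : SuperPoly n} (hH : sigma n H = H) {a b c : ℝ}
    (hc : c = a + b) (F G : SuperPoly n) : densityAction c H (F * G) =
      densityAction a H F * G + F * densityAction b H G := by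
  rw [hc, densityAction_mul_of_even hH]

theorem densityAction_mul_of_odd' {H : SuperPoly n} (hH : sigma n H = -H) {a b c : ℝ}
    (hc : c = a + b) (F G : SuperPoly n) : densityAction c H (F * G) =
      densityAction a H F * G + sigma n F * densityAction b H G := by
  rw [hc, densityAction_mul_of_odd hH]

theorem opA_apply (F G : SuperPoly n) : opA n F G = F * G := rfl

theorem opB_apply (lam mu : ℝ) (F G : SuperPoly n) : opB n lam mu F G =
    mu • (partialX n F * G) - lam • (F * partialX n G)
      - (1 / 2 : ℝ) • ∑ i, eta i (sigma n F) * eta i G := by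
  simp [opB, mulOp]

theorem skewOp_apply (i j : Fin n) (F G : SuperPoly n) : skewOp i j F G =
    eta i (sigma n F) * eta j G - eta j (sigma n F) * eta i G := by
  simp [skewOp, mulOp]

theorem opC_apply (i j : Fin n) (mu : ℝ) (F G : SuperPoly n) : opC i j mu F G =
    skewOp i j F G + (2 * mu) • (eta j (eta i F) * G) := by
  simp [opC, mulOp]

theorem opD_apply (i j : Fin n) (lam : ℝ) (F G : SuperPoly n) : opD i j lam F G =
    skewOp i j F G + (2 * lam) • (F * eta j (eta i G)) := by
  simp [opD, mulOp]

theorem opE_apply (i j : Fin n) (lam : ℝ) (F G : SuperPoly n) : opE i j lam F G =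
    (lam + 1 / 2) • skewOp i j F G + lam • (F * eta i (eta j G))
      + (lam + 1) • (eta i (eta j F) * G) := by
  simp [opE, mulOp]

theorem isContactInvariant_opA (lam mu : ℝ) : IsContactInvariant lam mu (lam + mu) (opA n) := by
  refine isContactInvariant_of_even ?_ ?_ ?_
  · intro F G
    simp only [opA_apply, sigma_mul]
  · intro H hH F G
    simp only [opA_apply, densityAction_mul_of_even hH]
  · intro H hH F G
    simp only [opA_apply, densityAction_mul_of_odd hH]

/-- The rotation terms in the action on `∑ η_i(F) η_i(G)` only contribute to the weight. -/
theorem sum_eta_eta_mul (H : SuperPoly n) (u v : Fin n → SuperPoly n) :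
    ∑ i, ∑ j, eta i (eta j H) * (u j * v i) + ∑ i, ∑ j, eta i (eta j H) * (u i * v j) =
      -((2 : ℝ) • (partialX n H * ∑ i, u i * v i)) := by
  rw [Finset.sum_comm, ← Finset.sum_add_distrib]
  simp only [← Finset.sum_add_distrib, ← add_mul]
  have h : ∀ i j, (eta j (eta i H) + eta i (eta j H)) * (u i * v j) =
      if i = j then -((2 : ℝ) • (partialX n H * (u i * v i))) else 0 := by
    intro i j
    by_cases hij : i = j
    · subst hij
      rw [if_pos rfl, eta_eta_self, ← neg_add, ← two_smul ℝ, neg_mul, smul_mul_assoc]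
    · rw [if_neg hij, eta_eta_of_ne hij, add_neg_cancel, zero_mul]
  simp [h, Finset.mul_sum, Finset.smul_sum]

theorem isContactInvariant_opB (lam mu : ℝ) :
    IsContactInvariant lam mu (lam + mu + 1) (opB n lam mu) := by
  have e1 : lam + mu + 1 = (lam + 1) + mu := by ring
  have e2 : lam + mu + 1 = lam + (mu + 1) := by ring
  have e3 : lam + mu + 1 = (lam + 1 / 2) + (mu + 1 / 2) := by ring
  refine isContactInvariant_of_even ?_ ?_ ?_
  · intro F G
    simp [opB_apply, sigma_mul, sigma_partialX, sigma_eta]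
  · intro H hH F G
    have l1 := densityAction_mul_of_even' hH e1 (partialX n F) G
    have l2 := densityAction_mul_of_even' hH e2 F (partialX n G)
    have l3 := fun i => densityAction_mul_of_even' hH e3 (eta i (sigma n F)) (eta i G)
    have rot := sum_eta_eta_mul H (fun i => eta i (sigma n F)) (fun i => eta i G)
    have c1 : ∀ i, eta i (sigma n F) * eta i (partialX n H) =
        -(eta i (partialX n H) * eta i F) := fun i => by
      rw [mul_comm_of_odd (eta_odd_of_even (partialX_even hH) i), sigma_eta, sigma_sigma, mul_neg]
    have c2 : ∀ i j (Z : SuperPoly n), Z * eta i (eta j H) = eta i (eta j H) * Z := fun i j Z =>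
      mul_comm_of_even (by rw [sigma_eta, eta_odd_of_even hH, map_neg, neg_neg]) Z
    have c3 : ∀ i, F * eta i (partialX n H) = eta i (partialX n H) * sigma n F := fun i =>
      mul_comm_of_odd (eta_odd_of_even (partialX_even hH) i) F
    have c4 : F * partialX n (partialX n H) = partialX n (partialX n H) * F :=
      mul_comm_of_even (partialX_even (partialX_even hH)) F
    have c5 : ∀ Z : SuperPoly n, Z * partialX n H = partialX n H * Z :=
      mul_comm_of_even (partialX_even hH)
    simp only [opB_apply, map_sub, map_smul, map_sum, l1, l2, l3, sigma_densityAction_of_even hH,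
      eta_densityAction_of_even hH, partialX_densityAction_of_even hH, densityAction_add_weight,
      mul_add, add_mul, mul_sub, sub_mul, smul_mul_assoc, mul_smul_comm, Finset.sum_add_distrib,
      Finset.sum_sub_distrib, ← Finset.smul_sum, Finset.sum_mul, ← mul_assoc,
      c1, c4, c5]
    simp only [Finset.mul_sum, ← mul_assoc, c2, c3, neg_mul, Finset.sum_neg_distrib]
      at rot ⊢
    -- The rotation terms carry the factor `½` of the bracket times the `½` of the commutator. By
    -- `rot` they reduce to the `H'` terms compensating the half-shifts of both weights.
    linear_combination (norm := module) (-1 / 4 : ℝ) • rot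
  · intro H hH F G
    have l1 := densityAction_mul_of_odd' hH e1 (partialX n F) G
    have l2 := densityAction_mul_of_odd' hH e2 F (partialX n G)
    have l3 := fun i => densityAction_mul_of_odd' hH e3 (eta i (sigma n F)) (eta i G)
    have rot := sum_eta_eta_mul H (fun i => eta i (sigma n F)) (fun i => eta i G)
    have c1 : ∀ i, eta i F * eta i (partialX n H) = eta i (partialX n H) * eta i F := fun i =>
      mul_comm_of_even (eta_even_of_odd (partialX_odd hH) i) _
    have c2 : ∀ i j, eta i F * eta i (eta j H) = -(eta i (eta j H) * eta i (sigma n F)) :=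
      fun i j => by
        rw [mul_comm_of_odd (by rw [sigma_eta, eta_even_of_odd hH]), sigma_eta, mul_neg]
    have c3 : ∀ i, sigma n F * eta i (partialX n H) = eta i (partialX n H) * sigma n F := fun i =>
      mul_comm_of_even (eta_even_of_odd (partialX_odd hH) i) _
    have c4 : sigma n F * partialX n (partialX n H) = partialX n (partialX n H) * F := by
      rw [mul_comm_of_odd (partialX_odd (partialX_odd hH)), sigma_sigma]
    have c5 : ∀ Z : SuperPoly n, Z * partialX n H = partialX n H * sigma n Z :=
      mul_comm_of_odd (partialX_odd hH)
    simp only [opB_apply, map_sub, map_smul, map_sum, l1, l2, l3, sigma_densityAction_of_odd hH,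
      sigma_sigma, sigma_eta, map_neg, sigma_partialX,
      eta_densityAction_of_odd hH, partialX_densityAction_of_odd hH, densityAction_add_weight,
      mul_add, add_mul, neg_mul, mul_neg, smul_mul_assoc, mul_smul_comm,
      Finset.sum_add_distrib, Finset.sum_neg_distrib, ← Finset.smul_sum, Finset.sum_mul, ← mul_assoc,
      c1, c4, c5]
    simp only [Finset.mul_sum, ← mul_assoc, c2, c3, neg_mul, Finset.sum_neg_distrib]
      at rot ⊢
    linear_combination (norm := module) (-1 / 4 : ℝ) • rot

end

end SuperPoly

/-! ### Invariance of `𝔠`, `𝔡`, `𝔢` for two odd coordinates -/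

namespace SuperPoly

noncomputable section

theorem mul_mul_of_even {n : ℕ} {Z : SuperPoly n} (hZ : sigma n Z = Z) (F W : SuperPoly n) :
    F * (Z * W) = Z * (F * W) := by
  rw [← mul_assoc, mul_comm_of_even hZ, mul_assoc]

theorem mul_mul_of_odd {n : ℕ} {Z : SuperPoly n} (hZ : sigma n Z = -Z) (F W : SuperPoly n) :
    F * (Z * W) = Z * (sigma n F * W) := by
  rw [← mul_assoc, mul_comm_of_odd hZ, mul_assoc]

section TwoOddCoordinates

variable {H : SuperPoly 2}

theorem eta_zero_one_comm (F : SuperPoly 2) : eta 1 (eta 0 F) = -eta 0 (eta 1 F) :=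
  eta_eta_of_ne (by decide) F

theorem eta_zero_densityAction_of_even (hH : sigma 2 H = H) (w : ℝ) (F : SuperPoly 2) :
    eta 0 (densityAction w H F) = densityAction w H (eta 0 F)
      + (1 / 2 : ℝ) • (partialX 2 H * eta 0 F) - (1 / 2 : ℝ) • (eta 0 (eta 1 H) * eta 1 F)
      + w • (eta 0 (partialX 2 H) * F) := by
  rw [eta_densityAction_of_even hH, Fin.sum_univ_two, eta_eta_self, neg_mul]
  module

theorem eta_one_densityAction_of_even (hH : sigma 2 H = H) (w : ℝ) (F : SuperPoly 2) :
    eta 1 (densityAction w H F) = densityAction w H (eta 1 F)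
      + (1 / 2 : ℝ) • (partialX 2 H * eta 1 F) + (1 / 2 : ℝ) • (eta 0 (eta 1 H) * eta 0 F)
      + w • (eta 1 (partialX 2 H) * F) := by
  rw [eta_densityAction_of_even hH, Fin.sum_univ_two, eta_eta_self, eta_zero_one_comm, neg_mul,
    neg_mul]
  module

theorem eta_zero_densityAction_of_odd (hH : sigma 2 H = -H) (w : ℝ) (F : SuperPoly 2) :
    eta 0 (densityAction w H F) = -densityAction w H (eta 0 F)
      - (1 / 2 : ℝ) • (partialX 2 H * eta 0 F) + (1 / 2 : ℝ) • (eta 0 (eta 1 H) * eta 1 F)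
      + w • (eta 0 (partialX 2 H) * F) := by
  rw [eta_densityAction_of_odd hH, Fin.sum_univ_two, eta_eta_self, neg_mul]
  module

theorem eta_one_densityAction_of_odd (hH : sigma 2 H = -H) (w : ℝ) (F : SuperPoly 2) :
    eta 1 (densityAction w H F) = -densityAction w H (eta 1 F)
      - (1 / 2 : ℝ) • (partialX 2 H * eta 1 F) - (1 / 2 : ℝ) • (eta 0 (eta 1 H) * eta 0 F)
      + w • (eta 1 (partialX 2 H) * F) := by
  rw [eta_densityAction_of_odd hH, Fin.sum_univ_two, eta_eta_self, eta_zero_one_comm, neg_mul,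
    neg_mul]
  module

theorem eta_one_eta_zero_eta_one (F : SuperPoly 2) :
    eta 1 (eta 0 (eta 1 F)) = eta 0 (partialX 2 F) := by
  rw [eta_zero_one_comm, eta_eta_self, map_neg, neg_neg]

/-- In the composite of the two commutators the rotation terms `η_0 η_1(H)` cancel. The corrections
left involve only derivatives of `H'`; for `w = 0` just the first-order one, with coefficient `½`,
remains. -/
theorem eta_eta_densityAction_of_even (hH : sigma 2 H = H) (w : ℝ) (F : SuperPoly 2) :
    eta 1 (eta 0 (densityAction w H F)) = densityAction (w + 1) H (eta 1 (eta 0 F))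
      + (w + 1 / 2) • (eta 1 (partialX 2 H) * eta 0 F - eta 0 (partialX 2 H) * eta 1 F)
      + w • (eta 1 (eta 0 (partialX 2 H)) * F) := by
  have h1 : sigma 2 (eta 0 (eta 1 H)) = eta 0 (eta 1 H) := by
    rw [sigma_eta, sigma_eta, hH, map_neg, neg_neg]
  simp only [eta_zero_densityAction_of_even hH, map_add, map_sub, map_smul,
    eta_one_densityAction_of_even hH, eta_mul, partialX_even hH, h1, eta_eta_self,
    eta_one_eta_zero_eta_one, densityAction_add_weight, eta_odd_of_even (partialX_even hH),
    neg_mul, mul_neg]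
  module

theorem eta_eta_densityAction_of_odd (hH : sigma 2 H = -H) (w : ℝ) (F : SuperPoly 2) :
    eta 1 (eta 0 (densityAction w H F)) = densityAction (w + 1) H (eta 1 (eta 0 F))
      - (w + 1 / 2) • (eta 1 (partialX 2 H) * eta 0 F - eta 0 (partialX 2 H) * eta 1 F)
      + w • (eta 1 (eta 0 (partialX 2 H)) * F) := by
  have h1 : sigma 2 (eta 0 (eta 1 H)) = -eta 0 (eta 1 H) := by
    rw [sigma_eta, sigma_eta, hH, map_neg, map_neg, map_neg, neg_neg]
  simp only [eta_zero_densityAction_of_odd hH, map_add, map_sub, map_smul, map_neg,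
    eta_one_densityAction_of_odd hH, eta_mul, partialX_odd hH, h1, eta_eta_self,
    eta_one_eta_zero_eta_one, densityAction_add_weight, eta_even_of_odd (partialX_odd hH),
    neg_mul, mul_neg]
  module

/-- The skew form in `η_0, η_1` is unchanged by rotations of the odd plane, so only terms with
`η_i(H')` obstruct invariance: `λ` times terms with derivatives of `G`, and `μ` times terms with
derivatives of `F`. These are what the second-order terms of `𝔠`, `𝔡`, `𝔢` cancel. -/
theorem skewOp_action_of_even (hH : sigma 2 H = H) (lam mu : ℝ) (F G : SuperPoly 2) :
    skewOp 0 1 (densityAction lam H F) G + skewOp 0 1 F (densityAction mu H G) =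
      densityAction (lam + mu + 1) H (skewOp 0 1 F G)
      + lam • (eta 0 (partialX 2 H) * (sigma 2 F * eta 1 G)
        - eta 1 (partialX 2 H) * (sigma 2 F * eta 0 G))
      + mu • (eta 0 (partialX 2 H) * (eta 1 F * G) - eta 1 (partialX 2 H) * (eta 0 F * G)) := by
  have e3 : lam + mu + 1 = (lam + 1 / 2) + (mu + 1 / 2) := by ring
  have l3 := fun i j => densityAction_mul_of_even' hH e3 (eta i (sigma 2 F)) (eta j G)
  have c1 : ∀ i (Z : SuperPoly 2), Z * (eta i (partialX 2 H) * G) =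
      eta i (partialX 2 H) * (sigma 2 Z * G) := fun i Z =>
      mul_mul_of_odd (eta_odd_of_even (partialX_even hH) i) _ _
  have c2 : ∀ Z W : SuperPoly 2, Z * (eta 0 (eta 1 H) * W) = eta 0 (eta 1 H) * (Z * W) :=
    mul_mul_of_even (by rw [sigma_eta, sigma_eta, hH, map_neg, neg_neg])
  have c3 : ∀ Z W : SuperPoly 2, Z * (partialX 2 H * W) = partialX 2 H * (Z * W) :=
    mul_mul_of_even (partialX_even hH)
  simp only [skewOp_apply, map_sub, l3, sigma_densityAction_of_even hH,
    eta_zero_densityAction_of_even hH, eta_one_densityAction_of_even hH, densityAction_add_weight,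
    mul_add, add_mul, mul_sub, sub_mul, smul_mul_assoc, mul_smul_comm, mul_assoc, c1, c2, c3,
    sigma_eta, sigma_sigma, neg_mul, mul_neg]
  module

theorem skewOp_action_of_odd (hH : sigma 2 H = -H) (lam mu : ℝ) (F G : SuperPoly 2) :
    skewOp 0 1 (densityAction lam H F) G + skewOp 0 1 (sigma 2 F) (densityAction mu H G) =
      densityAction (lam + mu + 1) H (skewOp 0 1 F G)
      - lam • (eta 0 (partialX 2 H) * (sigma 2 F * eta 1 G)
        - eta 1 (partialX 2 H) * (sigma 2 F * eta 0 G))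
      - mu • (eta 0 (partialX 2 H) * (eta 1 F * G) - eta 1 (partialX 2 H) * (eta 0 F * G)) := by
  have e3 : lam + mu + 1 = (lam + 1 / 2) + (mu + 1 / 2) := by ring
  have l3 := fun i j => densityAction_mul_of_odd' hH e3 (eta i (sigma 2 F)) (eta j G)
  have c1 : ∀ i (Z : SuperPoly 2), Z * (eta i (partialX 2 H) * G) =
      eta i (partialX 2 H) * (Z * G) := fun i Z =>
      mul_mul_of_even (eta_even_of_odd (partialX_odd hH) i) _ _
  have c2 : ∀ Z W : SuperPoly 2, Z * (eta 0 (eta 1 H) * W) = eta 0 (eta 1 H) * (sigma 2 Z * W) :=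
    mul_mul_of_odd (by rw [sigma_eta, sigma_eta, hH, map_neg, map_neg, map_neg, neg_neg])
  have c3 : ∀ Z W : SuperPoly 2, Z * (partialX 2 H * W) = partialX 2 H * (sigma 2 Z * W) :=
    mul_mul_of_odd (partialX_odd hH)
  simp only [skewOp_apply, map_sub, l3, sigma_densityAction_of_odd hH, map_neg,
    eta_zero_densityAction_of_odd hH, eta_one_densityAction_of_odd hH, densityAction_add_weight,
    mul_add, add_mul, mul_sub, sub_mul, smul_mul_assoc, mul_smul_comm, mul_assoc, c1, c2, c3,
    sigma_eta, sigma_sigma, neg_mul, mul_neg]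
  module

theorem sigma_skewOp (F G : SuperPoly 2) :
    sigma 2 (skewOp 0 1 F G) = skewOp 0 1 (sigma 2 F) (sigma 2 G) := by
  simp [skewOp_apply, sigma_mul, sigma_eta]

theorem isContactInvariant_opC {lam mu nu : ℝ} (hnu : nu = lam + mu + 1) (h : lam = 0) :
    IsContactInvariant lam mu nu (opC (0 : Fin 2) 1 mu) := by
  have e1 : lam + mu + 1 = (lam + 1) + mu := by ring
  rw [hnu]
  refine isContactInvariant_of_even ?_ ?_ ?_
  · intro F G
    simp [opC_apply, sigma_mul, sigma_eta, sigma_skewOp]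
  · intro H hH F G
    have s := skewOp_action_of_even hH lam mu F G
    simp only [opC_apply, map_add, map_smul, eta_eta_densityAction_of_even hH,
      densityAction_mul_of_even' hH e1, add_mul, sub_mul, smul_mul_assoc, mul_assoc]
    -- At `λ = 0` only the `μ` part of the obstruction survives, and `2μ` times the correction `½`
    -- of `η_1 η_0` matches it.
    linear_combination (norm := skip) (-1 : ℝ) • s
    subst h
    module
  · intro H hH F G
    have s := skewOp_action_of_odd hH lam mu F G
    simp only [opC_apply, map_add, map_smul, eta_eta_densityAction_of_odd hH,
      densityAction_mul_of_odd' hH e1, add_mul, sub_mul, smul_mul_assoc, mul_assoc, sigma_eta,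
      neg_neg, map_neg]
    linear_combination (norm := skip) (-1 : ℝ) • s
    subst h
    module

theorem isContactInvariant_opD {lam mu nu : ℝ} (hnu : nu = lam + mu + 1) (h : mu = 0) :
    IsContactInvariant lam mu nu (opD (0 : Fin 2) 1 lam) := by
  have e1 : lam + mu + 1 = lam + (mu + 1) := by ring
  rw [hnu]
  refine isContactInvariant_of_even ?_ ?_ ?_
  · intro F G
    simp [opD_apply, sigma_mul, sigma_eta, sigma_skewOp]
  · intro H hH F G
    have c1 : ∀ i (Z : SuperPoly 2), F * (eta i (partialX 2 H) * Z) =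
        eta i (partialX 2 H) * (sigma 2 F * Z) := fun i Z =>
      mul_mul_of_odd (eta_odd_of_even (partialX_even hH) i) _ _
    have s := skewOp_action_of_even hH lam mu F G
    simp only [opD_apply, map_add, map_smul, eta_eta_densityAction_of_even hH,
      densityAction_mul_of_even' hH e1, mul_add, mul_sub, mul_smul_comm, c1]
    linear_combination (norm := skip) (-1 : ℝ) • s
    subst h
    module
  · intro H hH F G
    have c1 : ∀ i (Z : SuperPoly 2), sigma 2 F * (eta i (partialX 2 H) * Z) =
        eta i (partialX 2 H) * (sigma 2 F * Z) := fun i Z =>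
      mul_mul_of_even (eta_even_of_odd (partialX_odd hH) i) _ _
    have s := skewOp_action_of_odd hH lam mu F G
    simp only [opD_apply, map_add, map_smul, eta_eta_densityAction_of_odd hH,
      densityAction_mul_of_odd' hH e1, mul_add, mul_sub, mul_smul_comm, c1]
    linear_combination (norm := skip) (-1 : ℝ) • s
    subst h
    module

theorem isContactInvariant_opE {lam mu nu : ℝ} (hnu : nu = lam + mu + 1) (h : nu = 0) :
    IsContactInvariant lam mu nu (opE (0 : Fin 2) 1 lam) := by
  have e1 : lam + mu + 1 = (lam + 1) + mu := by ring
  have e2 : lam + mu + 1 = lam + (mu + 1) := by ring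
  -- With `μ = -(λ + 1)` the first-order obstructions cancel in `F` and in `G` separately, and the
  -- two terms with `η_1 η_0(H') F G` have total coefficient `-λ(λ + μ + 1) = 0`.
  have hmu : mu = -1 - lam := by linarith
  have r : ∀ F : SuperPoly 2, eta 0 (eta 1 F) = -eta 1 (eta 0 F) := fun F => by
    rw [eta_zero_one_comm, neg_neg]
  rw [hnu]
  refine isContactInvariant_of_even ?_ ?_ ?_
  · intro F G
    simp [opE_apply, sigma_mul, sigma_eta, sigma_skewOp]
  · intro H hH F G
    have c1 : ∀ i (Z : SuperPoly 2), F * (eta i (partialX 2 H) * Z) =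
        eta i (partialX 2 H) * (sigma 2 F * Z) := fun i Z =>
      mul_mul_of_odd (eta_odd_of_even (partialX_even hH) i) _ _
    have c2 : F * (eta 1 (eta 0 (partialX 2 H)) * G) =
        eta 1 (eta 0 (partialX 2 H)) * (F * G) :=
      mul_mul_of_even (by rw [sigma_eta, sigma_eta, partialX_even hH, map_neg, neg_neg]) F G
    have s := skewOp_action_of_even hH lam mu F G
    simp only [opE_apply, r, map_add, map_neg, map_smul, eta_eta_densityAction_of_even hH,
      densityAction_mul_of_even' hH e1 (eta 1 (eta 0 F)) G,
      densityAction_mul_of_even' hH e2 F (eta 1 (eta 0 G)), mul_add, mul_sub, mul_smul_comm, c1,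
      add_mul, sub_mul, smul_mul_assoc, mul_assoc, mul_neg, neg_mul, c2]
    linear_combination (norm := skip) (-(lam + 1 / 2) : ℝ) • s
    subst hmu
    module
  · intro H hH F G
    have c1 : ∀ i (Z : SuperPoly 2), sigma 2 F * (eta i (partialX 2 H) * Z) =
        eta i (partialX 2 H) * (sigma 2 F * Z) := fun i Z =>
      mul_mul_of_even (eta_even_of_odd (partialX_odd hH) i) _ _
    have c2 : sigma 2 F * (eta 1 (eta 0 (partialX 2 H)) * G) =
        eta 1 (eta 0 (partialX 2 H)) * (F * G) := by
      rw [mul_mul_of_odd (by rw [sigma_eta, eta_even_of_odd (partialX_odd hH)]), sigma_sigma]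
    have s := skewOp_action_of_odd hH lam mu F G
    simp only [opE_apply, r, map_add, map_neg, map_smul, eta_eta_densityAction_of_odd hH,
      densityAction_mul_of_odd' hH e1 (eta 1 (eta 0 F)) G,
      densityAction_mul_of_odd' hH e2 F (eta 1 (eta 0 G)), mul_add, mul_sub, mul_smul_comm, c1,
      add_mul, sub_mul, smul_mul_assoc, mul_assoc, mul_neg, neg_mul, c2, sigma_eta, neg_neg]
    linear_combination (norm := skip) (-(lam + 1 / 2) : ℝ) • s
    subst hmu
    module

end TwoOddCoordinates

end

end SuperPoly

/-! ### The listed operators are differential operators -/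

namespace SuperPoly

noncomputable section

variable {n : ℕ}

/-- The value at `(F, G)` of the differential operator with coefficients `a` and order at most `M`
in `∂_x`. -/
def differentialSum (M : ℕ) (a : ℕ → Finset (Fin n) → ℕ → Finset (Fin n) → SuperPoly n)
    (F G : SuperPoly n) : SuperPoly n :=
  ∑ k ∈ Finset.range (M + 1), ∑ ε : Finset (Fin n),
    ∑ l ∈ Finset.range (M + 1), ∑ δ : Finset (Fin n),
      a k ε l δ * partialMonomial k ε (((sigma n) ^ δ.card) F) * partialMonomial l δ G

/-- Functions of two superpolynomials given by a differential operator. -/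
def IsDifferentialFun (f : SuperPoly n → SuperPoly n → SuperPoly n) : Prop :=
  ∃ M a, ∀ F G, f F G = differentialSum M a F G

/-- Padding the coefficients by zero brings two operators to a common order, so that they can be
added. -/
theorem differentialSum_extend {M M' : ℕ} (h : M ≤ M')
    (a : ℕ → Finset (Fin n) → ℕ → Finset (Fin n) → SuperPoly n) (F G : SuperPoly n) :
    differentialSum M' (fun k ε l δ => if k ≤ M ∧ l ≤ M then a k ε l δ else 0) F G =
      differentialSum M a F G := by
  have hs : Finset.range (M + 1) ⊆ Finset.range (M' + 1) :=
    Finset.range_subset_range.mpr (by omega)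
  unfold differentialSum
  refine (Finset.sum_subset hs fun k _ hk => ?_).symm.trans ?_
  · have : ¬ k ≤ M := fun hk' => hk (Finset.mem_range.mpr (by omega))
    simp [this]
  refine Finset.sum_congr rfl fun k hk => Finset.sum_congr rfl fun ε _ => ?_
  refine (Finset.sum_subset hs fun l _ hl => ?_).symm.trans ?_
  · have : ¬ l ≤ M := fun hl' => hl (Finset.mem_range.mpr (by omega))
    simp [this]
  refine Finset.sum_congr rfl fun l hl => Finset.sum_congr rfl fun δ _ => ?_
  rw [Finset.mem_range] at hk hl
  dsimp only
  rw [if_pos (by omega)]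

theorem IsDifferentialFun.congr {f g : SuperPoly n → SuperPoly n → SuperPoly n}
    (hf : IsDifferentialFun f) (h : ∀ F G, g F G = f F G) : IsDifferentialFun g := by
  obtain ⟨M, a, ha⟩ := hf
  exact ⟨M, a, fun F G => (h F G).trans (ha F G)⟩

theorem IsDifferentialFun.add {f g : SuperPoly n → SuperPoly n → SuperPoly n}
    (hf : IsDifferentialFun f) (hg : IsDifferentialFun g) :
    IsDifferentialFun fun F G => f F G + g F G := by
  obtain ⟨M, a, ha⟩ := hf
  obtain ⟨N, b, hb⟩ := hg
  refine ⟨max M N, fun k ε l δ => (if k ≤ M ∧ l ≤ M then a k ε l δ else 0) +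
    (if k ≤ N ∧ l ≤ N then b k ε l δ else 0), fun F G => ?_⟩
  change f F G + g F G = _
  rw [ha, hb, ← differentialSum_extend (le_max_left M N),
    ← differentialSum_extend (le_max_right M N)]
  simp only [differentialSum, add_mul, Finset.sum_add_distrib]

theorem IsDifferentialFun.smul {f : SuperPoly n → SuperPoly n → SuperPoly n}
    (hf : IsDifferentialFun f) (r : ℝ) : IsDifferentialFun fun F G => r • f F G := by
  obtain ⟨M, a, ha⟩ := hf
  refine ⟨M, fun k ε l δ => r • a k ε l δ, fun F G => ?_⟩
  simp only [ha, differentialSum, Finset.smul_sum, smul_mul_assoc]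

theorem IsDifferentialFun.neg {f : SuperPoly n → SuperPoly n → SuperPoly n}
    (hf : IsDifferentialFun f) : IsDifferentialFun fun F G => -f F G := by
  simpa using hf.smul (-1)

theorem IsDifferentialFun.sub {f g : SuperPoly n → SuperPoly n → SuperPoly n}
    (hf : IsDifferentialFun f) (hg : IsDifferentialFun g) :
    IsDifferentialFun fun F G => f F G - g F G := by
  simpa [sub_eq_add_neg] using hf.add hg.neg

theorem IsDifferentialFun.sum {ι : Type*} (s : Finset ι)
    {f : ι → SuperPoly n → SuperPoly n → SuperPoly n} (hf : ∀ i, IsDifferentialFun (f i)) :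
    IsDifferentialFun fun F G => ∑ i ∈ s, f i F G := by
  classical
  induction s using Finset.induction_on with
  | empty => exact ⟨0, 0, fun F G => by simp [differentialSum]⟩
  | insert i s hi ih => simpa [Finset.sum_insert hi] using (hf i).add ih

theorem isDifferentialFun_term (c : SuperPoly n) (k : ℕ) (ε : Finset (Fin n)) (l : ℕ)
    (δ : Finset (Fin n)) : IsDifferentialFun fun F G =>
      c * partialMonomial k ε (((sigma n) ^ δ.card) F) * partialMonomial l δ G := by
  classical
  refine ⟨max k l, fun k' ε' l' δ' =>
    if k' = k then if ε' = ε then if l' = l then if δ' = δ then c else 0 else 0 else 0 else 0,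
    fun F G => ?_⟩
  unfold differentialSum
  rw [Finset.sum_eq_single k, Finset.sum_eq_single ε, Finset.sum_eq_single l,
    Finset.sum_eq_single δ]
  · simp
  · intro b _ hb; simp [hb]
  · simp
  · intro b _ hb; simp [hb]
  · intro h; exact absurd (Finset.mem_range.mpr (by omega)) h
  · intro b _ hb; simp [hb]
  · simp
  · intro b _ hb; simp [hb]
  · intro h; exact absurd (Finset.mem_range.mpr (by omega)) h

theorem partialMonomial_empty (k : ℕ) (F : SuperPoly n) :
    partialMonomial k ∅ F = (partialX n ^ k : Module.End ℝ (SuperPoly n)) F := by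
  simp [partialMonomial]

theorem partialMonomial_singleton (k : ℕ) (i : Fin n) (F : SuperPoly n) :
    partialMonomial k {i} F = (partialX n ^ k : Module.End ℝ (SuperPoly n)) (partialTheta i F) := by
  simp [partialMonomial]

theorem isDifferentialFun_mul : IsDifferentialFun fun F G : SuperPoly n => F * G := by
  have h := isDifferentialFun_term (1 : SuperPoly n) 0 ∅ 0 ∅
  simpa [partialMonomial_empty] using h

theorem isDifferentialFun_partialX_mul :
    IsDifferentialFun fun F G : SuperPoly n => partialX n F * G := by
  have h := isDifferentialFun_term (1 : SuperPoly n) 1 ∅ 0 ∅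
  simpa [partialMonomial_empty] using h

theorem isDifferentialFun_mul_partialX :
    IsDifferentialFun fun F G : SuperPoly n => F * partialX n G := by
  have h := isDifferentialFun_term (1 : SuperPoly n) 0 ∅ 1 ∅
  simpa [partialMonomial_empty] using h

theorem isDifferentialFun_eta_mul_eta (i j : Fin n) :
    IsDifferentialFun fun F G : SuperPoly n => eta i (sigma n F) * eta j G := by
  -- The four terms expand `(∂_i - θ_i ∂_x)(σF) · (∂_j - θ_j ∂_x)(G)`. Moving `θ_j` to the front
  -- removes the `σ` on `F`, as the empty index set in the second slot requires, and turns the third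
  -- sign into a plus.
  have h1 := isDifferentialFun_term (1 : SuperPoly n) 0 {i} 0 {j}
  have h2 := isDifferentialFun_term (theta i : SuperPoly n) 1 ∅ 0 {j}
  have h3 := isDifferentialFun_term (theta j : SuperPoly n) 0 {i} 1 ∅
  have h4 := isDifferentialFun_term (theta i * theta j : SuperPoly n) 1 ∅ 1 ∅
  refine (((h1.sub h2).add h3).add h4).congr fun F G => ?_
  have c : ∀ F : SuperPoly n, F * theta j = theta j * sigma n F := fun F => by
    rw [theta_mul_comm, sigma_sigma]
  simp only [partialMonomial_empty, partialMonomial_singleton, eta_apply, mul_sub, sub_mul,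
    Finset.card_singleton, Finset.card_empty, pow_zero, pow_one, one_mul, Module.End.one_apply]
  simp only [← mul_assoc, c, sigma_mul, sigma_theta, sigma_partialX, sigma_partialTheta,
    sigma_sigma]
  noncomm_ring

theorem partialMonomial_pair (k : ℕ) (F : SuperPoly 2) :
    partialMonomial k {0, 1} F =
      (partialX 2 ^ k : Module.End ℝ (SuperPoly 2)) (partialTheta 0 (partialTheta 1 F)) := by
  have : ({0, 1} : Finset (Fin 2)).sort (· ≤ ·) = [0, 1] := by
    rw [Finset.sort_insert] <;> simp
  simp [partialMonomial, this]

theorem eta_one_eta_zero (F : SuperPoly 2) : eta 1 (eta 0 F) =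
    -partialTheta 0 (partialTheta 1 F) + theta 0 * partialX 2 (partialTheta 1 F)
      - theta 1 * partialX 2 (partialTheta 0 F)
      + theta 1 * theta 0 * partialX 2 (partialX 2 F) := by
  simp only [eta_apply, map_sub, partialTheta_theta_mul, partialX_theta_mul, partialTheta_partialX,
    partialTheta_partialTheta 1 0, mul_assoc]
  simp
  abel

theorem isDifferentialFun_eta_eta_mul :
    IsDifferentialFun fun F G : SuperPoly 2 => eta 1 (eta 0 F) * G := by
  have h1 := isDifferentialFun_term (-1 : SuperPoly 2) 0 {0, 1} 0 ∅
  have h2 := isDifferentialFun_term (theta 0 : SuperPoly 2) 1 {1} 0 ∅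
  have h3 := isDifferentialFun_term (theta 1 : SuperPoly 2) 1 {0} 0 ∅
  have h4 := isDifferentialFun_term (theta 1 * theta 0 : SuperPoly 2) 2 ∅ 0 ∅
  refine (((h1.add h2).sub h3).add h4).congr fun F G => ?_
  simp only [partialMonomial_empty, partialMonomial_singleton, partialMonomial_pair,
    eta_one_eta_zero, Finset.card_empty, pow_zero, pow_one, Module.End.one_apply, pow_two,
    Module.End.mul_apply]
  noncomm_ring

theorem isDifferentialFun_mul_eta_eta :
    IsDifferentialFun fun F G : SuperPoly 2 => F * eta 1 (eta 0 G) := by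
  have h1 := isDifferentialFun_term (-1 : SuperPoly 2) 0 ∅ 0 {0, 1}
  have h2 := isDifferentialFun_term (theta 0 : SuperPoly 2) 0 ∅ 1 {1}
  have h3 := isDifferentialFun_term (theta 1 : SuperPoly 2) 0 ∅ 1 {0}
  have h4 := isDifferentialFun_term (theta 1 * theta 0 : SuperPoly 2) 0 ∅ 2 ∅
  refine (((h1.add h2).sub h3).add h4).congr fun F G => ?_
  have c : ∀ (i : Fin 2) (F : SuperPoly 2), F * theta i = theta i * sigma 2 F := fun i F => by
    rw [theta_mul_comm, sigma_sigma]
  have card : ({0, 1} : Finset (Fin 2)).card = 2 := by decide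
  simp only [partialMonomial_empty, partialMonomial_singleton, partialMonomial_pair,
    eta_one_eta_zero, Finset.card_empty, Finset.card_singleton, card, pow_zero, pow_one,
    Module.End.one_apply, pow_two, Module.End.mul_apply, sigma_sigma, mul_add, mul_sub, mul_neg,
    ← mul_assoc F, c]
  simp only [sigma_theta, mul_neg, neg_mul]
  rw [mul_assoc (theta 0) _ (theta 1), c, sigma_sigma]
  noncomm_ring

theorem isDifferential_opA : IsDifferential (opA n) := isDifferentialFun_mul

theorem isDifferential_opB (lam mu : ℝ) : IsDifferential (opB n lam mu) := by
  have h : IsDifferentialFun fun F G => opB n lam mu F G := by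
    simp only [opB_apply]
    exact ((isDifferentialFun_partialX_mul.smul mu).sub
      (isDifferentialFun_mul_partialX.smul lam)).sub
      ((IsDifferentialFun.sum _ fun i => isDifferentialFun_eta_mul_eta i i).smul _)
  exact h

theorem isDifferentialFun_skewOp (i j : Fin n) :
    IsDifferentialFun fun F G => skewOp i j F G := by
  simp only [skewOp_apply]
  exact (isDifferentialFun_eta_mul_eta i j).sub (isDifferentialFun_eta_mul_eta j i)

theorem isDifferential_opC (mu : ℝ) : IsDifferential (opC (0 : Fin 2) 1 mu) := by
  have h : IsDifferentialFun fun F G => opC (0 : Fin 2) 1 mu F G := by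
    simp only [opC_apply]
    exact (isDifferentialFun_skewOp 0 1).add (isDifferentialFun_eta_eta_mul.smul _)
  exact h

theorem isDifferential_opD (lam : ℝ) : IsDifferential (opD (0 : Fin 2) 1 lam) := by
  have h : IsDifferentialFun fun F G => opD (0 : Fin 2) 1 lam F G := by
    simp only [opD_apply]
    exact (isDifferentialFun_skewOp 0 1).add (isDifferentialFun_mul_eta_eta.smul _)
  exact h

theorem isDifferential_opE (lam : ℝ) : IsDifferential (opE (0 : Fin 2) 1 lam) := by
  have r : ∀ F : SuperPoly 2, eta 0 (eta 1 F) = -eta 1 (eta 0 F) := fun F => by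
    rw [eta_zero_one_comm, neg_neg]
  have h : IsDifferentialFun fun F G => opE (0 : Fin 2) 1 lam F G := by
    simp only [opE_apply, r, mul_neg, neg_mul]
    exact (((isDifferentialFun_skewOp 0 1).smul _).add
      (isDifferentialFun_mul_eta_eta.neg.smul _)).add
      (isDifferentialFun_eta_eta_mul.neg.smul _)
  exact h

theorem IsDifferential.add {T U : BinaryOp n} (hT : IsDifferential T) (hU : IsDifferential U) :
    IsDifferential (T + U) :=
  IsDifferentialFun.add (f := fun F G => T F G) (g := fun F G => U F G) hT hU

theorem IsDifferential.smul {T : BinaryOp n} (hT : IsDifferential T) (r : ℝ) :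
    IsDifferential (r • T) :=
  IsDifferentialFun.smul (f := fun F G => T F G) hT r

theorem IsInvariantDifferential.add {lam mu nu : ℝ} {T U : BinaryOp n}
    (hT : IsInvariantDifferential lam mu nu T) (hU : IsInvariantDifferential lam mu nu U) :
    IsInvariantDifferential lam mu nu (T + U) :=
  ⟨hT.1.add hU.1, hT.2.add hU.2⟩

theorem IsInvariantDifferential.smul {lam mu nu : ℝ} {T : BinaryOp n}
    (hT : IsInvariantDifferential lam mu nu T) (r : ℝ) :
    IsInvariantDifferential lam mu nu (r • T) :=
  ⟨hT.1.smul r, hT.2.smul r⟩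

end

end SuperPoly

/-! ### Classification from the values at the origin -/

namespace SuperPoly

noncomputable section

variable {n : ℕ} {lam mu nu : ℝ}

/-- An invariant operator whose values on all pairs of monomials vanish at the origin is zero. -/
theorem eq_zero_of_monomials {T : BinaryOp n} (hn : 2 ≤ n) (hT : IsContactInvariant lam mu nu T)
    (h : ∀ (k l : ℕ) (L L' : List (Fin n)), L.Nodup → L'.Nodup →
      nu = lam + mu + (k + l + ((L.length + L'.length : ℕ) : ℝ) / 2) →
      (2 * (k + l) + (L.length + L'.length) = 0 ∨ 2 * (k + l) + (L.length + L'.length) = 2) →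
      atOrigin T (coordX n ^ k * thetaList L) (coordX n ^ l * thetaList L') = 0) : T = 0 := by
  refine eq_zero_of_eval0_eq_zero hT (functional_eq_zero (atOrigin T) fun k l L L' hL hL' => ?_)
  by_contra hne
  have h1 := hT.originInvariant.weight hne
  have h2 := hT.originInvariant.degree hn hL hL' hne
  exact hne (h k l L L' hL hL' (by rw [h1]; ring) h2)

theorem weight_of_ne_zero {T : BinaryOp n} (hn : 2 ≤ n) (hT : IsContactInvariant lam mu nu T)
    (h0 : T ≠ 0) : nu = lam + mu ∨ nu = lam + mu + 1 := by
  by_contra hcon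
  rw [not_or] at hcon
  refine h0 (eq_zero_of_monomials hn hT fun k l L L' _ _ hnu hN => ?_)
  have e : nu = lam + mu + ((2 * (k + l) + (L.length + L'.length) : ℕ) : ℝ) / 2 := by
    rw [hnu]; push_cast; ring
  rcases hN with hN | hN
  · rw [hN] at e; exact absurd (by rw [e]; norm_num) hcon.1
  · rw [hN] at e; exact absurd (by rw [e]; norm_num) hcon.2

theorem eq_zero_of_weight_zero {T : BinaryOp n} (hn : 2 ≤ n)
    (hT : IsContactInvariant lam mu (lam + mu) T) (h0 : atOrigin T 1 1 = 0) : T = 0 := by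
  refine eq_zero_of_monomials hn hT fun k l L L' _ _ hnu hN => ?_
  have e : ((2 * (k + l) + (L.length + L'.length) : ℕ) : ℝ) = 0 := by
    push_cast at hnu ⊢; linarith
  have e' : 2 * (k + l) + (L.length + L'.length) = 0 := by exact_mod_cast e
  obtain ⟨rfl, rfl, hL, hL'⟩ : k = 0 ∧ l = 0 ∧ L.length = 0 ∧ L'.length = 0 := by omega
  rw [List.length_eq_zero_iff] at hL hL'
  subst hL hL'
  simpa using h0

/-- The monomials of degree one also include `x ⊗ 1` and `1 ⊗ x`, but the field of `x θ_i` expresses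
their values as `2μ` and `-2λ` times `t(θ_i, θ_i)`. -/
theorem eq_zero_of_weight_one {T : BinaryOp n} (hn : 2 ≤ n)
    (hT : IsContactInvariant lam mu (lam + mu + 1) T)
    (h1 : ∀ a b, atOrigin T (theta a) (theta b) = 0)
    (h2 : ∀ a b, a ≠ b → atOrigin T (theta a * theta b) 1 = 0)
    (h3 : ∀ a b, a ≠ b → atOrigin T 1 (theta a * theta b) = 0) : T = 0 := by
  have : Nontrivial (Fin n) := Fin.nontrivial_iff_two_le.mpr hn
  obtain ⟨i, j, hij⟩ := exists_pair_ne (Fin n)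
  have rel := hT.originInvariant.pairRelations hij (isFree_one i) (isFree_one j) (isFree_one i)
    (isFree_one j) (e := 1) (by simp) (by norm_num)
  have x1 : atOrigin T (coordX n) 1 = 0 := by
    have := rel.odd_AS 0 0 0
    have hS := h1 i i
    simp only [atOrigin_apply] at hS
    simpa [hS] using this
  have x2 : atOrigin T 1 (coordX n) = 0 := by
    have := rel.odd_SA 0 0 0
    have hS := h1 i i
    simp only [atOrigin_apply] at hS
    simpa [hS] using this
  refine eq_zero_of_monomials hn hT fun k l L L' hL hL' hnu _ => ?_
  have e : ((2 * (k + l) + (L.length + L'.length) : ℕ) : ℝ) = (2 : ℕ) := by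
    push_cast at hnu ⊢; linarith
  have e' : 2 * (k + l) + (L.length + L'.length) = 2 := by exact_mod_cast e
  rcases L with _ | ⟨a, _ | ⟨b, _ | ⟨c, L⟩⟩⟩ <;> rcases L' with _ | ⟨a', _ | ⟨b', _ | ⟨c', L'⟩⟩⟩ <;>
    simp only [List.length_nil, List.length_cons] at e' <;> try omega
  · rcases k with _ | k
    · obtain rfl : l = 1 := by omega
      simpa using x2
    · obtain ⟨rfl, rfl⟩ : k = 0 ∧ l = 0 := by omega
      simpa using x1
  all_goals
    obtain ⟨rfl, rfl⟩ : k = 0 ∧ l = 0 := by omega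
    simp only [List.nodup_cons, List.mem_cons, not_or, List.not_mem_nil, not_false_eq_true,
      and_true, List.nodup_nil] at hL hL'
    simp only [thetaList_cons, thetaList_nil, mul_one, pow_zero, one_mul]
  · exact h3 _ _ hL'
  · exact h1 _ _
  · exact h2 _ _ hL

theorem atOrigin_opB_theta (a : Fin n) :
    atOrigin (opB n lam mu) (theta a) (theta a) = 1 / 2 := by
  simp [opB_apply, eta_theta]

/-- For at least three odd coordinates, one value determines an invariant operator. -/
theorem eq_zero_of_three_le {T : BinaryOp n} (hn : 3 ≤ n)
    (hT : IsContactInvariant lam mu (lam + mu + 1) T) (a : Fin n)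
    (h : atOrigin T (theta a) (theta a) = 0) : T = 0 := by
  have ht := hT.originInvariant
  -- A third index `d` supplies the rotation of `θ_b θ_d`, which creates `θ_b` from `θ_d` in one
  -- argument and kills the other argument, as that involves neither coordinate.
  have third : ∀ a b : Fin n, ∃ c, a ≠ c ∧ b ≠ c := by
    intro a b
    obtain ⟨c, hc⟩ : ∃ c, c ∉ ({a, b} : Finset (Fin n)) := by
      by_contra hcon
      push Not at hcon
      have h1 : (Finset.univ : Finset (Fin n)) ⊆ {a, b} := fun c _ => hcon c
      have h2 := Finset.card_le_card h1
      have h3 := Finset.card_le_two (a := a) (b := b)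
      simp at h2
      omega
    simp only [Finset.mem_insert, Finset.mem_singleton, not_or] at hc
    exact ⟨c, Ne.symm hc.1, Ne.symm hc.2⟩
  have rot : ∀ (w d : ℝ) (i j : Fin n) (Y : SuperPoly n), IsFree i d Y → IsFree j d Y →
      densityAction w (coordX n ^ 0 * (theta i * theta j)) Y = 0 := by
    intro w d i j Y hi hj
    simpa using hi.rotation_action hj w 0
  refine eq_zero_of_weight_one (by omega) hT (fun b c => ?_) (fun b c hbc => ?_)
    (fun b c hbc => ?_)
  · by_cases hbc : b = c
    · subst hbc
      by_cases hab : a = b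
      · rw [← hab, h]
      · have := ht.swap_S hab (isFree_one a) (isFree_one b) (isFree_one a) (isFree_one b) 0 0 0
        simpa [h] using this
    · obtain ⟨d, hbd, hcd⟩ := third b c
      simpa using ht.theta_left_eq_zero hbd (isFree_one b) (isFree_one d) 0
        (rot mu 1 b d (theta c) (isFree_theta hbc) (isFree_theta (Ne.symm hcd)))
  · obtain ⟨d, hbd, hcd⟩ := third b c
    simpa using ht.theta_left_eq_zero hbd (isFree_theta hbc) (isFree_theta (Ne.symm hcd)) 0
      (rot mu 0 b d 1 (isFree_one b) (isFree_one d))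
  · obtain ⟨d, hbd, hcd⟩ := third b c
    simpa using ht.theta_right_eq_zero hbd (isFree_theta hbc) (isFree_theta (Ne.symm hcd)) 0
      (rot lam 0 b d 1 (isFree_one b) (isFree_one d))

section TwoOddCoordinates

/-- The values of an invariant operator at the origin for `n = 2`. -/
theorem two_relations {T : BinaryOp 2} (hT : IsContactInvariant lam mu nu T) :
    (1 + 2 * lam) * atOrigin T (theta 0 * theta 1) 1
        + 2 * mu * atOrigin T (theta 0) (theta 1) = 0 ∧
      2 * lam * atOrigin T (theta 0) (theta 1)
        + (1 + 2 * mu) * atOrigin T 1 (theta 0 * theta 1) = 0 ∧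
      lam * atOrigin T (theta 0 * theta 1) 1 + mu * atOrigin T 1 (theta 0 * theta 1) = 0 := by
  have rel := hT.originInvariant.pairRelations (i := 0) (j := 1) (by decide) (isFree_one 0)
    (isFree_one 1) (isFree_one 0) (isFree_one 1) (e := 1) (by simp) (by norm_num)
  have h1 := rel.odd_PR 0 0 0
  have h2 := rel.odd_RQ 0 0 0
  have h3 := rel.even_PQ 0 0 0
  simp only [pow_zero, one_mul, mul_one, add_zero, zero_add, zero_div, Nat.cast_zero] at h1 h2 h3
  exact ⟨h1, h2, h3⟩

theorem eq_zero_of_two {T : BinaryOp 2} (hT : IsContactInvariant lam mu (lam + mu + 1) T)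
    (hS : atOrigin T (theta 0) (theta 0) = 0) (hR : atOrigin T (theta 0) (theta 1) = 0)
    (hP : atOrigin T (theta 0 * theta 1) 1 = 0) (hQ : atOrigin T 1 (theta 0 * theta 1) = 0) :
    T = 0 := by
  have h01 : (0 : Fin 2) ≠ 1 := by decide
  have hS' := hT.originInvariant.swap_S h01 (isFree_one 0) (isFree_one 1) (isFree_one 0)
    (isFree_one 1) 0 0 0
  have hR' := hT.originInvariant.swap_R h01 (isFree_one 0) (isFree_one 1) (isFree_one 0)
    (isFree_one 1) 0 0 0
  simp only [pow_zero, one_mul, mul_one, add_zero, hS, hR, neg_zero] at hS' hR'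
  refine eq_zero_of_weight_one le_rfl hT ?_ ?_ ?_
  · rw [Fin.forall_fin_two, Fin.forall_fin_two, Fin.forall_fin_two]
    exact ⟨⟨hS, hR⟩, hR', hS'⟩
  · rw [Fin.forall_fin_two, Fin.forall_fin_two, Fin.forall_fin_two]
    refine ⟨⟨by simp, fun _ => hP⟩, fun _ => ?_, by simp⟩
    rw [theta_mul_theta, map_neg, LinearMap.neg_apply, hP, neg_zero]
  · rw [Fin.forall_fin_two, Fin.forall_fin_two, Fin.forall_fin_two]
    refine ⟨⟨by simp, fun _ => hQ⟩, fun _ => ?_, by simp⟩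
    rw [theta_mul_theta, map_neg, hQ, neg_zero]

theorem eval0_eta_eta : eval0 2 (eta 1 (eta 0 (theta 0 * theta 1))) = 1 := by
  simp [eta_one_eta_zero, partialTheta_theta_mul, partialX_theta_mul]

theorem eta_one' (i : Fin n) : eta i (1 : SuperPoly n) = 0 := by
  simp [eta_apply]

theorem opB_values : atOrigin (opB 2 lam mu) (theta 0) (theta 1) = 0 ∧
    atOrigin (opB 2 lam mu) (theta 0 * theta 1) 1 = 0 ∧
    atOrigin (opB 2 lam mu) 1 (theta 0 * theta 1) = 0 := by
  refine ⟨?_, ?_, ?_⟩ <;>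
    simp [opB_apply, eta_theta, eta_one', partialX_theta_mul]

theorem opC_values : atOrigin (opC (0 : Fin 2) 1 mu) (theta 0) (theta 0) = 0 ∧
    atOrigin (opC (0 : Fin 2) 1 mu) (theta 0) (theta 1) = -1 ∧
    atOrigin (opC (0 : Fin 2) 1 mu) (theta 0 * theta 1) 1 = 2 * mu ∧
    atOrigin (opC (0 : Fin 2) 1 mu) 1 (theta 0 * theta 1) = 0 := by
  refine ⟨?_, ?_, ?_, ?_⟩ <;>
    simp [opC_apply, skewOp_apply, eta_theta, eta_one', eval0_eta_eta]

theorem opD_values : atOrigin (opD (0 : Fin 2) 1 lam) (theta 0) (theta 0) = 0 ∧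
    atOrigin (opD (0 : Fin 2) 1 lam) (theta 0) (theta 1) = -1 ∧
    atOrigin (opD (0 : Fin 2) 1 lam) (theta 0 * theta 1) 1 = 0 ∧
    atOrigin (opD (0 : Fin 2) 1 lam) 1 (theta 0 * theta 1) = 2 * lam := by
  refine ⟨?_, ?_, ?_, ?_⟩ <;>
    simp [opD_apply, skewOp_apply, eta_theta, eta_one', eval0_eta_eta]

theorem opE_values : atOrigin (opE (0 : Fin 2) 1 lam) (theta 0) (theta 0) = 0 ∧
    atOrigin (opE (0 : Fin 2) 1 lam) (theta 0) (theta 1) = -(lam + 1 / 2) ∧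
    atOrigin (opE (0 : Fin 2) 1 lam) (theta 0 * theta 1) 1 = -(lam + 1) ∧
    atOrigin (opE (0 : Fin 2) 1 lam) 1 (theta 0 * theta 1) = -lam := by
  have r : ∀ F : SuperPoly 2, eta 0 (eta 1 F) = -eta 1 (eta 0 F) := fun F => by
    rw [eta_zero_one_comm, neg_neg]
  refine ⟨?_, ?_, ?_, ?_⟩ <;>
    simp [opE_apply, r, skewOp_apply, eta_theta, eta_one', eval0_eta_eta]

/-- Classification for `n = 2` with a second invariant operator `U`: it suffices to match the
values at the origin for a suitable multiple of `U`. -/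
theorem exists_eq_add_smul {T U : BinaryOp 2} (hT : IsContactInvariant lam mu (lam + mu + 1) T)
    (hU : IsContactInvariant lam mu (lam + mu + 1) U) (β : ℝ)
    (hS : atOrigin U (theta 0) (theta 0) = 0)
    (hR : atOrigin T (theta 0) (theta 1) = β * atOrigin U (theta 0) (theta 1))
    (hP : atOrigin T (theta 0 * theta 1) 1 = β * atOrigin U (theta 0 * theta 1) 1)
    (hQ : atOrigin T 1 (theta 0 * theta 1) = β * atOrigin U 1 (theta 0 * theta 1)) :
    ∃ α : ℝ, T = α • opB 2 lam mu + β • U := by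
  -- The factor `2` compensates the value `½` of `𝔟` at `(θ_0, θ_0)`; `U` vanishes there.
  refine ⟨2 * atOrigin T (theta 0) (theta 0), ?_⟩
  obtain ⟨b1, b2, b3⟩ := opB_values (lam := lam) (mu := mu)
  have b0 := atOrigin_opB_theta (lam := lam) (mu := mu) (0 : Fin 2)
  rw [← sub_eq_zero]
  have hinv := hT.sub (((isContactInvariant_opB lam mu).smul
    (2 * atOrigin T (theta 0) (theta 0))).add (hU.smul β))
  simp only [atOrigin_apply] at hS hR hP hQ b0 b1 b2 b3
  refine eq_zero_of_two hinv ?_ ?_ ?_ ?_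
  · simp [hS, b0]
    ring
  · simp [hR, b1]
  · simp [hP, b2]
  · simp [hQ, b3]

end TwoOddCoordinates

theorem isContactInvariant_zero : IsContactInvariant lam mu nu (0 : BinaryOp n) := by
  intro p H _ F G
  simp [actionHomogeneous, parityPart]

theorem isInvariantDifferential_opA (hnu : nu = lam + mu) :
    IsInvariantDifferential lam mu nu (opA n) :=
  ⟨isDifferential_opA, hnu ▸ isContactInvariant_opA lam mu⟩

theorem isInvariantDifferential_opB (hnu : nu = lam + mu + 1) :
    IsInvariantDifferential lam mu nu (opB n lam mu) :=
  ⟨isDifferential_opB lam mu, hnu ▸ isContactInvariant_opB lam mu⟩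

theorem invariant_iff_opA (hn : 2 ≤ n) (hnu : nu = lam + mu) (T : BinaryOp n) :
    IsInvariantDifferential lam mu nu T ↔ ∃ α : ℝ, T = α • opA n := by
  constructor
  · rintro ⟨-, hT⟩
    refine ⟨atOrigin T 1 1, sub_eq_zero.mp ?_⟩
    subst hnu
    refine eq_zero_of_weight_zero hn (hT.sub ((isContactInvariant_opA lam mu).smul _)) ?_
    simp [opA_apply]
  · rintro ⟨α, rfl⟩
    exact (isInvariantDifferential_opA hnu).smul α

theorem invariant_iff_opB (hn : 2 ≤ n) (hnu : nu = lam + mu + 1)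
    (h : 2 < n ∨ (n = 2 ∧ lam * mu * nu ≠ 0)) (T : BinaryOp n) :
    IsInvariantDifferential lam mu nu T ↔ ∃ α : ℝ, T = α • opB n lam mu := by
  constructor
  swap
  · rintro ⟨α, rfl⟩
    exact (isInvariantDifferential_opB hnu).smul α
  rintro ⟨-, hT⟩
  rcases h with h | ⟨rfl, h⟩
  · let a : Fin n := ⟨0, by omega⟩
    refine ⟨2 * atOrigin T (theta a) (theta a), sub_eq_zero.mp ?_⟩
    subst hnu
    refine eq_zero_of_three_le h (hT.sub ((isContactInvariant_opB lam mu).smul _)) a ?_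
    have b0 := atOrigin_opB_theta (lam := lam) (mu := mu) a
    simp only [atOrigin_apply] at b0
    simp [b0]
    ring
  · obtain ⟨h1, h2, h3⟩ := two_relations hT
    have hlam : lam ≠ 0 := fun h0 => h (by rw [h0]; ring)
    have hmu : mu ≠ 0 := fun h0 => h (by rw [h0]; ring)
    have hP : atOrigin T (theta 0 * theta 1) 1 = 0 := by
      have : (2 * (lam * nu)) * atOrigin T (theta 0 * theta 1) 1 = 0 := by
        rw [hnu]
        -- This combination of the three relations eliminates `R` and `Q`, leaving `2λ(λ + μ + 1)
        -- P`.
        linear_combination lam * h1 - mu * h2 + (1 + 2 * mu) * h3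
      refine (mul_eq_zero.mp this).resolve_left fun h0 => h ?_
      linear_combination (mu / 2) * h0
    have hQ : atOrigin T 1 (theta 0 * theta 1) = 0 := by
      rw [hP, mul_zero, zero_add] at h3
      exact (mul_eq_zero.mp h3).resolve_left hmu
    have hR : atOrigin T (theta 0) (theta 1) = 0 := by
      rw [hP, mul_zero, zero_add] at h1
      exact (mul_eq_zero.mp h1).resolve_left (by simpa using hmu)
    subst hnu
    -- All values other than those determined by `𝔟` vanish, so the second operator can be taken to
    -- be zero.
    obtain ⟨α, hα⟩ := exists_eq_add_smul hT isContactInvariant_zero 0 (by simp)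
      (by rw [hR, zero_mul]) (by rw [hP, zero_mul])
      (by rw [hQ, zero_mul])
    exact ⟨α, by rw [hα, zero_smul, add_zero]⟩

theorem invariant_iff_of_two {U : BinaryOp 2} (hU : IsInvariantDifferential lam mu nu U)
    (hnu : nu = lam + mu + 1)
    (h : ∀ T : BinaryOp 2, IsContactInvariant lam mu nu T →
      ∃ α β : ℝ, T = α • opB 2 lam mu + β • U) (T : BinaryOp 2) :
    IsInvariantDifferential lam mu nu T ↔ ∃ α β : ℝ, T = α • opB 2 lam mu + β • U := by
  constructor
  · rintro ⟨-, hT⟩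
    exact h T hT
  · rintro ⟨α, β, rfl⟩
    exact ((isInvariantDifferential_opB hnu).smul α).add (hU.smul β)

theorem invariant_iff_opC (hnu : nu = lam + mu + 1) (h : lam = 0) (T : BinaryOp 2) :
    IsInvariantDifferential lam mu nu T ↔
      ∃ α β : ℝ, T = α • opB 2 lam mu + β • opC 0 1 mu := by
  refine invariant_iff_of_two ⟨isDifferential_opC mu, isContactInvariant_opC hnu h⟩ hnu
    (fun T hT => ?_) T
  obtain ⟨h1, h2, h3⟩ := two_relations hT
  obtain ⟨c0, c1, c2, c3⟩ := opC_values (mu := mu)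
  have hU := isContactInvariant_opC hnu h
  subst hnu
  rw [h] at h1 h2 h3
  -- The value of `𝔠` at `(θ_0, θ_1)` is `-1`, which fixes `β`; at `λ = 0` the relations express `P`
  -- through `R` and force `Q = 0`.
  obtain ⟨α, hα⟩ := exists_eq_add_smul hT hU (-atOrigin T (theta 0) (theta 1)) c0
    (by rw [c1]; ring) (by rw [c2]; linarith) (by rw [c3]; linarith)
  exact ⟨α, _, hα⟩

theorem invariant_iff_opD (hnu : nu = lam + mu + 1) (h : mu = 0) (T : BinaryOp 2) :
    IsInvariantDifferential lam mu nu T ↔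
      ∃ α β : ℝ, T = α • opB 2 lam mu + β • opD 0 1 lam := by
  refine invariant_iff_of_two ⟨isDifferential_opD lam, isContactInvariant_opD hnu h⟩ hnu
    (fun T hT => ?_) T
  obtain ⟨h1, h2, h3⟩ := two_relations hT
  obtain ⟨c0, c1, c2, c3⟩ := opD_values (lam := lam)
  have hU := isContactInvariant_opD hnu h
  subst hnu
  rw [h] at h1 h2 h3
  obtain ⟨α, hα⟩ := exists_eq_add_smul hT hU (-atOrigin T (theta 0) (theta 1)) c0
    (by rw [c1]; ring) (by rw [c2]; linarith) (by rw [c3]; linarith)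
  exact ⟨α, _, hα⟩

theorem invariant_iff_opE (hnu : nu = lam + mu + 1) (h : nu = 0) (T : BinaryOp 2) :
    IsInvariantDifferential lam mu nu T ↔
      ∃ α β : ℝ, T = α • opB 2 lam mu + β • opE 0 1 lam := by
  refine invariant_iff_of_two ⟨isDifferential_opE lam, isContactInvariant_opE hnu h⟩ hnu
    (fun T hT => ?_) T
  obtain ⟨h1, h2, h3⟩ := two_relations hT
  obtain ⟨c0, c1, c2, c3⟩ := opE_values (lam := lam)
  have hU := isContactInvariant_opE hnu h
  have hmu : mu = -1 - lam := by linarith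
  subst hnu
  rw [hmu] at h1 h2 h3
  -- For `𝔢` the difference `Q - P` equals `1` for every `λ`, whereas each of `R`, `P`, `Q` vanishes
  -- for some `λ`. Hence `β` is read off from `Q - P`.
  obtain ⟨α, hα⟩ := exists_eq_add_smul hT hU
    (atOrigin T 1 (theta 0 * theta 1) - atOrigin T (theta 0 * theta 1) 1) c0
    (by rw [c1]; linarith) (by rw [c2]; linarith) (by rw [c3]; linarith)
  exact ⟨α, _, hα⟩

end

end SuperPoly

theorem theorem1 (n : ℕ) (hn : 2 ≤ n) (lam mu nu : ℝ) :
    (∀ T : SuperPoly.BinaryOp n, SuperPoly.IsInvariantDifferential lam mu nu T → T ≠ 0 →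
      nu = lam + mu ∨ nu = lam + mu + 1) ∧
    (nu = lam + mu → ∀ T : SuperPoly.BinaryOp n,
      SuperPoly.IsInvariantDifferential lam mu nu T ↔
        ∃ α : ℝ, T = α • SuperPoly.opA n) ∧
    (nu = lam + mu + 1 →
      ((2 < n ∨ (n = 2 ∧ lam * mu * nu ≠ 0)) → ∀ T : SuperPoly.BinaryOp n,
        SuperPoly.IsInvariantDifferential lam mu nu T ↔
          ∃ α : ℝ, T = α • SuperPoly.opB n lam mu) ∧
      (n = 2 → lam = 0 → ∀ T : SuperPoly.BinaryOp n,
        SuperPoly.IsInvariantDifferential lam mu nu T ↔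
          ∃ α β : ℝ, T = α • SuperPoly.opB n lam mu
            + β • SuperPoly.opC ⟨0, by omega⟩ ⟨1, by omega⟩ mu) ∧
      (n = 2 → mu = 0 → ∀ T : SuperPoly.BinaryOp n,
        SuperPoly.IsInvariantDifferential lam mu nu T ↔
          ∃ α β : ℝ, T = α • SuperPoly.opB n lam mu
            + β • SuperPoly.opD ⟨0, by omega⟩ ⟨1, by omega⟩ lam) ∧
      (n = 2 → nu = 0 → ∀ T : SuperPoly.BinaryOp n,
        SuperPoly.IsInvariantDifferential lam mu nu T ↔
          ∃ α β : ℝ, T = α • SuperPoly.opB n lam mu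
            + β • SuperPoly.opE ⟨0, by omega⟩ ⟨1, by omega⟩ lam)) := by
  refine ⟨fun T hT h0 => SuperPoly.weight_of_ne_zero hn hT.2 h0,
    fun hnu => SuperPoly.invariant_iff_opA hn hnu, fun hnu =>
    ⟨SuperPoly.invariant_iff_opB hn hnu, ?_, ?_, ?_⟩⟩
  -- After substituting `n = 2`, the indices `⟨0, _⟩` and `⟨1, _⟩` are definitionally `0` and `1` in
  -- `Fin 2`.
  · rintro rfl h
    exact SuperPoly.invariant_iff_opC hnu h
  · rintro rfl h
    exact SuperPoly.invariant_iff_opD hnu h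
  · rintro rfl h
    exact SuperPoly.invariant_iff_opE hnu h
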